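/- **Conventions.** For a symmetric real $N\times N$ matrix $J$ of signature $(1,N-1)$ write $u\cdot v=u^{T}Jv$ on $\mathbb R^{N}$ and $\|n\|=\sqrt{-n\cdot n}$ if $n\cdot n<0$. Fix $D$ with $D\cdot D>0$; let $\mathcal H=\{x: x\cdot x=1,\ x\cdot D>0\}$ (hyperbolic space) and $\mathcal L^{+}=\{x: x\cdot x=0,\ x\cdot D>0\}$, whose rays form $\partial\mathcal H$. For $E\in\mathcal L^{+}$, $\partial\mathcal H$ without the ray of $E$ is a Euclidean space $\partial\mathcal H_E\cong\mathbb R^{N-2}$ with the metric $|AB|_E^2=\frac{2A\cdot B}{(A\cdot E)(B\cdot E)}$. A vector $n$ with $n\cdot n<0$ represents the oriented sphere whose closed side is $\{x\in\partial\mathcal H: n\cdot x\le 0\}$. * A *packing* is a set $\mathcal P\subset\mathbb R^{N}$ such that for some $k>0$, $n\cdot n=-k$ for all $n\in\mathcal P$, and $n\cdot n'\ge k$ and $n'\neq -n$ for all $n\ne n'$ in $\mathcal P$. A *perspective* of $\mathcal P$ is the set of the oriented spheres of $\mathcal P$, seen in $\mathbb R^{N-2}\cup\{\infty\}$ through an isometry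 $\partial\mathcal H_E\cong\mathbb R^{N-2}$ with $E\mapsto\infty$, for some $E\in\mathcal L^+$. * $\mathcal P$ is *crystallographic* if there are a full lattice $\Lambda\subset\mathbb R^{N}$, a group $\Gamma$ of linear maps that preserve the product, $\mathcal H$ and $\Lambda$ and that has a convex fundamental domain in $\mathcal H$ with finitely many faces, and a finite set $S\subset\Lambda$ of vectors of negative square, with $\mathcal P=\{\gamma n/\|\gamma n\|:\gamma\in\Gamma,\ n\in S\}$. It is a *Boyd–Maxwell packing* if $\Gamma$ can be taken to be generated by finitely many reflections. * $\mathcal P$ is *maximal* if no sphere of positive radius fits into the residual set $\{x\in\mathcal L^+: n\cdot x>0\ \forall n\in\mathcal P\}$. It is *Apollonian* if it is crystallographic and maximal, and each member lies in a set of $N$ members that are mutually tangent (distinct planes with $|n\cdot n'|=\|n\|\,\|n'\|$). * Let $J$ be the incidence matrix of the Coxeter graph $T_{2,3,8}$ on $N=11$ nodes: the path $\alpha_0-\alpha_1-\cdots-\alpha_9$ with a further node $\alpha_{10}$ joined to $\alpha_7$, with $\alpha_i\cdot\alpha_i=-2$, $\alpha_i\cdot\alpha_j=1$ on edges and $0$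 otherwise; the $\alpha_i$ are the standard basis of $\mathbb R^{11}$. Let $w_i$ be the weights, $w_i\cdot\alpha_j=\delta_{ij}$, let $D=\sum_i w_i$, let $\Gamma$ be the group generated by the reflections in the $\alpha_i$, and let $\mathcal P$ be the set of all $\gamma w_i/\|\gamma w_i\|$ with $\gamma\in\Gamma$ and $w_i\cdot w_i<0$. **Statement.** 1. $J$ has signature $(1,10)$ and $D\cdot D>0$. The only weight of negative square is $w_0$, and its plane is different from and tangent at infinity to the plane of $\alpha_0$. So $\mathcal P$ is the $\Gamma$-orbit of the normalized weight $w_0$. 2. Let $H$ be an $8$-dimensional linear subspace of $\mathbb R^{9}$ with unit normal $h$, and let $L\subset H$ be a copy of the $E_8$ lattice (the image of the standard $E_8\subset\mathbb R^{8}$ under a linear isometry $\mathbb R^{8}\to H$). Take the balls of radius $1/\sqrt2$ centred at the points of $L$ and the two half spaces bounded by the hyperplanes parallel to $H$ at distance $1/\sqrt2$ that do not contain $H$. The sphere about the origin touches the two hyperplanes at $A=h/\sqrt2$ and $B=-h/\sqrt2$; let $\sigma$ be the inversion in the sphere centred at $A$ through $B$. Let $G$ be the group of transformations of $\mathbb R^{9}\cup\{\infty\}$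 generated by $\sigma$, by the symmetries of $L$ (the isometries of $H$ that map $L$ onto itself, acting trivially in the direction of $h$), and by the reflection in $H$. Then the set of all images of these balls and half spaces under $G$ is a sphere packing in $\mathbb R^{9}$: its members are oriented spheres (balls, outsides of balls or half spaces), and distinct members have disjoint interiors and are not complementary. It is a perspective of $\mathcal P$. 3. $\mathcal P$ is a Boyd–Maxwell packing. 4. $\mathcal P$ is Apollonian (in nine dimensions: crystallographic, maximal, and each sphere lies in a cluster of $11$ mutually tangent spheres). -/

import Mathlib

open scoped OnePoint

noncomputable section

/-! ### Lorentz space, hyperbolic space and its boundary -/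

/-- The product `u ⬝ v = uᵀ J v` on `N`-tuples of real numbers. -/
def lorentz {N : ℕ} (J : Matrix (Fin N) (Fin N) ℝ) : LinearMap.BilinForm ℝ (Fin N → ℝ) :=
  Matrix.toBilin' J

/-- `J` is symmetric of signature `(1, N - 1)`, where `N = m + 1`. -/
def IsLorentzian {m : ℕ} (J : Matrix (Fin (m + 1)) (Fin (m + 1)) ℝ) : Prop :=
  J.IsSymm ∧ ∃ Q : Matrix (Fin (m + 1)) (Fin (m + 1)) ℝ, IsUnit Q.det ∧
    Q.transpose * J * Q = Matrix.diagonal (Fin.cons 1 fun _ => -1)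

/-- The length `√(-n ⬝ n)` of a vector of negative square. -/
def lorentzLength {N : ℕ} (J : Matrix (Fin N) (Fin N) ℝ) (n : Fin N → ℝ) : ℝ :=
  Real.sqrt (-lorentz J n n)

/-- The sheet of the hyperboloid `x ⬝ x = 1` singled out by the vector `D`. -/
def hyperbolicSpace {N : ℕ} (J : Matrix (Fin N) (Fin N) ℝ) (D : Fin N → ℝ) : Set (Fin N → ℝ) :=
  {x | lorentz J x x = 1 ∧ 0 < lorentz J x D}

/-- The half `𝓛⁺` of the light cone singled out by `D`; its rays are the points at infinity. -/
def lightCone {N : ℕ} (J : Matrix (Fin N) (Fin N) ℝ) (D : Fin N → ℝ) : Set (Fin N → ℝ) :=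
  {x | lorentz J x x = 0 ∧ 0 < lorentz J x D}

/-- The reflection `x ↦ x - 2 (n ⬝ x) / (n ⬝ n) n` in the plane `n ⬝ x = 0`
(the identity if `n ⬝ n = 0`; it is used only for `n ⬝ n < 0`). -/
def lorentzReflection {N : ℕ} (J : Matrix (Fin N) (Fin N) ℝ) (n : Fin N → ℝ) :
    (Fin N → ℝ) ≃ₗ[ℝ] (Fin N → ℝ) :=
  LinearEquiv.ofInvolutive
    (LinearMap.id - (2 / lorentz J n n) • (lorentz J n).smulRight n) (by
      intro x
      simp only [LinearMap.sub_apply, LinearMap.id_apply, LinearMap.smul_apply,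
        LinearMap.smulRight_apply, map_sub, map_smul]
      by_cases h : lorentz J n n = 0
      · simp [h]
      · ext i
        simp only [Pi.sub_apply, Pi.smul_apply, smul_eq_mul]
        field_simp
        ring)

theorem lorentzReflection_apply {N : ℕ} (J : Matrix (Fin N) (Fin N) ℝ) (n x : Fin N → ℝ) :
    lorentzReflection J n x = x - (2 * lorentz J n x / lorentz J n n) • n := by
  change x - (2 / lorentz J n n) • (lorentz J n x • n) = _
  rw [smul_smul, div_mul_eq_mul_div]

/-- `T` preserves the Lorentz product and maps the hyperbolic space onto itself. -/
def IsHyperbolicIsometry {N : ℕ} (J : Matrix (Fin N) (Fin N) ℝ) (D : Fin N → ℝ)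
    (T : (Fin N → ℝ) ≃ₗ[ℝ] (Fin N → ℝ)) : Prop :=
  (∀ u v, lorentz J (T u) (T v) = lorentz J u v) ∧
    T '' hyperbolicSpace J D = hyperbolicSpace J D

/-- `Λ` is a lattice of full rank in `ℝᴺ`. -/
def IsFullLattice {N : ℕ} (Λ : Submodule ℤ (Fin N → ℝ)) : Prop :=
  ∃ b : Module.Basis (Fin N) ℝ (Fin N → ℝ), Λ = Submodule.span ℤ (Set.range b)

/-- `Γ` has a convex fundamental domain in the hyperbolic space with finitely many faces: a
finite intersection of half spaces whose images cover, the images of the interior under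
nontrivial elements being disjoint from the interior. -/
def IsGeometricallyFinite {N : ℕ} (J : Matrix (Fin N) (Fin N) ℝ) (D : Fin N → ℝ)
    (Γ : Subgroup ((Fin N → ℝ) ≃ₗ[ℝ] (Fin N → ℝ))) : Prop :=
  ∃ A : Set (Fin N → ℝ), A.Finite ∧ (∀ a ∈ A, lorentz J a a < 0) ∧
    (∀ x ∈ hyperbolicSpace J D, ∃ γ ∈ Γ, ∀ a ∈ A, 0 ≤ lorentz J a (γ x)) ∧
    (∀ γ ∈ Γ, γ ≠ 1 → ∀ x ∈ hyperbolicSpace J D,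
      ¬((∀ a ∈ A, 0 < lorentz J a x) ∧ ∀ a ∈ A, 0 < lorentz J a (γ x)))

/-! ### Packings in Lorentz space -/

/-- All vectors of `P` have the same negative square `-k`, and two different ones have product
at least `k`; the trivial packing, a sphere with its complement, is excluded. -/
def IsPacking {N : ℕ} (J : Matrix (Fin N) (Fin N) ℝ) (P : Set (Fin N → ℝ)) : Prop :=
  ∃ k : ℝ, 0 < k ∧ (∀ n ∈ P, lorentz J n n = -k) ∧
    ∀ n ∈ P, ∀ n' ∈ P, n ≠ n' → k ≤ lorentz J n n' ∧ n' ≠ -n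

/-- The set `{γ n / ‖γ n‖ : γ ∈ Γ, n ∈ S}`. -/
def normalizedOrbit {N : ℕ} (J : Matrix (Fin N) (Fin N) ℝ)
    (Γ : Subgroup ((Fin N → ℝ) ≃ₗ[ℝ] (Fin N → ℝ))) (S : Set (Fin N → ℝ)) : Set (Fin N → ℝ) :=
  {v | ∃ γ ∈ Γ, ∃ n ∈ S, v = (lorentzLength J (γ n))⁻¹ • γ n}

/-- `P = Γ(S)` for a finite subset `S` of a lattice `Λ` and a geometrically finite group `Γ` of
hyperbolic isometries that preserve `Λ`. -/
def IsCrystallographicFor {N : ℕ} (J : Matrix (Fin N) (Fin N) ℝ) (D : Fin N → ℝ)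
    (Γ : Subgroup ((Fin N → ℝ) ≃ₗ[ℝ] (Fin N → ℝ))) (P : Set (Fin N → ℝ)) : Prop :=
  ∃ Λ : Submodule ℤ (Fin N → ℝ), IsFullLattice Λ ∧
    (∀ γ ∈ Γ, IsHyperbolicIsometry J D γ ∧ γ '' (Λ : Set (Fin N → ℝ)) = Λ) ∧
    IsGeometricallyFinite J D Γ ∧
    ∃ S : Set (Fin N → ℝ), S.Finite ∧ S ⊆ Λ ∧ (∀ n ∈ S, lorentz J n n < 0) ∧
      P = normalizedOrbit J Γ S

/-- A crystallographic packing. -/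
def IsCrystallographicPacking {N : ℕ} (J : Matrix (Fin N) (Fin N) ℝ) (D : Fin N → ℝ)
    (P : Set (Fin N → ℝ)) : Prop :=
  IsPacking J P ∧ ∃ Γ, IsCrystallographicFor J D Γ P

/-- A Boyd–Maxwell packing: a crystallographic packing whose group can be taken to be generated
by finitely many reflections. -/
def IsBoydMaxwellPacking {N : ℕ} (J : Matrix (Fin N) (Fin N) ℝ) (D : Fin N → ℝ)
    (P : Set (Fin N → ℝ)) : Prop :=
  IsPacking J P ∧ ∃ A : Set (Fin N → ℝ), A.Finite ∧ (∀ a ∈ A, lorentz J a a < 0) ∧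
    IsCrystallographicFor J D (Subgroup.closure (lorentzReflection J '' A)) P

/-- The residual set (as a set of light-like vectors): the points at infinity that lie on the
positive side of all the planes of `P`, that is, in none of the closed balls. -/
def residualSet {N : ℕ} (J : Matrix (Fin N) (Fin N) ℝ) (D : Fin N → ℝ)
    (P : Set (Fin N → ℝ)) : Set (Fin N → ℝ) :=
  {x | x ∈ lightCone J D ∧ ∀ n ∈ P, 0 < lorentz J n x}

/-- No further sphere of positive radius fits into the residual set. -/
def IsMaximalPacking {N : ℕ} (J : Matrix (Fin N) (Fin N) ℝ) (D : Fin N → ℝ)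
    (P : Set (Fin N → ℝ)) : Prop :=
  ¬∃ m : Fin N → ℝ, lorentz J m m < 0 ∧
    ∀ x ∈ lightCone J D, lorentz J m x ≤ 0 → x ∈ residualSet J D P

/-- The planes `n ⬝ x = 0` and `n' ⬝ x = 0` are different and tangent at infinity. -/
def AreTangent {N : ℕ} (J : Matrix (Fin N) (Fin N) ℝ) (n n' : Fin N → ℝ) : Prop :=
  LinearIndependent ℝ ![n, n'] ∧
    |lorentz J n n'| = lorentzLength J n * lorentzLength J n'

/-- Every sphere is a member of a cluster of `N` mutually tangent spheres of `P`. -/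
def HasApollonianProperty {N : ℕ} (J : Matrix (Fin N) (Fin N) ℝ) (P : Set (Fin N → ℝ)) : Prop :=
  ∀ n ∈ P, ∃ c : Finset (Fin N → ℝ), n ∈ c ∧ (c : Set (Fin N → ℝ)) ⊆ P ∧ c.card = N ∧
    (c : Set (Fin N → ℝ)).Pairwise (AreTangent J)

/-- An Apollonian packing: crystallographic, maximal, with the Apollonian property. -/
def IsApollonianPacking {N : ℕ} (J : Matrix (Fin N) (Fin N) ℝ) (D : Fin N → ℝ)
    (P : Set (Fin N → ℝ)) : Prop :=
  IsCrystallographicPacking J D P ∧ IsMaximalPacking J D P ∧ HasApollonianProperty J P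

/-! ### The packing of a Coxeter graph -/

open Classical in
/-- The incidence matrix of a Coxeter graph with regular edges only, whose nodes `αᵢ` have
norm `-2`. The vectors `αᵢ` are the standard basis vectors. -/
def coxeterGram {N : ℕ} (G : SimpleGraph (Fin N)) : Matrix (Fin N) (Fin N) ℝ :=
  Matrix.of fun i j => if i = j then -2 else if G.Adj i j then 1 else 0

/-- The Weyl group, generated by the reflections in the nodes. -/
def weylGroup {N : ℕ} (J : Matrix (Fin N) (Fin N) ℝ) :
    Subgroup ((Fin N → ℝ) ≃ₗ[ℝ] (Fin N → ℝ)) :=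
  Subgroup.closure (Set.range fun i : Fin N => lorentzReflection J (Pi.single i 1))

/-- The weights `wᵢ`, for which `wᵢ ⬝ αⱼ = δᵢⱼ` (for an invertible symmetric `J`). -/
def weight {N : ℕ} (J : Matrix (Fin N) (Fin N) ℝ) (i : Fin N) : Fin N → ℝ :=
  Matrix.mulVec J⁻¹ (Pi.single i 1)

/-- The sum of the weights, a vector `D` with `D ⬝ αⱼ = 1` for all `j`. -/
def weylVector {N : ℕ} (J : Matrix (Fin N) (Fin N) ℝ) : Fin N → ℝ :=
  ∑ i, weight J i

/-- The packing of a Coxeter graph: the images under the Weyl group of those weights that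
represent planes, normalized to length `1`. -/
def coxeterPacking {N : ℕ} (J : Matrix (Fin N) (Fin N) ℝ) : Set (Fin N → ℝ) :=
  normalizedOrbit J (weylGroup J) {w | ∃ i, w = weight J i ∧ lorentz J w w < 0}

/-- The tree `T₂,₃,₈` on eleven nodes: the path `0 - 1 - ⋯ - 9` and the edge `7 - 10`. Its
branches from the node `7` (counted with this node) have `2`, `3` and `8` nodes. -/
def treeT238 : SimpleGraph (Fin 11) :=
  SimpleGraph.fromRel fun i j =>
    (i.val + 1 = j.val ∧ j.val ≤ 9) ∨ (i.val = 7 ∧ j.val = 10)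

/-- The incidence matrix of the Coxeter graph `T₂,₃,₈`. -/
abbrev gramT238 : Matrix (Fin 11) (Fin 11) ℝ := coxeterGram treeT238

/-! ### Configurations of oriented spheres in Euclidean space -/

/-- The closed ball, as a subset of `ℝⁿ ∪ {∞}`. -/
def ballCap {n : ℕ} (x : EuclideanSpace ℝ (Fin n)) (r : ℝ) :
    Set (OnePoint (EuclideanSpace ℝ (Fin n))) :=
  OnePoint.some '' Metric.closedBall x r

/-- The closed half space `u ⬝ y ≥ t`, as a subset of `ℝⁿ ∪ {∞}` that contains `∞`. -/
def halfSpaceCap {n : ℕ} (u : EuclideanSpace ℝ (Fin n)) (t : ℝ) :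
    Set (OnePoint (EuclideanSpace ℝ (Fin n))) :=
  insert ∞ (OnePoint.some '' {y | t ≤ inner ℝ u y})

/-- An oriented sphere, given by the closed side that it includes: a ball, the outside of a
ball, or a half space. -/
def IsOrientedSphere {n : ℕ} (c : Set (OnePoint (EuclideanSpace ℝ (Fin n)))) : Prop :=
  (∃ x, ∃ r > 0, c = ballCap x r) ∨
  (∃ x, ∃ r > 0, c = (OnePoint.some '' Metric.ball x r)ᶜ) ∨
  (∃ u, ∃ t, u ≠ 0 ∧ c = halfSpaceCap u t)

/-- A sphere packing in `ℝⁿ`: oriented spheres that intersect tangentially or not at all; the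
trivial packing, a sphere with its complement, is excluded. -/
def IsSpherePacking {n : ℕ} (C : Set (Set (OnePoint (EuclideanSpace ℝ (Fin n))))) : Prop :=
  (∀ c ∈ C, IsOrientedSphere c) ∧
    C.Pairwise fun c c' => Disjoint (interior c) (interior c') ∧ c ∪ c' ≠ Set.univ

/-- `Φ` identifies `ℝⁿ` isometrically with the boundary of the hyperbolic space without the
point `E`, with the metric `|AB|² = 2 (A ⬝ B) / ((A ⬝ E) (B ⬝ E))`; `Φ x` is a representative
of a ray of light-like vectors. -/
structure IsBoundaryChart {N n : ℕ} (J : Matrix (Fin N) (Fin N) ℝ) (D E : Fin N → ℝ)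
    (Φ : EuclideanSpace ℝ (Fin n) → (Fin N → ℝ)) : Prop where
  mem : ∀ x, Φ x ∈ lightCone J D ∧ ¬SameRay ℝ (Φ x) E
  surj : ∀ A ∈ lightCone J D, ¬SameRay ℝ A E → ∃ x, SameRay ℝ A (Φ x)
  dist_sq : ∀ x y, dist x y ^ 2 =
    2 * lorentz J (Φ x) (Φ y) / (lorentz J (Φ x) E * lorentz J (Φ y) E)

/-- The configuration `C` in `ℝⁿ` is a perspective of `P`: for some point `E` at infinity, and
an isometric identification of the rest of the boundary with `ℝⁿ`, the oriented spheres in `C`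
are the closed sides `n ⬝ x ≤ 0` of the planes of `P`. -/
def IsPerspective {N n : ℕ} (J : Matrix (Fin N) (Fin N) ℝ) (D : Fin N → ℝ)
    (P : Set (Fin N → ℝ)) (C : Set (Set (OnePoint (EuclideanSpace ℝ (Fin n))))) : Prop :=
  ∃ E ∈ lightCone J D, ∃ Φ : EuclideanSpace ℝ (Fin n) → (Fin N → ℝ),
    IsBoundaryChart J D E Φ ∧
    C = {c | ∃ m ∈ P, c = {p | lorentz J m (p.elim E Φ) ≤ 0}}

/-! ### The construction from the `E₈` lattice -/

/-- The `E₈` lattice: all coordinates are integers, or all are half-integers, and their sum is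
an even integer. -/
def latticeE8 : Set (EuclideanSpace ℝ (Fin 8)) :=
  {x | ((∀ i, ∃ z : ℤ, x i = z) ∨ (∀ i, ∃ z : ℤ, x i = z + 1 / 2)) ∧
    ∃ k : ℤ, ∑ i, x i = 2 * k}

open Classical in
/-- Inversion in the sphere with centre `c` and radius `R > 0`, extended to `ℝⁿ ∪ {∞}`. -/
def inversionOnePoint {n : ℕ} (c : EuclideanSpace ℝ (Fin n)) (R : ℝ)
    (p : OnePoint (EuclideanSpace ℝ (Fin n))) : OnePoint (EuclideanSpace ℝ (Fin n)) :=
  p.elim (OnePoint.some c) fun x =>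
    if x = c then ∞ else OnePoint.some (EuclideanGeometry.inversion c R x)

/-- The initial oriented spheres: balls of radius `1/√2` at the points of the copy `ι(E₈)` of
the lattice, and the half spaces beyond the two parallel hyperplanes at distance `1/√2`. -/
def initialSpheres (ι : EuclideanSpace ℝ (Fin 8) →ₗᵢ[ℝ] EuclideanSpace ℝ (Fin 9))
    (h : EuclideanSpace ℝ (Fin 9)) : Set (Set (OnePoint (EuclideanSpace ℝ (Fin 9)))) :=
  {c | (∃ x ∈ latticeE8, c = ballCap (ι x) (1 / Real.sqrt 2)) ∨
    c = halfSpaceCap h (1 / Real.sqrt 2) ∨ c = halfSpaceCap (-h) (1 / Real.sqrt 2)}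

/-- The group of transformations of `ℝ⁹ ∪ {∞}` generated by the symmetries of the lattice
`ι(E₈)` in its hyperplane (isometries of the hyperplane, acting trivially in the normal
direction `h`), the reflection in the hyperplane, and the inversion `σ` in the sphere centred
at `A = h/√2` that goes through `B = -h/√2`. -/
def constructionGroup (ι : EuclideanSpace ℝ (Fin 8) →ₗᵢ[ℝ] EuclideanSpace ℝ (Fin 9))
    (h : EuclideanSpace ℝ (Fin 9)) :
    Subgroup (Equiv.Perm (OnePoint (EuclideanSpace ℝ (Fin 9)))) :=
  Subgroup.closure
    ({g | ∃ f : EuclideanSpace ℝ (Fin 9) ≃ᵢ EuclideanSpace ℝ (Fin 9),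
        f '' (ι '' latticeE8) = ι '' latticeE8 ∧ (∀ y, inner ℝ h (f y) = inner ℝ h y) ∧
        g = f.toHomeomorph.onePointCongr.toEquiv} ∪
     {(Submodule.reflection (LinearMap.range ι.toLinearMap)
        ).toIsometryEquiv.toHomeomorph.onePointCongr.toEquiv} ∪
     {g | ∀ p, g p = inversionOnePoint ((1 / Real.sqrt 2) • h)
        (dist ((1 / Real.sqrt 2) • h) (-((1 / Real.sqrt 2) • h))) p})

/-- The configuration: all images of the initial oriented spheres under the group. -/
def stripConfiguration (ι : EuclideanSpace ℝ (Fin 8) →ₗᵢ[ℝ] EuclideanSpace ℝ (Fin 9))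
    (h : EuclideanSpace ℝ (Fin 9)) : Set (Set (OnePoint (EuclideanSpace ℝ (Fin 9)))) :=
  {c | ∃ g ∈ constructionGroup ι h, ∃ c₀ ∈ initialSpheres ι h, c = g '' c₀}

end

/-! Write s_i for the reflection in α_i and Γ for the Weyl group. The weights are dual to the nodes,
so the product with w_j is the j-th coordinate (`lorentz_weight_right`). The length argument for
Coxeter groups (`root_nonneg`) shows that γα_i has nonnegative coordinates whenever s_i does not
shorten γ. Hence an image of w_k dominates w_k in every coordinate, and if it differs from w_k, it
exceeds it by at least 1 in coordinate k (`weight_orbit`). As w_0 ⬝ w_0 = -1/2, distinct members of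
the orbit of w_0 have product at least 1/2. After normalization this is the packing inequality
(`one_le_lorentz_of_mem_coxeterPacking`).

The chamber of nonnegative products with the nodes is a fundamental domain: a γ that minimizes γD ⬝
x gives γ⁻¹x in the chamber, and a nontrivial element sends some node to a nonpositive vector. The
reflections have integral matrices, so the packing is of Boyd–Maxwell type.

Maximality rests on two facts. The inverse Gram matrix has a single negative entry, at (0,0), which
forces every light-like vector of the chamber onto the closed negative side of w_0
(`lorentz_weight_zero_nonpos_of_dominant`). A light-like vector with integral products can be moved
into the chamber by Γ, hence lies in a closed ball of the packing. The rays of such vectors are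
dense at infinity, so no sphere fits into the residual set.

For the Euclidean picture, Lorentz space is identified with ℝ⁹ ⊕ ℝ ⊕ ℝ, with the light-like weight
w_1 as the point ∞. Nodes 2 to 10 become the affine E₈ diagram in H, node 0 the reflection in H,
node 1 the inversion σ, and w_0 a half space. All reflections of Γ then lie in the construction
group. Conversely Γ contains the lattice translations and all affine root reflections, so linear
symmetries of the lattice normalize it and fix w_0. Thus the construction group preserves the orbit
of w_0; this orbit contains the initial spheres, and the configuration is exactly that orbit
(`stripConfiguration_eq`).

The Apollonian cluster consists of the two half spaces and nine balls centred at the vertices of a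
regular simplex of edge √2 in E₈; Γ carries it to every member. -/

noncomputable section

/-! ### Products and reflections -/

section Lorentz

variable {N : ℕ} {J : Matrix (Fin N) (Fin N) ℝ}

theorem lorentz_single_left (i : Fin N) (x : Fin N → ℝ) :
    lorentz J (Pi.single i 1) x = ∑ j, J i j * x j := by
  rw [lorentz, Matrix.toBilin'_apply']
  simp [Matrix.mulVec, dotProduct, Pi.single_apply]

theorem lorentz_single_single (i j : Fin N) :
    lorentz J (Pi.single i 1) (Pi.single j 1) = J i j := by
  simp [lorentz]

theorem lorentz_comm (hJ : J.IsSymm) (u v : Fin N → ℝ) : lorentz J u v = lorentz J v u := by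
  simp only [lorentz, Matrix.toBilin'_apply]
  rw [Finset.sum_comm]
  refine Finset.sum_congr rfl fun i _ => Finset.sum_congr rfl fun j _ => ?_
  rw [hJ.apply]; ring

/-- Expansion of the product along the coordinates of the first vector. -/
theorem lorentz_eq_sum (u v : Fin N → ℝ) :
    lorentz J u v = ∑ i, u i * lorentz J (Pi.single i 1) v := by
  conv_lhs => rw [← Finset.univ_sum_single u]
  rw [map_sum, LinearMap.sum_apply]
  refine Finset.sum_congr rfl fun i _ => ?_
  have : (Pi.single i (u i) : Fin N → ℝ) = u i • Pi.single i 1 := by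
    rw [← Pi.single_smul]; simp
  rw [this]; simp

/-- A linear automorphism that preserves the product. -/
def PreservesProduct (J : Matrix (Fin N) (Fin N) ℝ) (T : (Fin N → ℝ) ≃ₗ[ℝ] (Fin N → ℝ)) : Prop :=
  ∀ u v, lorentz J (T u) (T v) = lorentz J u v

theorem PreservesProduct.inv {T : (Fin N → ℝ) ≃ₗ[ℝ] (Fin N → ℝ)} (h : PreservesProduct J T) :
    PreservesProduct J T⁻¹ := fun u v => by
  have := h (T⁻¹ u) (T⁻¹ v)
  rw [← LinearEquiv.mul_apply, ← LinearEquiv.mul_apply] at this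
  simpa using this.symm

theorem preservesProduct_lorentzReflection (hJ : J.IsSymm) (n : Fin N → ℝ) :
    PreservesProduct J (lorentzReflection J n) := fun u v => by
  simp only [lorentzReflection_apply, map_sub, map_smul, LinearMap.sub_apply,
    LinearMap.smul_apply, smul_eq_mul]
  rw [lorentz_comm hJ u n]
  by_cases h : lorentz J n n = 0
  · simp [h]
  · field_simp
    ring

theorem lorentzReflection_mul_self (n : Fin N → ℝ) :
    lorentzReflection J n * lorentzReflection J n = 1 := by
  ext1 x
  exact (lorentzReflection J n).left_inv x

theorem lorentzReflection_inv (n : Fin N → ℝ) :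
    (lorentzReflection J n)⁻¹ = lorentzReflection J n :=
  inv_eq_of_mul_eq_one_left (lorentzReflection_mul_self n)

/-- Conjugation moves the mirror along. This yields the commutation and braid relations without
matrix products. -/
theorem PreservesProduct.conj_lorentzReflection {T : (Fin N → ℝ) ≃ₗ[ℝ] (Fin N → ℝ)}
    (h : PreservesProduct J T) (n : Fin N → ℝ) :
    T * lorentzReflection J n * T⁻¹ = lorentzReflection J (T n) := by
  ext1 x
  obtain ⟨y, rfl⟩ := T.surjective x
  have hy : T⁻¹ (T y) = y := T.symm_apply_apply y
  simp only [LinearEquiv.mul_apply, hy, lorentzReflection_apply, map_sub, map_smul, h n y, h n n]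

end Lorentz

/-! ### Weyl groups of simply laced Coxeter graphs -/

section Coxeter

variable {N : ℕ} (G : SimpleGraph (Fin N))

theorem coxeterGram_isSymm : (coxeterGram G).IsSymm := by
  ext i j
  simp only [Matrix.transpose_apply, coxeterGram, Matrix.of_apply, eq_comm (a := j)]
  by_cases h : G.Adj i j
  · simp [h, h.symm]
  · simp [h, mt G.adj_symm h]

theorem coxeterGram_self (i : Fin N) : coxeterGram G i i = -2 := by
  simp [coxeterGram]

theorem coxeterGram_adj {i j : Fin N} (h : G.Adj i j) : coxeterGram G i j = 1 := by
  simp [coxeterGram, h, h.ne]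

theorem coxeterGram_not_adj {i j : Fin N} (hij : i ≠ j) (h : ¬G.Adj i j) :
    coxeterGram G i j = 0 := by
  simp [coxeterGram, h, hij]

/-- The reflection in a node. -/
def simpleReflection (i : Fin N) : (Fin N → ℝ) ≃ₗ[ℝ] (Fin N → ℝ) :=
  lorentzReflection (coxeterGram G) (Pi.single i 1)

theorem simpleReflection_apply (i : Fin N) (x : Fin N → ℝ) :
    simpleReflection G i x =
      x + lorentz (coxeterGram G) (Pi.single i 1) x • (Pi.single i 1 : Fin N → ℝ) := by
  rw [simpleReflection, lorentzReflection_apply, lorentz_single_single, coxeterGram_self,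
    mul_div_assoc, sub_eq_add_neg, ← neg_smul]
  congr 2
  ring

theorem simpleReflection_self (i : Fin N) :
    simpleReflection G i (Pi.single i 1) = -Pi.single i 1 := by
  rw [simpleReflection_apply, lorentz_single_single, coxeterGram_self]
  module

theorem simpleReflection_adj {i j : Fin N} (h : G.Adj i j) :
    simpleReflection G i (Pi.single j 1) = Pi.single j 1 + Pi.single i 1 := by
  rw [simpleReflection_apply, lorentz_single_single, coxeterGram_adj G h, one_smul]

theorem simpleReflection_not_adj {i j : Fin N} (hij : i ≠ j) (h : ¬G.Adj i j) :
    simpleReflection G i (Pi.single j 1) = Pi.single j 1 := by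
  rw [simpleReflection_apply, lorentz_single_single, coxeterGram_not_adj G hij h, zero_smul,
    add_zero]

theorem simpleReflection_mul_self (i : Fin N) :
    simpleReflection G i * simpleReflection G i = 1 :=
  lorentzReflection_mul_self _

theorem simpleReflection_inv (i : Fin N) : (simpleReflection G i)⁻¹ = simpleReflection G i :=
  lorentzReflection_inv _

theorem preservesProduct_simpleReflection (i : Fin N) :
    PreservesProduct (coxeterGram G) (simpleReflection G i) :=
  preservesProduct_lorentzReflection (coxeterGram_isSymm G) _

theorem simpleReflection_commute {i j : Fin N} (hij : i ≠ j) (h : ¬G.Adj i j) :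
    simpleReflection G i * simpleReflection G j = simpleReflection G j * simpleReflection G i := by
  have := (preservesProduct_simpleReflection G i).conj_lorentzReflection (Pi.single j 1)
  rw [simpleReflection_not_adj G hij h, mul_inv_eq_iff_eq_mul] at this
  exact this

/-- Both sides are the reflection in α_i + α_j = s_i α_j = s_j α_i. -/
theorem simpleReflection_braid {i j : Fin N} (h : G.Adj i j) :
    simpleReflection G i * simpleReflection G j * simpleReflection G i =
      simpleReflection G j * simpleReflection G i * simpleReflection G j := by
  have h1 := (preservesProduct_simpleReflection G i).conj_lorentzReflection (Pi.single j 1)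
  have h2 := (preservesProduct_simpleReflection G j).conj_lorentzReflection (Pi.single i 1)
  rw [simpleReflection_adj G h, simpleReflection_inv] at h1
  rw [simpleReflection_adj G h.symm, simpleReflection_inv, add_comm, ← h1] at h2
  exact h2.symm

theorem simpleReflection_mem (i : Fin N) : simpleReflection G i ∈ weylGroup (coxeterGram G) :=
  Subgroup.subset_closure ⟨i, rfl⟩

theorem preservesProduct_of_mem_weylGroup {γ : (Fin N → ℝ) ≃ₗ[ℝ] (Fin N → ℝ)}
    (hγ : γ ∈ weylGroup (coxeterGram G)) : PreservesProduct (coxeterGram G) γ := by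
  induction hγ using Subgroup.closure_induction with
  | mem x hx =>
    obtain ⟨i, rfl⟩ := hx
    exact preservesProduct_simpleReflection G i
  | one => exact fun _ _ => rfl
  | mul x y _ _ hx hy => exact fun u v => (hx _ _).trans (hy u v)
  | inv x _ hx => exact hx.inv

/-- The product of the reflections in a word of nodes. -/
def wordProd (l : List (Fin N)) : (Fin N → ℝ) ≃ₗ[ℝ] (Fin N → ℝ) :=
  (l.map (simpleReflection G)).prod

theorem wordProd_concat (l : List (Fin N)) (i : Fin N) :
    wordProd G (l ++ [i]) = wordProd G l * simpleReflection G i := by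
  simp [wordProd]

theorem exists_wordProd {γ : (Fin N → ℝ) ≃ₗ[ℝ] (Fin N → ℝ)}
    (hγ : γ ∈ weylGroup (coxeterGram G)) : ∃ l, wordProd G l = γ := by
  induction hγ using Subgroup.closure_induction with
  | mem x hx =>
    obtain ⟨i, rfl⟩ := hx
    exact ⟨[i], by simp [wordProd, simpleReflection]⟩
  | one => exact ⟨[], rfl⟩
  | mul x y _ _ hx hy =>
    obtain ⟨l, rfl⟩ := hx
    obtain ⟨l', rfl⟩ := hy
    exact ⟨l ++ l', by simp [wordProd]⟩
  | inv x _ hx =>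
    obtain ⟨l, rfl⟩ := hx
    refine ⟨l.reverse, ?_⟩
    rw [wordProd, wordProd, List.prod_inv_reverse, List.map_map, List.map_reverse]
    congr 3

/-- The length of the shortest word for an element of the Weyl group. -/
def weylLength (γ : (Fin N → ℝ) ≃ₗ[ℝ] (Fin N → ℝ)) : ℕ :=
  sInf {n | ∃ l : List (Fin N), l.length = n ∧ wordProd G l = γ}

theorem weylLength_wordProd_le (l : List (Fin N)) : weylLength G (wordProd G l) ≤ l.length :=
  Nat.sInf_le ⟨l, rfl, rfl⟩

/-- Outside the Weyl group the infimum is taken over the empty set and is 0 by default, so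
membership is essential here. -/
theorem exists_reduced_word {γ : (Fin N → ℝ) ≃ₗ[ℝ] (Fin N → ℝ)}
    (hγ : γ ∈ weylGroup (coxeterGram G)) : ∃ l, l.length = weylLength G γ ∧ wordProd G l = γ := by
  obtain ⟨l, hl⟩ := exists_wordProd G hγ
  exact Nat.sInf_mem (s := {n | ∃ l : List (Fin N), l.length = n ∧ wordProd G l = γ})
    ⟨l.length, l, rfl, hl⟩

variable {G} in
theorem weylLength_mul_le {γ : (Fin N → ℝ) ≃ₗ[ℝ] (Fin N → ℝ)}
    (hγ : γ ∈ weylGroup (coxeterGram G)) (i : Fin N) :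
    weylLength G (γ * simpleReflection G i) ≤ weylLength G γ + 1 := by
  obtain ⟨l, hl, rfl⟩ := exists_reduced_word G hγ
  rw [← wordProd_concat, ← hl]
  exact (weylLength_wordProd_le G _).trans (by simp)

theorem mul_simpleReflection_cancel (γ : (Fin N → ℝ) ≃ₗ[ℝ] (Fin N → ℝ)) (i : Fin N) :
    γ * simpleReflection G i * simpleReflection G i = γ := by
  rw [mul_assoc, simpleReflection_mul_self, mul_one]

variable {G} in
theorem exists_weylLength_lt {γ : (Fin N → ℝ) ≃ₗ[ℝ] (Fin N → ℝ)}
    (hγ : γ ∈ weylGroup (coxeterGram G)) (h : γ ≠ 1) :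
    ∃ i, weylLength G (γ * simpleReflection G i) < weylLength G γ := by
  obtain ⟨l, hl, rfl⟩ := exists_reduced_word G hγ
  rcases List.eq_nil_or_concat l with rfl | ⟨l', i, rfl⟩
  · exact absurd rfl h
  · rw [List.concat_eq_append] at *
    refine ⟨i, ?_⟩
    rw [← hl, wordProd_concat, mul_simpleReflection_cancel]
    exact (weylLength_wordProd_le G l').trans_lt (by simp)

variable {G} in
/-- If right multiplication by the reflection in a node does not shorten `γ`, then `γ` maps the
node to a nonnegative combination of nodes. -/
theorem root_nonneg {γ : (Fin N → ℝ) ≃ₗ[ℝ] (Fin N → ℝ)}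
    (hγ : γ ∈ weylGroup (coxeterGram G)) {i : Fin N}
    (hi : weylLength G γ ≤ weylLength G (γ * simpleReflection G i)) :
    0 ≤ γ (Pi.single i 1) := by
  induction hn : weylLength G γ using Nat.strong_induction_on generalizing γ i with
  | _ n ih =>
  subst hn
  by_cases h1 : γ = 1
  · subst h1
    simp
  obtain ⟨j, hj⟩ := exists_weylLength_lt hγ h1
  have hij : i ≠ j := by
    rintro rfl
    exact absurd hj (not_lt.2 hi)
  obtain ⟨γ', rfl⟩ : ∃ γ', γ = γ' * simpleReflection G j :=
    ⟨γ * simpleReflection G j, (mul_simpleReflection_cancel G γ j).symm⟩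
  have hs := simpleReflection_mem G
  have hγ' : γ' ∈ weylGroup (coxeterGram G) := by
    simpa only [mul_simpleReflection_cancel] using mul_mem hγ (hs j)
  rw [mul_simpleReflection_cancel] at hj
  have hle := weylLength_mul_le hγ' j
  rw [LinearEquiv.mul_apply]
  by_cases hadj : G.Adj j i
  -- Here γ = γ' s_j with γ' shorter, and γα_i = γ'α_i + γ'α_j. The second term is nonnegative by
  -- induction; the first is too unless s_i shortens γ'. In that case γ' = γ'' s_i, and the sum
  -- collapses to γ''α_j.
  · rw [simpleReflection_adj G hadj, map_add]
    by_cases h2 : weylLength G γ' ≤ weylLength G (γ' * simpleReflection G i)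
    · exact add_nonneg (ih _ hj hγ' h2 rfl) (ih _ hj hγ' hj.le rfl)
    · obtain ⟨γ'', rfl⟩ : ∃ γ'', γ' = γ'' * simpleReflection G i :=
        ⟨γ' * simpleReflection G i, (mul_simpleReflection_cancel G γ' i).symm⟩
      have hγ'' : γ'' ∈ weylGroup (coxeterGram G) := by
        simpa only [mul_simpleReflection_cancel] using mul_mem hγ' (hs i)
      rw [mul_simpleReflection_cancel] at h2
      rw [LinearEquiv.mul_apply, LinearEquiv.mul_apply, simpleReflection_self,
        simpleReflection_adj G hadj.symm, map_add, map_neg]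
      -- If s_j shortened γ'', the braid relation would write γ s_i as γ'' s_j s_i s_j, of length at
      -- most ℓ(γ'') + 1. But ℓ(γ s_i) ≥ ℓ(γ) ≥ ℓ(γ'') + 2.
      have h3 : weylLength G γ'' ≤ weylLength G (γ'' * simpleReflection G j) := by
        by_contra h3
        have e : γ'' * simpleReflection G i * simpleReflection G j * simpleReflection G i =
            γ'' * simpleReflection G j * simpleReflection G i * simpleReflection G j := by
          have := simpleReflection_braid G hadj
          simp only [mul_assoc] at this ⊢
          rw [this]
        rw [e] at hi
        have h4 := weylLength_mul_le (mul_mem (mul_mem hγ'' (hs j)) (hs i)) j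
        have h5 := weylLength_mul_le (mul_mem hγ'' (hs j)) i
        have h6 := weylLength_mul_le hγ'' i
        omega
      have := ih _ (by omega) hγ'' h3 rfl
      rwa [neg_add_cancel_comm_assoc]
  -- Commuting reflections: γα_i = γ'α_i, and if s_i shortened γ', it would also shorten γ = γ' s_j.
  · rw [simpleReflection_not_adj G hij.symm hadj]
    refine ih _ hj hγ' ?_ rfl
    by_contra h2
    rw [mul_assoc, simpleReflection_commute G hij.symm hadj, ← mul_assoc] at hi
    have := weylLength_mul_le (mul_mem hγ' (hs i)) j
    omega

variable {G} in
/-- A nontrivial element of the Weyl group maps some node to a nonpositive vector. -/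
theorem exists_root_nonpos {γ : (Fin N → ℝ) ≃ₗ[ℝ] (Fin N → ℝ)}
    (hγ : γ ∈ weylGroup (coxeterGram G)) (h : γ ≠ 1) : ∃ i, γ (Pi.single i 1) ≤ 0 := by
  obtain ⟨i, hi⟩ := exists_weylLength_lt hγ h
  refine ⟨i, ?_⟩
  have := root_nonneg (mul_mem hγ (simpleReflection_mem G i)) (i := i)
    (by rw [mul_simpleReflection_cancel]; exact hi.le)
  rw [LinearEquiv.mul_apply, simpleReflection_self, map_neg] at this
  exact neg_nonneg.1 this

variable {G} in
/-- Images of a fundamental weight: they exceed the weight in all coordinates, and by at least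
`1` in the coordinate of its node unless they agree with it. -/
theorem weight_orbit {k : Fin N} {ω : Fin N → ℝ}
    (hω : ∀ i, lorentz (coxeterGram G) (Pi.single i 1) ω = if i = k then 1 else 0)
    {γ : (Fin N → ℝ) ≃ₗ[ℝ] (Fin N → ℝ)} (hγ : γ ∈ weylGroup (coxeterGram G)) :
    γ ω = ω ∨ ω ≤ γ ω ∧ ω k + 1 ≤ γ ω k := by
  induction hn : weylLength G γ using Nat.strong_induction_on generalizing γ with
  | _ n ih =>
  subst hn
  by_cases h1 : γ = 1
  · subst h1
    exact Or.inl rfl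
  obtain ⟨j, hj⟩ := exists_weylLength_lt hγ h1
  obtain ⟨γ', rfl⟩ : ∃ γ', γ = γ' * simpleReflection G j :=
    ⟨γ * simpleReflection G j, (mul_simpleReflection_cancel G γ j).symm⟩
  have hγ' : γ' ∈ weylGroup (coxeterGram G) := by
    simpa only [mul_simpleReflection_cancel] using mul_mem hγ (simpleReflection_mem G j)
  rw [mul_simpleReflection_cancel] at hj
  have key := ih _ hj hγ' rfl
  rw [LinearEquiv.mul_apply, simpleReflection_apply, hω]
  by_cases hjk : j = k
  · subst hjk
    rw [if_pos rfl, one_smul, map_add]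
    -- Since s_k ω = ω + α_k, the step adds the vector γ'α_k, which is nonnegative because s_k
    -- lengthens γ'.
    have hpos := root_nonneg hγ' hj.le
    right
    rcases key with h | ⟨h2, h3⟩
    -- Coordinate k of a vector is its product with ω. As γ' fixes ω, the product of γ'α_k with ω
    -- equals α_k ⬝ ω = 1.
    · have : γ' (Pi.single j 1) j = 1 := by
        have e := (preservesProduct_of_mem_weylGroup G hγ') (Pi.single j 1) ω
        rw [h, hω, if_pos rfl, lorentz_eq_sum] at e
        simpa [hω] using e
      rw [h]
      exact ⟨le_add_of_nonneg_right hpos, by simp [this]⟩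
    · refine ⟨h2.trans (le_add_of_nonneg_right hpos), ?_⟩
      have := hpos j
      simp only [Pi.zero_apply, Pi.add_apply] at this ⊢
      linarith
  · rw [if_neg hjk, zero_smul, add_zero]
    exact key

end Coxeter

/-! ### Causality in Lorentz space -/

section Causality

variable {m : ℕ} {J : Matrix (Fin (m + 1)) (Fin (m + 1)) ℝ}

/-- The orthogonal complement of a time-like vector is negative definite. -/
theorem IsLorentzian.neg_of_orthogonal (hJ : IsLorentzian J) {D x : Fin (m + 1) → ℝ}
    (hD : 0 < lorentz J D D) (hx : x ≠ 0) (hxD : lorentz J x D = 0) : lorentz J x x < 0 := by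
  obtain ⟨-, Q, hQ, h⟩ := hJ
  have form : ∀ p q : Fin (m + 1) → ℝ, lorentz J (Q.mulVec p) (Q.mulVec q) =
      p 0 * q 0 - ∑ i : Fin m, p i.succ * q i.succ := by
    intro p q
    rw [lorentz, Matrix.toBilin'_apply', Matrix.mulVec_mulVec, ← Matrix.vecMul_transpose,
      ← Matrix.dotProduct_mulVec, Matrix.mulVec_mulVec, ← mul_assoc, h]
    simp only [dotProduct, Matrix.mulVec_diagonal, Fin.sum_univ_succ, Fin.cons_zero,
      Fin.cons_succ]
    simp [sub_eq_add_neg]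
  have surj : ∀ v, ∃ p, Q.mulVec p = v := fun v =>
    ⟨Q⁻¹.mulVec v, by rw [Matrix.mulVec_mulVec, Matrix.mul_nonsing_inv _ hQ, Matrix.one_mulVec]⟩
  obtain ⟨d, rfl⟩ := surj D
  obtain ⟨p, rfl⟩ := surj x
  rw [form] at *
  -- In diagonal coordinates orthogonality reads p₀d₀ = Σ pᵢdᵢ, so (p₀d₀)² ≤ P·S by Cauchy–Schwarz,
  -- while S < d₀² because D is time-like. This gives p₀² < P unless P = 0.
  have cs := Finset.sum_mul_sq_le_sq_mul_sq Finset.univ (fun i : Fin m => p i.succ)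
    (fun i => d i.succ)
  simp only [← pow_two] at *
  rw [sub_eq_zero] at hxD
  rw [← hxD] at cs
  set P := ∑ i : Fin m, p i.succ ^ 2 with hP
  set S := ∑ i : Fin m, d i.succ ^ 2
  have hP0 : 0 ≤ P := Finset.sum_nonneg fun i _ => sq_nonneg _
  have hS0 : 0 ≤ S := Finset.sum_nonneg fun i _ => sq_nonneg _
  rcases hP0.eq_or_lt with h0 | h0
  · exfalso
    apply hx
    have hp : ∀ i : Fin m, p i.succ = 0 := by
      intro i
      have := (Finset.sum_eq_zero_iff_of_nonneg (fun i _ => sq_nonneg (p (Fin.succ i)))).1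
        h0.symm i (Finset.mem_univ i)
      exact pow_eq_zero_iff two_ne_zero |>.1 this
    have hp0 : p 0 = 0 := by
      rw [← h0, zero_mul] at cs
      have : p 0 * d 0 = 0 := pow_eq_zero_iff two_ne_zero |>.1 (le_antisymm cs (sq_nonneg _))
      rcases mul_eq_zero.1 this with h | h
      · exact h
      · rw [h] at hD; nlinarith
    have : p = 0 := by
      ext i
      refine Fin.cases hp0 hp i
    rw [this, Matrix.mulVec_zero]
  · have : P * S < P * d 0 ^ 2 := mul_lt_mul_of_pos_left (by linarith) h0
    have hd : 0 < d 0 ^ 2 := by linarith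
    by_contra hcon
    have : d 0 ^ 2 * P ≤ d 0 ^ 2 * p 0 ^ 2 := mul_le_mul_of_nonneg_left (by linarith) hd.le
    nlinarith

/-- Causal vectors on the same side as a time-like vector have nonnegative product. -/
theorem IsLorentzian.nonneg_of_causal (hJ : IsLorentzian J) {D u v : Fin (m + 1) → ℝ}
    (hD : 0 < lorentz J D D) (hu : 0 ≤ lorentz J u u) (hv : 0 ≤ lorentz J v v)
    (huD : 0 < lorentz J u D) (hvD : 0 < lorentz J v D) : 0 ≤ lorentz J u v := by
  have hs := lorentz_comm hJ.1
  -- With this t, u - t v is orthogonal to D and so has nonpositive square; expanding the square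
  -- bounds 2t (u ⬝ v) from below by u ⬝ u + t² (v ⬝ v).
  set t := lorentz J u D / lorentz J v D
  have ht : 0 < t := div_pos huD hvD
  have h0 : lorentz J (u - t • v) D = 0 := by
    simp only [map_sub, map_smul, LinearMap.sub_apply, LinearMap.smul_apply, smul_eq_mul, t]
    field_simp
    ring
  have h1 : lorentz J (u - t • v) (u - t • v) ≤ 0 := by
    by_cases h : u - t • v = 0
    · simp [h]
    · exact (hJ.neg_of_orthogonal hD h h0).le
  simp only [map_sub, map_smul, LinearMap.sub_apply, LinearMap.smul_apply, smul_eq_mul,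
    hs v u] at h1
  have h2 := mul_nonneg (mul_nonneg ht.le ht.le) hv
  nlinarith

/-- The same bound 2t (u ⬝ v) ≥ u ⬝ u + t² (v ⬝ v) as for causal vectors, now with a positive
right-hand side. -/
theorem IsLorentzian.pos_of_timelike (hJ : IsLorentzian J) {D u v : Fin (m + 1) → ℝ}
    (hD : 0 < lorentz J D D) (hu : 0 < lorentz J u u) (hv : 0 ≤ lorentz J v v)
    (huD : 0 < lorentz J u D) (hvD : 0 < lorentz J v D) : 0 < lorentz J u v := by
  have hs := lorentz_comm hJ.1
  set t := lorentz J u D / lorentz J v D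
  have ht : 0 < t := div_pos huD hvD
  have h0 : lorentz J (u - t • v) D = 0 := by
    simp only [map_sub, map_smul, LinearMap.sub_apply, LinearMap.smul_apply, smul_eq_mul, t]
    field_simp
    ring
  have h1 : lorentz J (u - t • v) (u - t • v) ≤ 0 := by
    by_cases h : u - t • v = 0
    · simp [h]
    · exact (hJ.neg_of_orthogonal hD h h0).le
  simp only [map_sub, map_smul, LinearMap.sub_apply, LinearMap.smul_apply, smul_eq_mul,
    hs v u] at h1
  have h2 := mul_nonneg (mul_nonneg ht.le ht.le) hv
  nlinarith

end Causality

/-! ### The Gram matrix of `T₂,₃,₈`, its inverse, and its signature -/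

section T238

/-- The Gram matrix with integral entries. -/
def gramInt : Matrix (Fin 11) (Fin 11) ℤ :=
  !![-2, 1, 0, 0, 0, 0, 0, 0, 0, 0, 0;
     1, -2, 1, 0, 0, 0, 0, 0, 0, 0, 0;
     0, 1, -2, 1, 0, 0, 0, 0, 0, 0, 0;
     0, 0, 1, -2, 1, 0, 0, 0, 0, 0, 0;
     0, 0, 0, 1, -2, 1, 0, 0, 0, 0, 0;
     0, 0, 0, 0, 1, -2, 1, 0, 0, 0, 0;
     0, 0, 0, 0, 0, 1, -2, 1, 0, 0, 0;
     0, 0, 0, 0, 0, 0, 1, -2, 1, 0, 1;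
     0, 0, 0, 0, 0, 0, 0, 1, -2, 1, 0;
     0, 0, 0, 0, 0, 0, 0, 0, 1, -2, 0;
     0, 0, 0, 0, 0, 0, 0, 1, 0, 0, -2]

/-- Twice the inverse of the Gram matrix. -/
def twiceInverse : Matrix (Fin 11) (Fin 11) ℤ :=
  !![-1, 0, 1, 2, 3, 4, 5, 6, 4, 2, 3;
     0, 0, 2, 4, 6, 8, 10, 12, 8, 4, 6;
     1, 2, 3, 6, 9, 12, 15, 18, 12, 6, 9;
     2, 4, 6, 8, 12, 16, 20, 24, 16, 8, 12;
     3, 6, 9, 12, 15, 20, 25, 30, 20, 10, 15;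
     4, 8, 12, 16, 20, 24, 30, 36, 24, 12, 18;
     5, 10, 15, 20, 25, 30, 35, 42, 28, 14, 21;
     6, 12, 18, 24, 30, 36, 42, 48, 32, 16, 24;
     4, 8, 12, 16, 20, 24, 28, 32, 20, 10, 16;
     2, 4, 6, 8, 10, 12, 14, 16, 10, 4, 8;
     3, 6, 9, 12, 15, 18, 21, 24, 16, 8, 11]

/-- The rows are an orthogonal basis. -/
def orthogonalRows : Matrix (Fin 11) (Fin 11) ℤ :=
  !![3, 6, 9, 12, 15, 18, 21, 24, 16, 8, 12;
     1, 0, 0, 0, 0, 0, 0, 0, 0, 0, 0;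
     1, 2, 0, 0, 0, 0, 0, 0, 0, 0, 0;
     1, 2, 3, 0, 0, 0, 0, 0, 0, 0, 0;
     1, 2, 3, 4, 0, 0, 0, 0, 0, 0, 0;
     1, 2, 3, 4, 5, 0, 0, 0, 0, 0, 0;
     1, 2, 3, 4, 5, 6, 0, 0, 0, 0, 0;
     1, 2, 3, 4, 5, 6, 7, 0, 0, 0, 0;
     0, 0, 0, 0, 0, 0, 0, 0, 1, 0, 0;
     0, 0, 0, 0, 0, 0, 0, 0, 1, 2, 0;
     0, 0, 0, 0, 0, 0, 0, 0, 0, 0, 1]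

/-- The absolute values of the norms of the orthogonal basis. -/
def orthogonalNorms : Fin 11 → ℤ := ![24, 2, 6, 12, 20, 30, 42, 56, 2, 6, 2]

theorem treeT238_adj (i j : Fin 11) : treeT238.Adj i j ↔ i ≠ j ∧
    (((i.val + 1 = j.val ∧ j.val ≤ 9) ∨ (i.val = 7 ∧ j.val = 10)) ∨
      ((j.val + 1 = i.val ∧ i.val ≤ 9) ∨ (j.val = 7 ∧ i.val = 10))) :=
  SimpleGraph.fromRel_adj _ _ _

instance : DecidableRel treeT238.Adj := fun i j => decidable_of_iff _ (treeT238_adj i j).symm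

theorem gramT238_eq : gramT238 = gramInt.map (Int.cast : ℤ → ℝ) := by
  have key : Matrix.of (fun i j : Fin 11 => if i = j then (-2 : ℤ) else
      if treeT238.Adj i j then 1 else 0) = gramInt := by decide +kernel
  ext i j
  rw [Matrix.map_apply, ← key]
  simp only [coxeterGram, Matrix.of_apply]
  split_ifs <;> simp

theorem gramT238_isSymm : gramT238.IsSymm := coxeterGram_isSymm _

theorem gramT238_mul_inverse :
    gramT238 * (1 / 2 : ℝ) • twiceInverse.map (Int.cast : ℤ → ℝ) = 1 := by
  have key : gramInt * twiceInverse = Matrix.diagonal fun _ => 2 := by decide +kernel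
  have := congrArg (fun A : Matrix (Fin 11) (Fin 11) ℤ => A.map (Int.castRingHom ℝ)) key
  simp only [Matrix.map_mul] at this
  rw [gramT238_eq, Matrix.mul_smul]
  change (1 / 2 : ℝ) • (gramInt.map (Int.castRingHom ℝ) * twiceInverse.map (Int.castRingHom ℝ)) = 1
  rw [this]
  ext i j
  by_cases h : i = j <;> simp [h, Matrix.one_apply]

theorem weight_gramT238_apply (i j : Fin 11) :
    weight gramT238 i j = (twiceInverse j i : ℝ) / 2 := by
  rw [weight, Matrix.inv_eq_right_inv gramT238_mul_inverse]
  simp [Matrix.mulVec_single]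
  ring

theorem lorentz_weight (i j : Fin 11) :
    lorentz gramT238 (Pi.single i 1) (weight gramT238 j) = if i = j then 1 else 0 := by
  rw [lorentz, Matrix.toBilin'_apply', weight, Matrix.mulVec_mulVec,
    Matrix.inv_eq_right_inv gramT238_mul_inverse, gramT238_mul_inverse]
  simp [Matrix.one_apply]

/-- The weights are the dual basis of the nodes. This turns coordinatewise inequalities in the orbit
of a weight into inequalities between products. -/
theorem lorentz_weight_right (x : Fin 11 → ℝ) (j : Fin 11) :
    lorentz gramT238 x (weight gramT238 j) = x j := by
  rw [lorentz_eq_sum]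
  simp [lorentz_weight]

theorem lorentz_weight_weight (i j : Fin 11) :
    lorentz gramT238 (weight gramT238 i) (weight gramT238 j) = (twiceInverse j i : ℝ) / 2 := by
  rw [lorentz_weight_right, weight_gramT238_apply]

theorem isLorentzian_gramT238 : IsLorentzian gramT238 := by
  refine ⟨gramT238_isSymm, ?_⟩
  -- Deleting the branch node 7 leaves diagrams A₇, A₂ and A₁. Rows 1 to 10 orthogonalize these
  -- three pieces, and row 0 is w_7, which is orthogonal to all nodes but 7 and has norm 24.
  have key : orthogonalRows * gramInt * orthogonalRows.transpose =
    Matrix.diagonal (fun i => (Fin.cons 1 fun _ => -1 : Fin 11 → ℤ) i * orthogonalNorms i) := by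
    decide +kernel
  have npos : ∀ i, 0 < orthogonalNorms i := by decide
  have hpos : ∀ i, (0 : ℝ) < orthogonalNorms i := fun i => by exact_mod_cast npos i
  set K : Matrix (Fin 11) (Fin 11) ℝ := orthogonalRows.transpose.map (Int.castRingHom ℝ)
  set S : Matrix (Fin 11) (Fin 11) ℝ :=
    Matrix.diagonal fun i => (Real.sqrt (orthogonalNorms i))⁻¹
  have hK : K.transpose * gramT238 * K = Matrix.diagonal
      (fun i => (Fin.cons 1 fun _ => -1 : Fin 11 → ℝ) i * orthogonalNorms i) := by
    have := congrArg (fun A : Matrix (Fin 11) (Fin 11) ℤ => A.map (Int.castRingHom ℝ)) key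
    simp only [Matrix.map_mul] at this
    rw [gramT238_eq]
    refine this.trans ?_
    ext i j
    rw [Matrix.map_apply, Matrix.diagonal_apply, Matrix.diagonal_apply]
    split_ifs with h
    · refine Fin.cases ?_ (fun i => ?_) i <;> simp
    · simp
  have hQ : (K * S).transpose * gramT238 * (K * S) =
      Matrix.diagonal (Fin.cons 1 fun _ => -1) := by
    rw [Matrix.transpose_mul, show S.transpose = S from Matrix.diagonal_transpose _]
    calc S * K.transpose * gramT238 * (K * S) = S * (K.transpose * gramT238 * K) * S := by
          simp only [mul_assoc]
      _ = _ := by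
          rw [hK, Matrix.diagonal_mul_diagonal, Matrix.diagonal_mul_diagonal]
          congr 1
          ext i
          have := Real.mul_self_sqrt (hpos i).le
          have h2 := (Real.sqrt_pos.2 (hpos i)).ne'
          field_simp
          rw [pow_two, this, mul_comm]
  refine ⟨K * S, ?_, hQ⟩
  rw [isUnit_iff_ne_zero]
  intro h0
  have := congrArg Matrix.det hQ
  rw [Matrix.det_mul, h0, mul_zero, Matrix.det_diagonal] at this
  refine (Finset.prod_ne_zero_iff.2 fun i _ => ?_) this.symm
  refine Fin.cases ?_ (fun i => ?_) i <;> simp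

theorem lorentz_weylVector_single (i : Fin 11) :
    lorentz gramT238 (Pi.single i 1) (weylVector gramT238) = 1 := by
  simp [weylVector, lorentz_weight]

theorem lorentz_weylVector (x : Fin 11 → ℝ) :
    lorentz gramT238 x (weylVector gramT238) = ∑ i, x i := by
  rw [lorentz_eq_sum]
  simp [lorentz_weylVector_single]

theorem weylVector_apply (j : Fin 11) :
    weylVector gramT238 j = (∑ i, twiceInverse j i : ℤ) / 2 := by
  simp [weylVector, weight_gramT238_apply, ← Finset.sum_div]

theorem weylVector_timelike :
    0 < lorentz gramT238 (weylVector gramT238) (weylVector gramT238) := by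
  rw [lorentz_weylVector]
  simp only [weylVector_apply, ← Finset.sum_div]
  have : 0 < ∑ j, ∑ i, twiceInverse j i := by decide +kernel
  have : (0 : ℝ) < ((∑ j, ∑ i, twiceInverse j i : ℤ) : ℝ) := by exact_mod_cast this
  push_cast at this ⊢
  linarith

theorem lorentz_weight_self_neg_iff (i : Fin 11) :
    lorentz gramT238 (weight gramT238 i) (weight gramT238 i) < 0 ↔ i = 0 := by
  have key : ∀ i : Fin 11, twiceInverse i i < 0 ↔ i = 0 := by decide +kernel
  rw [← key, lorentz_weight_weight, ← Int.cast_lt_zero (R := ℝ)]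
  constructor <;> intro h <;> linarith

theorem lorentz_weight_zero_self :
    lorentz gramT238 (weight gramT238 0) (weight gramT238 0) = -(1 / 2) := by
  rw [lorentz_weight_weight, show twiceInverse 0 0 = -1 from rfl]
  norm_num

theorem areTangent_weight_zero : AreTangent gramT238 (weight gramT238 0) (Pi.single 0 1) := by
  constructor
  · rw [LinearIndependent.pair_iff]
    intro s t h
    -- Coordinates 2 and 0 suffice: w_0 has 1/2 and -1/2 there, and α_0 has 0 and 1.
    have h2 := congrFun h 2
    have h0 := congrFun h 0
    simp only [Pi.add_apply, Pi.smul_apply, weight_gramT238_apply, Pi.zero_apply,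
      smul_eq_mul, Pi.single_apply] at h0 h2
    rw [show twiceInverse 2 0 = 1 from rfl] at h2
    rw [show twiceInverse 0 0 = -1 from rfl] at h0
    rw [if_neg (by decide)] at h2
    norm_num at h0 h2
    subst h2
    simpa using h0
  · rw [lorentz_comm gramT238_isSymm, lorentz_weight, lorentzLength, lorentzLength,
      lorentz_weight_zero_self, lorentz_single_single,
      show gramT238 0 0 = -2 from coxeterGram_self _ 0, ← Real.sqrt_mul (by norm_num)]
    norm_num

end T238

/-! ### The Weyl group of `T₂,₃,₈` and its packing -/

section Weyl238

theorem preservesProduct_weyl238 {γ : (Fin 11 → ℝ) ≃ₗ[ℝ] (Fin 11 → ℝ)}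
    (hγ : γ ∈ weylGroup gramT238) : PreservesProduct gramT238 γ :=
  preservesProduct_of_mem_weylGroup _ hγ

theorem lorentz_map_left {γ : (Fin 11 → ℝ) ≃ₗ[ℝ] (Fin 11 → ℝ)}
    (hγ : γ ∈ weylGroup gramT238) (x y : Fin 11 → ℝ) :
    lorentz gramT238 (γ x) y = lorentz gramT238 x (γ⁻¹ y) := by
  rw [← preservesProduct_weyl238 hγ x, ← LinearEquiv.mul_apply, mul_inv_cancel]
  rfl

theorem weight_orbit238 (k : Fin 11) {γ : (Fin 11 → ℝ) ≃ₗ[ℝ] (Fin 11 → ℝ)}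
    (hγ : γ ∈ weylGroup gramT238) : γ (weight gramT238 k) = weight gramT238 k ∨
      weight gramT238 k ≤ γ (weight gramT238 k) ∧
        weight gramT238 k k + 1 ≤ γ (weight gramT238 k) k :=
  weight_orbit (fun i => lorentz_weight i k) hγ

theorem weight_le_map (k : Fin 11) {γ : (Fin 11 → ℝ) ≃ₗ[ℝ] (Fin 11 → ℝ)}
    (hγ : γ ∈ weylGroup gramT238) : weight gramT238 k ≤ γ (weight gramT238 k) := by
  rcases weight_orbit238 k hγ with h | h
  · exact h.ge
  · exact h.1

theorem weylVector_le_map {γ : (Fin 11 → ℝ) ≃ₗ[ℝ] (Fin 11 → ℝ)}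
    (hγ : γ ∈ weylGroup gramT238) : weylVector gramT238 ≤ γ (weylVector gramT238) := by
  rw [weylVector, map_sum]
  exact Finset.sum_le_sum fun k _ => weight_le_map k hγ

/-- The product with D is the sum of the coordinates, and γD dominates D. -/
theorem lorentz_map_weylVector_pos {γ : (Fin 11 → ℝ) ≃ₗ[ℝ] (Fin 11 → ℝ)}
    (hγ : γ ∈ weylGroup gramT238) :
    0 < lorentz gramT238 (γ (weylVector gramT238)) (weylVector gramT238) := by
  have := weylVector_timelike
  rw [lorentz_weylVector] at *
  exact this.trans_le (Finset.sum_le_sum fun i _ => weylVector_le_map hγ i)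

/-- Causality says nothing about w_0, which has negative square; instead the coordinates of γw_0
dominate those of w_0, whose sum is positive. This later excludes opposite members and complementary
spheres. -/
theorem lorentz_map_weight_zero_pos {γ : (Fin 11 → ℝ) ≃ₗ[ℝ] (Fin 11 → ℝ)}
    (hγ : γ ∈ weylGroup gramT238) :
    0 < lorentz gramT238 (γ (weight gramT238 0)) (weylVector gramT238) := by
  rw [lorentz_weylVector]
  refine lt_of_lt_of_le ?_ (Finset.sum_le_sum fun i _ => weight_le_map 0 hγ i)
  have key : 0 < ∑ j, twiceInverse j 0 := by decide +kernel
  have : (0 : ℝ) < ((∑ j, twiceInverse j 0 : ℤ) : ℝ) := by exact_mod_cast key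
  simp only [weight_gramT238_apply, ← Finset.sum_div]
  push_cast at this
  linarith

/-- The Weyl group does not exchange past and future. -/
theorem forward_map {γ : (Fin 11 → ℝ) ≃ₗ[ℝ] (Fin 11 → ℝ)} (hγ : γ ∈ weylGroup gramT238)
    {x : Fin 11 → ℝ} (hx : 0 ≤ lorentz gramT238 x x)
    (hxD : 0 < lorentz gramT238 x (weylVector gramT238)) :
    0 < lorentz gramT238 (γ x) (weylVector gramT238) := by
  -- Move γ to the other side: γ⁻¹D is time-like and on the side of D.
  rw [lorentz_map_left hγ, lorentz_comm gramT238_isSymm]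
  have hi := inv_mem hγ
  refine isLorentzian_gramT238.pos_of_timelike weylVector_timelike ?_ hx
    (lorentz_map_weylVector_pos hi) hxD
  rw [preservesProduct_weyl238 hi]
  exact weylVector_timelike

theorem map_mem_hyperbolicSpace {γ : (Fin 11 → ℝ) ≃ₗ[ℝ] (Fin 11 → ℝ)}
    (hγ : γ ∈ weylGroup gramT238) {x : Fin 11 → ℝ}
    (hx : x ∈ hyperbolicSpace gramT238 (weylVector gramT238)) :
    γ x ∈ hyperbolicSpace gramT238 (weylVector gramT238) :=
  ⟨(preservesProduct_weyl238 hγ x x).trans hx.1, forward_map hγ (hx.1.ge.trans' zero_le_one) hx.2⟩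

theorem image_eq_of_forall_mem {γ : (Fin 11 → ℝ) ≃ₗ[ℝ] (Fin 11 → ℝ)}
    (hγ : γ ∈ weylGroup gramT238) {s : Set (Fin 11 → ℝ)}
    (hs : ∀ γ ∈ weylGroup gramT238, ∀ x ∈ s, γ x ∈ s) : γ '' s = s := by
  apply Set.Subset.antisymm
  · rintro _ ⟨x, hx, rfl⟩
    exact hs γ hγ x hx
  · exact fun x hx => ⟨γ⁻¹ x, hs _ (inv_mem hγ) x hx, γ.apply_symm_apply x⟩

theorem isHyperbolicIsometry_weyl238 {γ : (Fin 11 → ℝ) ≃ₗ[ℝ] (Fin 11 → ℝ)}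
    (hγ : γ ∈ weylGroup gramT238) :
    IsHyperbolicIsometry gramT238 (weylVector gramT238) γ :=
  ⟨preservesProduct_weyl238 hγ, image_eq_of_forall_mem hγ fun _ h _ => map_mem_hyperbolicSpace h⟩

/-- The packing consists of the images of the normalized weight `w₀`. -/
theorem mem_coxeterPacking {v : Fin 11 → ℝ} : v ∈ coxeterPacking gramT238 ↔
    ∃ γ ∈ weylGroup gramT238, v = Real.sqrt 2 • γ (weight gramT238 0) := by
  have hl : ∀ γ ∈ weylGroup gramT238,
      (lorentzLength gramT238 (γ (weight gramT238 0)))⁻¹ = Real.sqrt 2 := by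
    intro γ hγ
    rw [lorentzLength, preservesProduct_weyl238 hγ, lorentz_weight_zero_self, ← Real.sqrt_inv]
    norm_num
  constructor
  · rintro ⟨γ, hγ, _, ⟨i, rfl, hi⟩, rfl⟩
    obtain rfl := (lorentz_weight_self_neg_iff i).1 hi
    exact ⟨γ, hγ, by rw [hl γ hγ]⟩
  · rintro ⟨γ, hγ, rfl⟩
    exact ⟨γ, hγ, _, ⟨0, rfl, (lorentz_weight_self_neg_iff 0).2 rfl⟩, by rw [hl γ hγ]⟩

theorem map_mem_coxeterPacking {γ : (Fin 11 → ℝ) ≃ₗ[ℝ] (Fin 11 → ℝ)}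
    (hγ : γ ∈ weylGroup gramT238) {v : Fin 11 → ℝ} (hv : v ∈ coxeterPacking gramT238) :
    γ v ∈ coxeterPacking gramT238 := by
  obtain ⟨δ, hδ, rfl⟩ := mem_coxeterPacking.1 hv
  exact mem_coxeterPacking.2 ⟨γ * δ, mul_mem hγ hδ, by simp⟩

theorem lorentz_self_of_mem_coxeterPacking {n : Fin 11 → ℝ} (hn : n ∈ coxeterPacking gramT238) :
    lorentz gramT238 n n = -1 := by
  obtain ⟨γ, hγ, rfl⟩ := mem_coxeterPacking.1 hn
  simp only [map_smul, LinearMap.smul_apply, smul_eq_mul, preservesProduct_weyl238 hγ _ _,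
    lorentz_weight_zero_self]
  have := Real.mul_self_sqrt (show (0 : ℝ) ≤ 2 by norm_num)
  linarith

theorem lorentz_weylVector_pos_of_mem_coxeterPacking {n : Fin 11 → ℝ}
    (hn : n ∈ coxeterPacking gramT238) : 0 < lorentz gramT238 n (weylVector gramT238) := by
  obtain ⟨γ, hγ, rfl⟩ := mem_coxeterPacking.1 hn
  simp only [map_smul, LinearMap.smul_apply, smul_eq_mul]
  exact mul_pos (Real.sqrt_pos.2 two_pos) (lorentz_map_weight_zero_pos hγ)

/-- The product of γw_0 and δw_0 is coordinate 0 of δ⁻¹γw_0. That coordinate is at least -1/2 + 1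
when the two vectors differ, and the normalization by √2 doubles it. -/
theorem one_le_lorentz_of_mem_coxeterPacking {n n' : Fin 11 → ℝ}
    (hn : n ∈ coxeterPacking gramT238) (hn' : n' ∈ coxeterPacking gramT238) (hne : n ≠ n') :
    1 ≤ lorentz gramT238 n n' := by
  obtain ⟨γ, hγ, rfl⟩ := mem_coxeterPacking.1 hn
  obtain ⟨δ, hδ, rfl⟩ := mem_coxeterPacking.1 hn'
  have h2 := Real.mul_self_sqrt (show (0 : ℝ) ≤ 2 by norm_num)
  have hmem := mul_mem (inv_mem hδ) hγ
  have key : lorentz gramT238 (γ (weight gramT238 0)) (δ (weight gramT238 0)) =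
      (δ⁻¹ * γ) (weight gramT238 0) 0 := by
    rw [lorentz_comm gramT238_isSymm, lorentz_map_left hδ, lorentz_comm gramT238_isSymm,
      lorentz_weight_right]
    rfl
  simp only [map_smul, LinearMap.smul_apply, smul_eq_mul, key]
  rcases weight_orbit238 0 hmem with h | ⟨-, h⟩
  · exfalso
    apply hne
    rw [LinearEquiv.mul_apply] at h
    have := congrArg δ h
    rw [← LinearEquiv.mul_apply, mul_inv_cancel] at this
    exact congrArg _ this
  · have h0 : weight gramT238 0 0 = -(1 / 2) := by
      rw [← lorentz_weight_right (weight gramT238 0), lorentz_weight_zero_self]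
    nlinarith

theorem isPacking_coxeterPacking : IsPacking gramT238 (coxeterPacking gramT238) := by
  refine ⟨1, one_pos, fun n hn => lorentz_self_of_mem_coxeterPacking hn, ?_⟩
  refine fun n hn n' hn' hne => ⟨one_le_lorentz_of_mem_coxeterPacking hn hn' hne, ?_⟩
  rintro rfl
  have h1 := lorentz_weylVector_pos_of_mem_coxeterPacking hn
  have h2 := lorentz_weylVector_pos_of_mem_coxeterPacking hn'
  rw [map_neg, LinearMap.neg_apply] at h2
  linarith

/-! ### Integrality -/

/-- Vectors with integral coordinates. -/
def HasIntegralCoords (v : Fin 11 → ℝ) : Prop := ∀ i, ∃ z : ℤ, v i = z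

theorem exists_int_sum {ι : Type*} (s : Finset ι) {f : ι → ℝ} (h : ∀ i, ∃ z : ℤ, f i = z) :
    ∃ z : ℤ, ∑ i ∈ s, f i = z := by
  choose g hg using h
  exact ⟨∑ i ∈ s, g i, by push_cast; exact Finset.sum_congr rfl fun i _ => hg i⟩

theorem HasIntegralCoords.map {γ : (Fin 11 → ℝ) ≃ₗ[ℝ] (Fin 11 → ℝ)}
    (hγ : γ ∈ weylGroup gramT238) {v : Fin 11 → ℝ} (hv : HasIntegralCoords v) :
    HasIntegralCoords (γ v) := by
  induction hγ using Subgroup.closure_induction_left generalizing v with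
  | one => exact hv
  | mul_left s hs y _ ih =>
    obtain ⟨k, rfl⟩ := hs
    intro i
    have hy := ih hv
    obtain ⟨a, ha⟩ := hy i
    obtain ⟨b, hb⟩ := exists_int_sum Finset.univ (f := fun j => gramT238 k j * y v j) fun j => by
      obtain ⟨c, hc⟩ := hy j
      exact ⟨gramInt k j * c, by rw [hc, gramT238_eq]; simp⟩
    refine ⟨a + b * if i = k then 1 else 0, ?_⟩
    change simpleReflection _ k (y v) i = _
    rw [simpleReflection_apply, lorentz_single_left, hb]
    simp [ha, Pi.single_apply]
  | inv_mul_cancel s hs y _ ih =>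
    obtain ⟨k, rfl⟩ := hs
    intro i
    have hy := ih hv
    obtain ⟨a, ha⟩ := hy i
    obtain ⟨b, hb⟩ := exists_int_sum Finset.univ (f := fun j => gramT238 k j * y v j) fun j => by
      obtain ⟨c, hc⟩ := hy j
      exact ⟨gramInt k j * c, by rw [hc, gramT238_eq]; simp⟩
    refine ⟨a + b * if i = k then 1 else 0, ?_⟩
    rw [lorentzReflection_inv]
    change simpleReflection _ k (y v) i = _
    rw [simpleReflection_apply, lorentz_single_left, hb]
    simp [ha, Pi.single_apply]

theorem hasIntegralCoords_two_smul_weight (i : Fin 11) :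
    HasIntegralCoords ((2 : ℝ) • weight gramT238 i) := fun j =>
  ⟨twiceInverse j i, by simp [weight_gramT238_apply, mul_div_cancel₀]⟩

theorem hasIntegralCoords_two_smul_map_weylVector {γ : (Fin 11 → ℝ) ≃ₗ[ℝ] (Fin 11 → ℝ)}
    (hγ : γ ∈ weylGroup gramT238) : HasIntegralCoords ((2 : ℝ) • γ (weylVector gramT238)) := by
  rw [← map_smul]
  refine HasIntegralCoords.map hγ fun j => ⟨∑ i, twiceInverse j i, ?_⟩
  rw [Pi.smul_apply, weylVector_apply, smul_eq_mul, mul_div_cancel₀ _ two_ne_zero]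

/-! ### The fundamental chamber -/

/-- Compare γ with γ s_i: since s_i D = D + α_i, minimality says that γα_i ⬝ x ≥ 0. -/
theorem exists_dominant_of_isMin {x : Fin 11 → ℝ} {γ : (Fin 11 → ℝ) ≃ₗ[ℝ] (Fin 11 → ℝ)}
    (hγ : γ ∈ weylGroup gramT238) (h : ∀ δ ∈ weylGroup gramT238,
      lorentz gramT238 (γ (weylVector gramT238)) x ≤
        lorentz gramT238 (δ (weylVector gramT238)) x) (i : Fin 11) :
    0 ≤ lorentz gramT238 (Pi.single i 1) (γ⁻¹ x) := by
  have := h _ (mul_mem hγ (simpleReflection_mem _ i))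
  rw [LinearEquiv.mul_apply, simpleReflection_apply, lorentz_weylVector_single, one_smul,
    map_add, map_add, LinearMap.add_apply] at this
  rw [← lorentz_map_left hγ]
  linarith

/-- The vectors 2γD are integral, so a minimizer exists once the γD with γD ⬝ x ≤ D ⬝ x are known to
be bounded. -/
theorem exists_dominant_of_timelike {x : Fin 11 → ℝ} (hx : 0 < lorentz gramT238 x x)
    (hxD : 0 < lorentz gramT238 x (weylVector gramT238)) :
    ∃ γ ∈ weylGroup gramT238, ∀ i, 0 ≤ lorentz gramT238 (Pi.single i 1) (γ x) := by
  have hcont : ∀ w v : Fin 11 → ℝ, Continuous fun ε : ℝ => lorentz gramT238 (x + ε • w) v := by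
    intro w v
    simp only [map_add, map_smul, LinearMap.add_apply, LinearMap.smul_apply, smul_eq_mul]
    fun_prop
  have hcont2 : ∀ w : Fin 11 → ℝ,
      Continuous fun ε : ℝ => lorentz gramT238 (x + ε • w) (x + ε • w) := by
    intro w
    simp only [map_add, map_smul, LinearMap.add_apply, LinearMap.smul_apply, smul_eq_mul]
    fun_prop
  -- Time-likeness is open: x ± ε w_i stays time-like and forward for small ε. Positivity of its
  -- product with γD then says that |(γD)_i| is less than (γD ⬝ x)/ε.
  have hev : ∀ w : Fin 11 → ℝ, ∀ᶠ ε : ℝ in nhds 0, 0 < lorentz gramT238 (x + ε • w) (x + ε • w) ∧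
      0 < lorentz gramT238 (x + ε • w) (weylVector gramT238) := fun w =>
    ((hcont2 w).continuousAt.eventually_const_lt (by simpa using hx)).and
      ((hcont w _).continuousAt.eventually_const_lt (by simpa using hxD))
  have hall : ∀ᶠ ε : ℝ in nhds 0, ∀ i, (0 < lorentz gramT238 (x + ε • weight gramT238 i)
        (x + ε • weight gramT238 i) ∧
      0 < lorentz gramT238 (x + ε • weight gramT238 i) (weylVector gramT238)) ∧
      (0 < lorentz gramT238 (x + ε • -weight gramT238 i) (x + ε • -weight gramT238 i) ∧
      0 < lorentz gramT238 (x + ε • -weight gramT238 i) (weylVector gramT238)) :=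
    Filter.eventually_all.2 fun i => (hev _).and (hev _)
  obtain ⟨ε, hε, hε0⟩ := ((hall.filter_mono nhdsWithin_le_nhds).and
    (self_mem_nhdsWithin : Set.Ioi (0 : ℝ) ∈ nhdsWithin 0 (Set.Ioi 0))).exists
  set D := weylVector gramT238
  set C := lorentz gramT238 D x
  have hs := lorentz_comm gramT238_isSymm
  have bound : ∀ γ ∈ weylGroup gramT238, lorentz gramT238 (γ D) x ≤ C → ∀ i, |γ D i| ≤ C / ε := by
    intro γ hγ hC i
    have pos : ∀ v, 0 < lorentz gramT238 v v → 0 < lorentz gramT238 v D →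
        0 < lorentz gramT238 (γ D) v := fun v h1 h2 =>
      isLorentzian_gramT238.pos_of_timelike weylVector_timelike
        ((preservesProduct_weyl238 hγ D D).symm ▸ weylVector_timelike) h1.le
        (lorentz_map_weylVector_pos hγ) h2
    have h1 := pos _ (hε i).1.1 (hε i).1.2
    have h2 := pos _ (hε i).2.1 (hε i).2.2
    simp only [map_add, map_smul, map_neg, smul_eq_mul, lorentz_weight_right] at h1 h2
    rw [abs_le, le_div_iff₀ hε0, neg_le, le_div_iff₀ hε0]
    constructor <;> linarith
  set S := {y | ∃ γ ∈ weylGroup gramT238, y = γ D ∧ lorentz gramT238 (γ D) x ≤ C}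
  have hfin : S.Finite := by
    obtain ⟨M, hM⟩ := exists_int_gt (2 * (C / ε))
    refine ((Set.finite_Icc (fun _ : Fin 11 => -M) (fun _ => M)).image
      fun z : Fin 11 → ℤ => fun i => (z i : ℝ) / 2).subset ?_
    rintro _ ⟨γ, hγ, rfl, hC⟩
    choose z hz using hasIntegralCoords_two_smul_map_weylVector hγ
    have hz' : ∀ i, (z i : ℝ) = 2 * γ D i := fun i => (hz i).symm
    refine ⟨z, ⟨fun i => ?_, fun i => ?_⟩, ?_⟩
    · have := (abs_le.1 (bound γ hγ hC i)).1
      have h3 : ((-M : ℤ) : ℝ) ≤ z i := by push_cast; rw [hz']; linarith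
      exact_mod_cast h3
    · have := (abs_le.1 (bound γ hγ hC i)).2
      have h3 : (z i : ℝ) ≤ M := by rw [hz']; linarith
      exact_mod_cast h3
    · ext i
      simp [hz']
  obtain ⟨_, ⟨γ, hγ, rfl, -⟩, hmin⟩ := Set.exists_min_image S (fun y => lorentz gramT238 y x) hfin
    ⟨D, 1, one_mem _, rfl, le_rfl⟩
  refine ⟨γ⁻¹, inv_mem hγ, exists_dominant_of_isMin hγ fun δ hδ => ?_⟩
  -- A minimum over `S` is a global one, because D itself belongs to `S` with value `C`.
  by_cases h : lorentz gramT238 (δ D) x ≤ C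
  · exact hmin _ ⟨δ, hδ, rfl, h⟩
  · exact (hmin D ⟨1, one_mem _, rfl, le_rfl⟩).trans (not_le.1 h).le

/-- For light-like x the perturbation argument fails, but here every 2γD ⬝ x is a natural number, so
a least value exists. -/
theorem exists_dominant_of_integral {x : Fin 11 → ℝ} (hx : 0 ≤ lorentz gramT238 x x)
    (hxD : 0 < lorentz gramT238 x (weylVector gramT238))
    (hint : ∀ i, ∃ z : ℤ, lorentz gramT238 (Pi.single i 1) x = z) :
    ∃ γ ∈ weylGroup gramT238, ∀ i, 0 ≤ lorentz gramT238 (Pi.single i 1) (γ x) := by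
  have hnat : ∀ γ ∈ weylGroup gramT238, ∃ n : ℕ,
      2 * lorentz gramT238 (γ (weylVector gramT238)) x = n := by
    intro γ hγ
    have hpos : 0 < lorentz gramT238 (γ (weylVector gramT238)) x := by
      rw [lorentz_map_left hγ, lorentz_comm gramT238_isSymm]
      exact forward_map (inv_mem hγ) hx hxD
    obtain ⟨z, hz⟩ : ∃ z : ℤ, 2 * lorentz gramT238 (γ (weylVector gramT238)) x = z := by
      rw [lorentz_eq_sum, Finset.mul_sum]
      refine exists_int_sum _ fun i => ?_
      obtain ⟨a, ha⟩ := hasIntegralCoords_two_smul_map_weylVector hγ i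
      obtain ⟨b, hb⟩ := hint i
      refine ⟨a * b, ?_⟩
      rw [Pi.smul_apply, smul_eq_mul] at ha
      rw [← mul_assoc, ha, hb]
      push_cast
      rfl
    have hz0 : (0 : ℝ) ≤ z := by rw [← hz]; linarith
    lift z to ℕ using (by exact_mod_cast hz0)
    exact ⟨z, by simpa using hz⟩
  have hex : ∃ n : ℕ, ∃ γ ∈ weylGroup gramT238,
      2 * lorentz gramT238 (γ (weylVector gramT238)) x = n := by
    obtain ⟨n, hn⟩ := hnat 1 (one_mem _)
    exact ⟨n, 1, one_mem _, hn⟩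
  classical
  obtain ⟨γ, hγ, hn⟩ := Nat.find_spec hex
  refine ⟨γ⁻¹, inv_mem hγ, exists_dominant_of_isMin hγ fun δ hδ => ?_⟩
  obtain ⟨m, hm⟩ := hnat δ hδ
  have h1 : ((Nat.find hex : ℕ) : ℝ) ≤ m := Nat.cast_le.2 (Nat.find_min' hex ⟨δ, hδ, hm⟩)
  linarith

/-- A vector of nonpositive square in the fundamental chamber is on the negative side of the
plane of `w₀`, or on the plane. -/
theorem lorentz_weight_zero_nonpos_of_dominant {x : Fin 11 → ℝ} (hx : lorentz gramT238 x x = 0)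
    (hdom : ∀ i, 0 ≤ lorentz gramT238 (Pi.single i 1) x) :
    lorentz gramT238 (weight gramT238 0) x ≤ 0 := by
  by_contra! hpos
  rw [lorentz_comm gramT238_isSymm, lorentz_weight_right] at hpos
  set c : Fin 11 → ℝ := fun i => lorentz gramT238 (Pi.single i 1) x
  have expand : ∀ k, x k = ∑ i, c i * ((twiceInverse k i : ℝ) / 2) := by
    intro k
    have h : x = ∑ i, c i • weight gramT238 i := by
      have hinv : gramT238⁻¹.mulVec (gramT238.mulVec x) = x := by
        rw [Matrix.mulVec_mulVec, Matrix.inv_eq_right_inv gramT238_mul_inverse,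
          mul_eq_one_comm.1 gramT238_mul_inverse, Matrix.one_mulVec]
      have hc : gramT238.mulVec x = ∑ i, c i • (Pi.single i 1 : Fin 11 → ℝ) := by
        ext j
        simp [c, lorentz_single_left, Matrix.mulVec, dotProduct, Pi.single_apply]
      rw [hc, Matrix.mulVec_sum] at hinv
      simp only [Matrix.mulVec_smul] at hinv
      exact hinv.symm
    conv_lhs => rw [h]
    simp [weight_gramT238_apply]
  -- The only negative entry of the inverse Gram matrix is at (0,0).
  have gnonneg : ∀ k i : Fin 11, k ≠ 0 → (0 : ℝ) ≤ (twiceInverse k i : ℝ) / 2 := by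
    have key : ∀ k : Fin 11, ∀ i, k ≠ 0 → 0 ≤ twiceInverse k i := by
      intro k i
      fin_cases k <;> fin_cases i <;> decide
    intro k i hk
    have : (0 : ℝ) ≤ twiceInverse k i := by exact_mod_cast key k i hk
    positivity
  have xnonneg : ∀ k, 0 ≤ x k := by
    intro k
    by_cases hk : k = 0
    · exact hk ▸ hpos.le
    · rw [expand k]
      exact Finset.sum_nonneg fun i _ => mul_nonneg (hdom i) (gnonneg k i hk)
  -- The square of x is Σ x_k c_k, now a vanishing sum of nonnegative terms.
  have hzero : ∀ k, x k * c k = 0 := by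
    rw [lorentz_eq_sum, Finset.sum_eq_zero_iff_of_nonneg
      fun k _ => mul_nonneg (xnonneg k) (hdom k)] at hx
    exact fun k => hx k (Finset.mem_univ k)
  have c0 : c 0 = 0 := (mul_eq_zero.1 (hzero 0)).resolve_left hpos.ne'
  -- If c_k > 0, then x_k = 0; but x_k ≥ c_k (w_k ⬝ w_k), and w_k ⬝ w_k is positive for k ≥ 2.
  have ck : ∀ k, k ≠ 0 → k ≠ 1 → c k = 0 := by
    intro k h0 h1
    by_contra hne
    have hck : 0 < c k := (hdom k).lt_of_ne' hne
    have hxk := (mul_eq_zero.1 (hzero k)).resolve_right hne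
    rw [expand, Finset.sum_eq_zero_iff_of_nonneg
      fun i _ => mul_nonneg (hdom i) (gnonneg k i h0)] at hxk
    have h2 := (mul_eq_zero.1 (hxk k (Finset.mem_univ k))).resolve_left hne
    have key : ∀ k : Fin 11, k ≠ 0 → k ≠ 1 → twiceInverse k k ≠ 0 := by decide +kernel
    rw [div_eq_zero_iff] at h2
    exact key k h0 h1 (by exact_mod_cast h2.resolve_right two_ne_zero)
  -- Only a multiple of w_1 remains, and w_0 ⬝ w_1 = 0 contradicts x_0 > 0.
  rw [expand, Finset.sum_eq_zero] at hpos
  · exact lt_irrefl _ hpos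
  · intro k _
    by_cases h0 : k = 0
    · rw [h0, c0, zero_mul]
    by_cases h1 : k = 1
    · rw [h1, show twiceInverse 0 1 = 0 from rfl]
      simp
    · rw [ck k h0 h1, zero_mul]

/-- Light-like vectors with integral products do not lie in the residual set. -/
theorem not_mem_residualSet_of_integral {x : Fin 11 → ℝ}
    (hx : x ∈ lightCone gramT238 (weylVector gramT238))
    (hint : ∀ i, ∃ z : ℤ, lorentz gramT238 (Pi.single i 1) x = z) :
    x ∉ residualSet gramT238 (weylVector gramT238) (coxeterPacking gramT238) := by
  rintro ⟨-, h⟩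
  obtain ⟨γ, hγ, hdom⟩ := exists_dominant_of_integral hx.1.ge hx.2 hint
  have h1 := lorentz_weight_zero_nonpos_of_dominant
    ((preservesProduct_weyl238 hγ x x).trans hx.1) hdom
  have h2 := h _ (mem_coxeterPacking.2 ⟨γ⁻¹, inv_mem hγ, rfl⟩)
  rw [map_smul, LinearMap.smul_apply, smul_eq_mul, lorentz_map_left (inv_mem hγ), inv_inv] at h2
  have := pos_of_mul_pos_right h2 (Real.sqrt_nonneg 2)
  linarith

/-! ### The packing is a Boyd–Maxwell packing -/

theorem isGeometricallyFinite_weyl238 :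
    IsGeometricallyFinite gramT238 (weylVector gramT238) (weylGroup gramT238) := by
  refine ⟨Set.range fun i : Fin 11 => Pi.single i 1, Set.finite_range _, ?_, ?_, ?_⟩
  · rintro _ ⟨i, rfl⟩
    change lorentz gramT238 (Pi.single i 1) (Pi.single i 1) < 0
    rw [lorentz_single_single, show gramT238 i i = -2 from coxeterGram_self _ i]
    norm_num
  · intro x hx
    obtain ⟨γ, hγ, h⟩ := exists_dominant_of_timelike (hx.1.symm ▸ one_pos) hx.2
    exact ⟨γ, hγ, Set.forall_mem_range.2 h⟩
  · rintro γ hγ hne x - ⟨h1, h2⟩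
    rw [Set.forall_mem_range] at h1 h2
    -- For this node γ⁻¹α_i ≤ 0, so α_i ⬝ γx = γ⁻¹α_i ⬝ x cannot be positive for x in the chamber.
    obtain ⟨i, hi⟩ := exists_root_nonpos (inv_mem hγ) (inv_ne_one.2 hne)
    have h3 := h2 i
    rw [lorentz_comm gramT238_isSymm, lorentz_map_left hγ, lorentz_comm gramT238_isSymm,
      lorentz_eq_sum] at h3
    exact not_le.2 h3 (Finset.sum_nonpos fun k _ =>
      mul_nonpos_of_nonpos_of_nonneg (hi k) (h1 k).le)

theorem isCrystallographicFor_weyl238 : IsCrystallographicFor gramT238 (weylVector gramT238)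
    (weylGroup gramT238) (coxeterPacking gramT238) := by
  set b := Pi.basisFun ℝ (Fin 11)
  have hΛ : ∀ v, v ∈ Submodule.span ℤ (Set.range b) ↔ HasIntegralCoords v := by
    intro v
    refine (b.mem_span_iff_repr_mem ℤ v).trans ?_
    refine forall_congr' fun i => ?_
    simp [b, eq_comm]
  -- The coordinates of w_0 are only half-integral; 2w_0 lies in the lattice and has the same
  -- normalization.
  refine ⟨Submodule.span ℤ (Set.range b), ⟨b, rfl⟩, fun γ hγ => ⟨isHyperbolicIsometry_weyl238 hγ,
    image_eq_of_forall_mem hγ fun δ hδ x hx => ?_⟩, isGeometricallyFinite_weyl238,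
    {(2 : ℝ) • weight gramT238 0}, Set.finite_singleton _, ?_, ?_, ?_⟩
  · exact (hΛ _).2 (((hΛ x).1 hx).map hδ)
  · rw [Set.singleton_subset_iff]
    exact (hΛ _).2 (hasIntegralCoords_two_smul_weight 0)
  · rintro _ rfl
    simp only [map_smul, LinearMap.smul_apply, smul_eq_mul, lorentz_weight_zero_self]
    norm_num
  · ext v
    rw [mem_coxeterPacking]
    simp only [normalizedOrbit, Set.mem_ofPred_eq, Set.mem_singleton_iff, exists_eq_left]
    refine exists_congr fun γ => and_congr_right fun hγ => ?_
    have : (lorentzLength gramT238 (γ ((2 : ℝ) • weight gramT238 0)))⁻¹ • γ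
        ((2 : ℝ) • weight gramT238 0) = Real.sqrt 2 • γ (weight gramT238 0) := by
      rw [lorentzLength, preservesProduct_weyl238 hγ, map_smul, map_smul, LinearMap.smul_apply,
        map_smul, lorentz_weight_zero_self, smul_smul, smul_eq_mul, smul_eq_mul]
      congr 1
      have := Real.mul_self_sqrt (show (0 : ℝ) ≤ 2 by norm_num)
      rw [show -(2 * (2 * -(1 / 2)) : ℝ) = 2 by norm_num, inv_mul_eq_div,
        div_eq_iff (Real.sqrt_pos.2 two_pos).ne', this]
    rw [this]

theorem isBoydMaxwellPacking_coxeterPacking :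
    IsBoydMaxwellPacking gramT238 (weylVector gramT238) (coxeterPacking gramT238) := by
  refine ⟨isPacking_coxeterPacking, Set.range fun i : Fin 11 => Pi.single i 1,
    Set.finite_range _, ?_, ?_⟩
  · rintro _ ⟨i, rfl⟩
    change lorentz gramT238 (Pi.single i 1) (Pi.single i 1) < 0
    rw [lorentz_single_single, show gramT238 i i = -2 from coxeterGram_self _ i]
    norm_num
  · rw [← Set.range_comp]
    exact isCrystallographicFor_weyl238

end Weyl238

/-! ### The `E₈` lattice and its roots -/

section E8

/-- Twice the coordinates of the simple roots of affine `E₈`, as nodes `2, …, 10` of the graph;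
node `2` is the affine one. -/
def nodeRows : Matrix (Fin 11) (Fin 8) ℤ :=
  !![0, 0, 0, 0, 0, 0, 0, 0;
     0, 0, 0, 0, 0, 0, 0, 0;
     0, 0, 0, 0, 0, 0, -2, -2;
     0, 0, 0, 0, 0, -2, 2, 0;
     0, 0, 0, 0, -2, 2, 0, 0;
     0, 0, 0, -2, 2, 0, 0, 0;
     0, 0, -2, 2, 0, 0, 0, 0;
     0, -2, 2, 0, 0, 0, 0, 0;
     -2, 2, 0, 0, 0, 0, 0, 0;
     1, -1, -1, -1, -1, -1, -1, 1;
     2, 2, 0, 0, 0, 0, 0, 0]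

/-- The simple roots of affine `E₈`, extended by zero to the nodes `0` and `1`. -/
def nodeVec (i : Fin 11) : EuclideanSpace ℝ (Fin 8) :=
  WithLp.toLp 2 fun k => (nodeRows i k : ℝ) / 2

theorem nodeVec_apply (i : Fin 11) (k : Fin 8) : nodeVec i k = (nodeRows i k : ℝ) / 2 := rfl

theorem inner_eq_sum (x y : EuclideanSpace ℝ (Fin 8)) : inner ℝ x y = ∑ k, x k * y k := by
  rw [PiLp.inner_apply]
  exact Finset.sum_congr rfl fun k _ => mul_comm _ _

/-- The part of the Gram matrix that comes from affine `E₈`. -/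
def affineGram : Matrix (Fin 11) (Fin 11) ℤ :=
  Matrix.of fun i j => if 2 ≤ i ∧ 2 ≤ j then -gramInt i j else 0

theorem inner_nodeVec (i j : Fin 11) : inner ℝ (nodeVec i) (nodeVec j) = (affineGram i j : ℝ) := by
  have key : nodeRows * nodeRows.transpose = Matrix.of fun i j => 4 * affineGram i j := by
    decide +kernel
  have h : ∑ k, nodeRows i k * nodeRows j k = 4 * affineGram i j := congrFun (congrFun key i) j
  have h' : ∑ k, (nodeRows i k : ℝ) * nodeRows j k = 4 * affineGram i j := by exact_mod_cast h
  rw [inner_eq_sum]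
  simp only [nodeVec_apply, div_mul_div_comm, ← Finset.sum_div]
  rw [h']
  ring

/-- The lattice as an additive group. -/
def latticeE8AddSubgroup : AddSubgroup (EuclideanSpace ℝ (Fin 8)) where
  carrier := latticeE8
  zero_mem' := ⟨Or.inl fun _ => ⟨0, by simp⟩, 0, by simp⟩
  add_mem' := by
    rintro x y ⟨hx, k, hk⟩ ⟨hy, l, hl⟩
    refine ⟨?_, k + l, ?_⟩
    · rcases hx with hx | hx <;> rcases hy with hy | hy <;> choose a ha using hx <;>
        choose b hb using hy
      · exact Or.inl fun i => ⟨a i + b i, by simp [ha, hb]⟩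
      · exact Or.inr fun i => ⟨a i + b i, by simp [ha, hb, add_assoc]⟩
      · exact Or.inr fun i => ⟨a i + b i, by simp [ha, hb]; ring⟩
      · exact Or.inl fun i => ⟨a i + b i + 1, by simp [ha, hb]; ring⟩
    · simp only [PiLp.add_apply, Finset.sum_add_distrib, hk, hl]
      push_cast
      ring
  neg_mem' := by
    rintro x ⟨hx, k, hk⟩
    refine ⟨?_, -k, ?_⟩
    · rcases hx with hx | hx <;> choose a ha using hx
      · exact Or.inl fun i => ⟨-a i, by simp [ha]⟩
      · exact Or.inr fun i => ⟨-a i - 1, by simp [ha]; ring⟩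
    · simp only [PiLp.neg_apply, Finset.sum_neg_distrib, hk]
      push_cast
      ring

theorem nodeVec_mem (i : Fin 11) : nodeVec i ∈ latticeE8AddSubgroup := by
  have key : ∀ i : Fin 11, ((∀ k, nodeRows i k % 2 = 0) ∨ ∀ k, nodeRows i k % 2 = 1) ∧
      (∑ k, nodeRows i k) % 4 = 0 := by decide +kernel
  obtain ⟨h1, h2⟩ := key i
  refine ⟨?_, (∑ k, nodeRows i k) / 4, ?_⟩
  · refine h1.imp (fun h k => ⟨nodeRows i k / 2, ?_⟩) fun h k => ⟨nodeRows i k / 2, ?_⟩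
    · have : nodeRows i k = 2 * (nodeRows i k / 2) := by have := h k; omega
      have : (nodeRows i k : ℝ) = 2 * ((nodeRows i k / 2 : ℤ) : ℝ) := by exact_mod_cast this
      rw [nodeVec_apply, this]
      ring
    · have : nodeRows i k = 2 * (nodeRows i k / 2) + 1 := by have := h k; omega
      have : (nodeRows i k : ℝ) = 2 * ((nodeRows i k / 2 : ℤ) : ℝ) + 1 := by exact_mod_cast this
      rw [nodeVec_apply, this]
      ring
  · have : ∑ k, nodeRows i k = 4 * ((∑ k, nodeRows i k) / 4) := by omega
    have : ∑ k, (nodeRows i k : ℝ) = 4 * (((∑ k, nodeRows i k) / 4 : ℤ) : ℝ) := by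
      exact_mod_cast this
    simp only [nodeVec_apply, ← Finset.sum_div]
    rw [this]
    ring

/-- The simple roots of `E₈` generate the lattice. -/
theorem latticeE8_le_closure :
    latticeE8AddSubgroup ≤ AddSubgroup.closure (nodeVec '' {i | 3 ≤ i}) := by
  rintro x ⟨hx, k, hk⟩
  obtain ⟨p, hp⟩ : ∃ p : ℤ, 2 * x 7 = p := by
    rcases hx with h | h
    · obtain ⟨a, ha⟩ := h 7
      exact ⟨2 * a, by rw [ha]; push_cast; ring⟩
    · obtain ⟨a, ha⟩ := h 7
      exact ⟨2 * a + 1, by rw [ha]; push_cast; ring⟩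
  have hadd : ∀ i, ∃ z : ℤ, x i + x 7 = z := by
    intro i
    rcases hx with h | h <;> obtain ⟨a, ha⟩ := h 7 <;> obtain ⟨b, hb⟩ := h i
    · exact ⟨b + a, by rw [ha, hb]; push_cast; ring⟩
    · exact ⟨b + a + 1, by rw [ha, hb]; push_cast; ring⟩
  choose u hu using hadd
  rw [Fin.sum_univ_eight] at hk
  -- Root 9 is the only one used with a nonzero last coordinate, so its coefficient is p = 2x₇. The
  -- remaining coefficients follow by solving from the other coordinates, with u_i = x_i + x₇ and Σ
  -- x_i = 2k keeping them integral.
  have e : x = (u 6) • nodeVec 3 + (u 5 + u 6) • nodeVec 4 + (u 4 + u 5 + u 6) • nodeVec 5 +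
      (u 3 + u 4 + u 5 + u 6) • nodeVec 6 + (u 2 + u 3 + u 4 + u 5 + u 6) • nodeVec 7 +
      (k + p - u 0 + p) • nodeVec 8 + p • nodeVec 9 + (k + p) • nodeVec 10 := by
    ext i
    simp only [← Int.cast_smul_eq_zsmul ℝ, PiLp.add_apply, PiLp.smul_apply, smul_eq_mul,
      nodeVec_apply]
    push_cast
    simp only [← hu, ← hp]
    fin_cases i <;> simp [nodeRows] <;> linarith
  rw [e]
  have hm : ∀ (c : ℤ) (i : Fin 11), 3 ≤ i →
      c • nodeVec i ∈ AddSubgroup.closure (nodeVec '' {i | 3 ≤ i}) := fun c i hi =>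
    zsmul_mem (AddSubgroup.subset_closure (Set.mem_image_of_mem nodeVec hi)) c
  repeat' first | apply add_mem | exact hm _ _ (by decide)

theorem exists_int_inner_nodeVec {x : EuclideanSpace ℝ (Fin 8)} (hx : x ∈ latticeE8AddSubgroup)
    (i : Fin 11) : ∃ z : ℤ, inner ℝ x (nodeVec i) = z := by
  have h := latticeE8_le_closure hx
  clear hx
  induction h using AddSubgroup.closure_induction with
  | mem x hx =>
    obtain ⟨j, -, rfl⟩ := hx
    exact ⟨_, inner_nodeVec j i⟩
  | zero => exact ⟨0, by simp⟩
  | add x y _ _ h1 h2 =>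
    obtain ⟨a, ha⟩ := h1
    obtain ⟨b, hb⟩ := h2
    exact ⟨a + b, by rw [inner_add_left, ha, hb]; push_cast; rfl⟩
  | neg x _ h =>
    obtain ⟨a, ha⟩ := h
    exact ⟨-a, by rw [inner_neg_left, ha]; push_cast; rfl⟩

/-- The Weyl vector of `E₈`. -/
def rhoE8 : EuclideanSpace ℝ (Fin 8) := !₂[0, 1, 2, 3, 4, 5, 6, 23]

theorem inner_rhoE8 (x : EuclideanSpace ℝ (Fin 8)) : inner ℝ rhoE8 x =
    x 1 + 2 * x 2 + 3 * x 3 + 4 * x 4 + 5 * x 5 + 6 * x 6 + 23 * x 7 := by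
  rw [inner_eq_sum, Fin.sum_univ_eight]
  simp [rhoE8]

theorem inner_rhoE8_nodeVec {i : Fin 11} (hi : 3 ≤ i) : inner ℝ rhoE8 (nodeVec i) = 1 := by
  have key : ∀ i : Fin 11, 3 ≤ i → nodeRows i 1 + 2 * nodeRows i 2 + 3 * nodeRows i 3 +
      4 * nodeRows i 4 + 5 * nodeRows i 5 + 6 * nodeRows i 6 + 23 * nodeRows i 7 = 2 := by
    decide +kernel
  have : (nodeRows i 1 : ℝ) + 2 * nodeRows i 2 + 3 * nodeRows i 3 +
      4 * nodeRows i 4 + 5 * nodeRows i 5 + 6 * nodeRows i 6 + 23 * nodeRows i 7 = 2 := by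
    exact_mod_cast key i hi
  rw [inner_rhoE8]
  simp only [nodeVec_apply]
  linarith

theorem rhoE8_eq : rhoE8 = (29 : ℝ) • nodeVec 3 + (57 : ℝ) • nodeVec 4 + (84 : ℝ) • nodeVec 5 +
    (110 : ℝ) • nodeVec 6 + (135 : ℝ) • nodeVec 7 + (91 : ℝ) • nodeVec 8 + (46 : ℝ) • nodeVec 9 +
    (68 : ℝ) • nodeVec 10 := by
  ext i
  simp only [PiLp.add_apply, PiLp.smul_apply, smul_eq_mul, nodeVec_apply]
  fin_cases i <;> simp [nodeRows, rhoE8] <;> norm_num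

/-- The Weyl vector is a positive combination of the simple roots. -/
theorem exists_nodeVec_inner_pos {x : EuclideanSpace ℝ (Fin 8)} (hx : 0 < inner ℝ rhoE8 x) :
    ∃ i, 3 ≤ i ∧ 0 < inner ℝ x (nodeVec i) := by
  by_contra! h
  rw [rhoE8_eq, real_inner_comm] at hx
  simp only [inner_add_right, real_inner_smul_right] at hx
  have h3 := h 3 (by decide)
  have h4 := h 4 (by decide)
  have h5 := h 5 (by decide)
  have h6 := h 6 (by decide)
  have h7 := h 7 (by decide)
  have h8 := h 8 (by decide)
  have h9 := h 9 (by decide)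
  have h10 := h 10 (by decide)
  linarith

/-- No root is orthogonal to the Weyl vector. -/
theorem inner_rhoE8_ne_zero {r : EuclideanSpace ℝ (Fin 8)} (hr : r ∈ latticeE8AddSubgroup)
    (h2 : inner ℝ r r = (2 : ℝ)) : inner ℝ rhoE8 r ≠ (0 : ℝ) := by
  rw [inner_eq_sum, Fin.sum_univ_eight] at h2
  rw [inner_rhoE8]
  obtain ⟨h | h, -⟩ := hr <;> choose a ha using h <;> simp only [ha] at h2 ⊢
  · have h2' : a 0 * a 0 + a 1 * a 1 + a 2 * a 2 + a 3 * a 3 + a 4 * a 4 + a 5 * a 5 +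
        a 6 * a 6 + a 7 * a 7 = 2 := by exact_mod_cast h2
    have hle : ∀ i, -1 ≤ a i ∧ a i ≤ 1 := by
      have hs : ∑ i, a i * a i = 2 := by rw [Fin.sum_univ_eight]; exact h2'
      intro i
      have : a i * a i ≤ 2 := hs ▸ Finset.single_le_sum (f := fun i => a i * a i)
        (fun i _ => mul_self_nonneg _) (Finset.mem_univ i)
      constructor <;> nlinarith
    intro h0
    have h0' : a 1 + 2 * a 2 + 3 * a 3 + 4 * a 4 + 5 * a 5 + 6 * a 6 + 23 * a 7 = 0 := by
      exact_mod_cast h0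
    have key : ∀ b₀ b₁ b₂ b₃ b₄ b₅ b₆ : Fin 3,
        ((b₀ : ℤ) - 1) * (b₀ - 1) + (b₁ - 1) * (b₁ - 1) + (b₂ - 1) * (b₂ - 1) +
          (b₃ - 1) * (b₃ - 1) + (b₄ - 1) * (b₄ - 1) + (b₅ - 1) * (b₅ - 1) +
          (b₆ - 1) * (b₆ - 1) = 2 →
        ((b₁ : ℤ) - 1) + 2 * (b₂ - 1) + 3 * (b₃ - 1) + 4 * (b₄ - 1) + 5 * (b₅ - 1) +
          6 * (b₆ - 1) ≠ 0 := by decide +kernel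
    have hfin : ∀ i, ∃ b : Fin 3, a i = (b : ℤ) - 1 := fun i => by
      obtain ⟨h1, h3⟩ := hle i
      refine ⟨⟨(a i + 1).toNat, by omega⟩, ?_⟩
      simp only [Int.toNat_of_nonneg (show 0 ≤ a i + 1 by omega)]
      ring
    -- The other terms sum to at most 1 + 2 + ⋯ + 6 = 21 < 23 in absolute value. The remaining seven
    -- coordinates are in {-1, 0, 1} and are checked exhaustively.
    have h7 : a 7 = 0 := by
      have := hle 1; have := hle 2; have := hle 3; have := hle 4; have := hle 5
      have := hle 6; have := hle 7
      omega
    rw [h7] at h0' h2'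
    choose b hb using hfin
    refine key (b 0) (b 1) (b 2) (b 3) (b 4) (b 5) (b 6) ?_ ?_
    · simp only [← hb]; linarith
    · simp only [← hb]; linarith
  · have hodd : ∀ i, (1 : ℤ) ≤ (2 * a i + 1) * (2 * a i + 1) := fun i => by
      have : (2 * a i + 1) ≠ 0 := by omega
      have := mul_self_pos.2 this
      omega
    have h2' : (2 * a 0 + 1) * (2 * a 0 + 1) + (2 * a 1 + 1) * (2 * a 1 + 1) +
        (2 * a 2 + 1) * (2 * a 2 + 1) + (2 * a 3 + 1) * (2 * a 3 + 1) +
        (2 * a 4 + 1) * (2 * a 4 + 1) + (2 * a 5 + 1) * (2 * a 5 + 1) +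
        (2 * a 6 + 1) * (2 * a 6 + 1) + (2 * a 7 + 1) * (2 * a 7 + 1) = 8 := by
      have : ((2 * a 0 + 1) * (2 * a 0 + 1) + (2 * a 1 + 1) * (2 * a 1 + 1) +
        (2 * a 2 + 1) * (2 * a 2 + 1) + (2 * a 3 + 1) * (2 * a 3 + 1) +
        (2 * a 4 + 1) * (2 * a 4 + 1) + (2 * a 5 + 1) * (2 * a 5 + 1) +
        (2 * a 6 + 1) * (2 * a 6 + 1) + (2 * a 7 + 1) * (2 * a 7 + 1) : ℝ) = 8 := by linarith
      exact_mod_cast this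
    -- Eight odd squares with sum 8 are all 1. Each coordinate is then ±1/2, and the term with
    -- weight 23 again cannot be cancelled by the others.
    have hle : ∀ i, -1 ≤ a i ∧ a i ≤ 0 := by
      have hs : ∑ i, (2 * a i + 1) * (2 * a i + 1) = 8 := by
        rw [Fin.sum_univ_eight]; exact h2'
      intro i
      have h1 : (2 * a i + 1) * (2 * a i + 1) ≤ 1 := by
        have h3 := Finset.add_sum_erase Finset.univ
          (fun i => (2 * a i + 1) * (2 * a i + 1)) (Finset.mem_univ i)
        have h4 : ((Finset.univ.erase i).card : ℤ) ≤
            ∑ j ∈ Finset.univ.erase i, (2 * a j + 1) * (2 * a j + 1) := by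
          rw [Finset.cast_card]
          exact Finset.sum_le_sum fun j _ => hodd j
        rw [Finset.card_erase_of_mem (Finset.mem_univ i), Finset.card_univ, Fintype.card_fin] at h4
        push_cast at h4
        linarith
      constructor <;> nlinarith
    intro h0
    have h0' : (2 * a 1 + 1) + 2 * (2 * a 2 + 1) + 3 * (2 * a 3 + 1) + 4 * (2 * a 4 + 1) +
        5 * (2 * a 5 + 1) + 6 * (2 * a 6 + 1) + 23 * (2 * a 7 + 1) = 0 := by
      have : ((2 * a 1 + 1) + 2 * (2 * a 2 + 1) + 3 * (2 * a 3 + 1) + 4 * (2 * a 4 + 1) +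
        5 * (2 * a 5 + 1) + 6 * (2 * a 6 + 1) + 23 * (2 * a 7 + 1) : ℝ) = 0 := by linarith
      exact_mod_cast this
    have := hle 1; have := hle 2; have := hle 3; have := hle 4; have := hle 5
    have := hle 6; have := hle 7
    omega

theorem exists_int_inner_rhoE8 {x : EuclideanSpace ℝ (Fin 8)} (hx : x ∈ latticeE8AddSubgroup) :
    ∃ z : ℤ, inner ℝ rhoE8 x = z := by
  choose a ha using exists_int_inner_nodeVec hx
  refine ⟨29 * a 3 + 57 * a 4 + 84 * a 5 + 110 * a 6 + 135 * a 7 + 91 * a 8 + 46 * a 9 +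
    68 * a 10, ?_⟩
  rw [rhoE8_eq, real_inner_comm]
  simp only [inner_add_right, real_inner_smul_right, ha]
  push_cast
  ring

/-- Every root is obtained from simple roots by simple reflections and changes of sign. -/
theorem e8_root_induction {P : EuclideanSpace ℝ (Fin 8) → Prop}
    (simple : ∀ i, 3 ≤ i → P (nodeVec i)) (neg : ∀ r, P r → P (-r))
    (refl : ∀ r i, 3 ≤ i → P r → P (r - inner ℝ r (nodeVec i) • nodeVec i))
    {r : EuclideanSpace ℝ (Fin 8)} (hr : r ∈ latticeE8AddSubgroup)
    (h2 : inner ℝ r r = (2 : ℝ)) : P r := by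
  -- Induction on the height ρ ⬝ r; a root of negative height is treated through its negative.
  have pos : ∀ n : ℕ, ∀ r ∈ latticeE8AddSubgroup, inner ℝ r r = (2 : ℝ) →
      inner ℝ rhoE8 r = (n : ℝ) → P r := by
    intro n
    induction n with
    | zero => exact fun r hr h2 h0 => absurd (by simpa using h0) (inner_rhoE8_ne_zero hr h2)
    | succ n ih =>
      intro r hr h2 hn
      obtain ⟨i, hi, hpos⟩ := exists_nodeVec_inner_pos (x := r) (by rw [hn]; positivity)
      obtain ⟨z, hz⟩ := exists_int_inner_nodeVec hr i
      have hself : inner ℝ (nodeVec i) (nodeVec i) = (2 : ℝ) := by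
        have key : ∀ i : Fin 11, 3 ≤ i → affineGram i i = 2 := by decide +kernel
        rw [inner_nodeVec, key i hi]
        norm_num
      -- This square forces z = 1 or z = 2. For z = 1 the difference is a root of height one less
      -- whose reflection is r; for z = 2 it vanishes and r is simple.
      have hsub : inner ℝ (r - nodeVec i) (r - nodeVec i) = 4 - 2 * (z : ℝ) := by
        rw [inner_sub_sub_self, h2, hself, real_inner_comm r (nodeVec i), hz]
        ring
      have hz0 : 0 < z := by rw [hz] at hpos; exact_mod_cast hpos
      have hz2 : z ≤ 2 := by
        have : (0 : ℝ) ≤ 4 - 2 * (z : ℝ) := hsub ▸ real_inner_self_nonneg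
        have : (z : ℝ) ≤ 2 := by linarith
        exact_mod_cast this
      obtain rfl | rfl : z = 1 ∨ z = 2 := by omega
      · have hr' : P (r - nodeVec i) := by
          refine ih _ (sub_mem hr (nodeVec_mem i)) (by rw [hsub]; norm_num) ?_
          rw [inner_sub_right, hn, inner_rhoE8_nodeVec hi]
          push_cast
          ring
        have := refl _ i hi hr'
        rw [inner_sub_left, hz, hself] at this
        convert this using 1
        push_cast
        module
      · have : r - nodeVec i = 0 := by
          rw [← inner_self_eq_zero (𝕜 := ℝ), hsub]
          norm_num
        rw [sub_eq_zero.1 this]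
        exact simple i hi
  obtain ⟨z, hz⟩ := exists_int_inner_rhoE8 hr
  obtain ⟨n, rfl | rfl⟩ := z.eq_nat_or_neg
  · exact pos n r hr h2 (by simpa using hz)
  · have := pos n (-r) (neg_mem hr) (by simpa using h2) (by rw [inner_neg_right, hz]; simp)
    simpa using neg _ this

end E8

/-! ### A model of Lorentz space with horospherical coordinates -/

section Model

/-- The model `ℝ⁹ ⊕ ℝ ⊕ ℝ` of Lorentz space; the first summand is negative definite and the sum
of the other two is a hyperbolic plane. -/
abbrev Model : Type := EuclideanSpace ℝ (Fin 9) × ℝ × ℝ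

/-- The product of the model. -/
def modelForm : LinearMap.BilinForm ℝ Model :=
  LinearMap.mk₂ ℝ (fun u v => -inner ℝ u.1 v.1 + u.2.1 * v.2.2 + u.2.2 * v.2.1)
    (fun u u' v => by simp [inner_add_left]; ring)
    (fun c u v => by simp [real_inner_smul_left]; ring)
    (fun u v v' => by simp [inner_add_right]; ring)
    (fun c u v => by simp [real_inner_smul_right]; ring)

theorem modelForm_apply (u v : Model) :
    modelForm u v = -inner ℝ u.1 v.1 + u.2.1 * v.2.2 + u.2.2 * v.2.1 := rfl

theorem modelForm_comm (u v : Model) : modelForm u v = modelForm v u := by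
  rw [modelForm_apply, modelForm_apply, real_inner_comm]
  ring

/-- The reflection in a vector of the model. -/
def modelReflection (n : Model) : Model ≃ₗ[ℝ] Model :=
  LinearEquiv.ofInvolutive
    (LinearMap.id - (2 / modelForm n n) • (modelForm n).smulRight n) (by
      intro x
      simp only [LinearMap.sub_apply, LinearMap.id_apply, LinearMap.smul_apply,
        LinearMap.smulRight_apply, map_sub, map_smul]
      by_cases h : modelForm n n = 0
      · simp [h]
      · match_scalars
        · ring
        · field_simp
          ring)

theorem modelReflection_apply {n : Model} (hn : modelForm n n = -2) (x : Model) :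
    modelReflection n x = x + modelForm n x • n := by
  change x - (2 / modelForm n n) • modelForm n x • n = _
  rw [hn]
  module

theorem modelReflection_neg (n : Model) : modelReflection (-n) = modelReflection n := by
  ext1 x
  change x - (2 / modelForm (-n) (-n)) • modelForm (-n) x • (-n) =
    x - (2 / modelForm n n) • modelForm n x • n
  simp

/-- Linear maps that preserve the product of the model. -/
def ModelIsometry (F : Model ≃ₗ[ℝ] Model) : Prop :=
  ∀ u v, modelForm (F u) (F v) = modelForm u v

theorem ModelIsometry.conj {F : Model ≃ₗ[ℝ] Model} (hF : ModelIsometry F) (n : Model) :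
    F * modelReflection n * F⁻¹ = modelReflection (F n) := by
  ext1 x
  obtain ⟨y, rfl⟩ := F.surjective x
  have hy : F⁻¹ (F y) = y := F.symm_apply_apply y
  rw [LinearEquiv.mul_apply, LinearEquiv.mul_apply, hy]
  change F (y - (2 / modelForm n n) • modelForm n y • n) =
    F y - (2 / modelForm (F n) (F n)) • modelForm (F n) (F y) • F n
  rw [hF, hF, map_sub, map_smul, map_smul]

/-- The lift of the isometry `x ↦ A x + c` of `ℝ⁹`. -/
def affineLift (A : EuclideanSpace ℝ (Fin 9) ≃ₗᵢ[ℝ] EuclideanSpace ℝ (Fin 9))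
    (c : EuclideanSpace ℝ (Fin 9)) : Model ≃ₗ[ℝ] Model where
  toFun u := (A u.1 + u.2.1 • c, u.2.1, u.2.2 + inner ℝ (A u.1) c + u.2.1 * inner ℝ c c / 2)
  map_add' u v := by
    ext1
    · simp; module
    · ext1
      · simp
      · simp [inner_add_left]; ring
  map_smul' t u := by
    ext1
    · simp; module
    · ext1
      · simp
      · simp [real_inner_smul_left]; ring
  invFun u := (A.symm (u.1 - u.2.1 • c), u.2.1,
    u.2.2 - inner ℝ u.1 c + u.2.1 * inner ℝ c c / 2)
  left_inv u := by
    ext1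
    · simp
    · ext1
      · simp
      · simp only [inner_add_left, real_inner_smul_left]; ring
  right_inv u := by
    ext1
    · simp
    · ext1
      · simp
      · simp only [LinearIsometryEquiv.apply_symm_apply, inner_sub_left, real_inner_smul_left]
        ring

theorem affineLift_apply (A : EuclideanSpace ℝ (Fin 9) ≃ₗᵢ[ℝ] EuclideanSpace ℝ (Fin 9))
    (c : EuclideanSpace ℝ (Fin 9)) (u : Model) : affineLift A c u =
      (A u.1 + u.2.1 • c, u.2.1, u.2.2 + inner ℝ (A u.1) c + u.2.1 * inner ℝ c c / 2) := rfl

theorem modelIsometry_affineLift (A : EuclideanSpace ℝ (Fin 9) ≃ₗᵢ[ℝ] EuclideanSpace ℝ (Fin 9))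
    (c : EuclideanSpace ℝ (Fin 9)) : ModelIsometry (affineLift A c) := fun u v => by
  simp only [affineLift_apply, modelForm_apply, inner_add_left, inner_add_right,
    real_inner_smul_left, real_inner_smul_right, LinearIsometryEquiv.inner_map_map,
    real_inner_comm c]
  ring

/-- The lift of a translation. -/
def translationLift (c : EuclideanSpace ℝ (Fin 9)) : Model ≃ₗ[ℝ] Model :=
  affineLift (LinearIsometryEquiv.refl ℝ _) c

theorem translationLift_apply (c : EuclideanSpace ℝ (Fin 9)) (u : Model) : translationLift c u =
    (u.1 + u.2.1 • c, u.2.1, u.2.2 + inner ℝ u.1 c + u.2.1 * inner ℝ c c / 2) := rfl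

theorem translationLift_add (c d : EuclideanSpace ℝ (Fin 9)) :
    translationLift (c + d) = translationLift c * translationLift d := by
  ext1 u
  simp only [LinearEquiv.mul_apply, translationLift_apply, inner_add_left, inner_add_right,
    real_inner_smul_left, real_inner_comm d c]
  ext1
  · simp only; module
  · ext1
    · rfl
    · simp only; ring

theorem translationLift_zero : translationLift 0 = 1 := by
  ext1 u
  simp [translationLift_apply]

theorem translationLift_neg (c : EuclideanSpace ℝ (Fin 9)) :
    translationLift (-c) = (translationLift c)⁻¹ := by
  rw [eq_inv_iff_mul_eq_one, ← translationLift_add, neg_add_cancel, translationLift_zero]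

theorem affineLift_eq (A : EuclideanSpace ℝ (Fin 9) ≃ₗᵢ[ℝ] EuclideanSpace ℝ (Fin 9))
    (c : EuclideanSpace ℝ (Fin 9)) : affineLift A c = translationLift c * affineLift A 0 := by
  ext1 u
  simp [LinearEquiv.mul_apply, translationLift_apply, affineLift_apply]

end Model

/-! ### The nodes in the model -/

section Nodes

/-- The hyperplane `ι(ℝ⁸)` has the unit normal `h`. -/
structure IsUnitNormal (ι : EuclideanSpace ℝ (Fin 8) →ₗᵢ[ℝ] EuclideanSpace ℝ (Fin 9))
    (h : EuclideanSpace ℝ (Fin 9)) : Prop where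
  norm_eq : ‖h‖ = 1
  inner_eq : ∀ x, inner ℝ h (ι x) = 0

variable {ι : EuclideanSpace ℝ (Fin 8) →ₗᵢ[ℝ] EuclideanSpace ℝ (Fin 9)}
  {h : EuclideanSpace ℝ (Fin 9)}

theorem IsUnitNormal.inner_self (hu : IsUnitNormal ι h) : inner ℝ h h = (1 : ℝ) := by
  rw [real_inner_self_eq_norm_sq, hu.norm_eq, one_pow]

theorem IsUnitNormal.inner_eq' (hu : IsUnitNormal ι h) (x : EuclideanSpace ℝ (Fin 8)) :
    inner ℝ (ι x) h = (0 : ℝ) := by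
  rw [real_inner_comm, hu.inner_eq]

/-- Twice the components of the nodes in the direction `√2 h`, four times the coordinates in the
hyperbolic plane. -/
def nodeExtra : Fin 3 → Fin 11 → ℤ :=
  ![![-2, 1, 0, 0, 0, 0, 0, 0, 0, 0, 0],
    ![0, 4, 0, 0, 0, 0, 0, 0, 0, 0, 0],
    ![0, -3, 4, 0, 0, 0, 0, 0, 0, 0, 0]]

variable (ι h) in
/-- The nodes of the graph as vectors of the model. -/
def nodeModel (i : Fin 11) : Model :=
  (ι (nodeVec i) + ((nodeExtra 0 i : ℝ) / 2 * Real.sqrt 2) • h,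
    (nodeExtra 1 i : ℝ) / 4, (nodeExtra 2 i : ℝ) / 4)

theorem sqrt_two_mul_self : Real.sqrt 2 * Real.sqrt 2 = 2 := Real.mul_self_sqrt (by norm_num)

theorem gramInt_eq (i j : Fin 11) : 16 * gramInt i j = -16 * affineGram i j -
    8 * nodeExtra 0 i * nodeExtra 0 j + nodeExtra 1 i * nodeExtra 2 j +
      nodeExtra 2 i * nodeExtra 1 j := by
  have key : Matrix.of (fun i j => 16 * gramInt i j) =
    Matrix.of fun i j => -16 * affineGram i j -
    8 * nodeExtra 0 i * nodeExtra 0 j + nodeExtra 1 i * nodeExtra 2 j +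
      nodeExtra 2 i * nodeExtra 1 j := by decide +kernel
  exact congrFun (congrFun key i) j

theorem modelForm_node (hu : IsUnitNormal ι h) (i j : Fin 11) :
    modelForm (nodeModel ι h i) (nodeModel ι h j) = gramT238 i j := by
  have key : (16 : ℝ) * gramInt i j = -16 * affineGram i j -
    8 * nodeExtra 0 i * nodeExtra 0 j + nodeExtra 1 i * nodeExtra 2 j +
      nodeExtra 2 i * nodeExtra 1 j := by exact_mod_cast gramInt_eq i j
  rw [gramT238_eq, Matrix.map_apply, modelForm_apply]
  simp only [nodeModel, inner_add_left, inner_add_right, real_inner_smul_left,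
    real_inner_smul_right, hu.inner_self, hu.inner_eq, hu.inner_eq', LinearIsometry.inner_map_map,
    inner_nodeVec]
  have := sqrt_two_mul_self
  linear_combination (-1 / 16 : ℝ) * key -
    (nodeExtra 0 i : ℝ) * nodeExtra 0 j / 4 * sqrt_two_mul_self

theorem modelForm_node_self (hu : IsUnitNormal ι h) (i : Fin 11) :
    modelForm (nodeModel ι h i) (nodeModel ι h i) = -2 := by
  rw [modelForm_node hu]
  exact coxeterGram_self _ i

variable (ι h) in
/-- The linear map to the model that sends the standard basis to the nodes. -/
def toModel : (Fin 11 → ℝ) →ₗ[ℝ] Model := Fintype.linearCombination ℝ (nodeModel ι h)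

theorem toModel_single (i : Fin 11) : toModel ι h (Pi.single i 1) = nodeModel ι h i := by
  simp [toModel, Fintype.linearCombination_apply_single]

theorem modelForm_toModel (hu : IsUnitNormal ι h) (u v : Fin 11 → ℝ) :
    modelForm (toModel ι h u) (toModel ι h v) = lorentz gramT238 u v := by
  rw [lorentz, Matrix.toBilin'_apply]
  simp only [toModel, Fintype.linearCombination_apply, map_sum, LinearMap.sum_apply, map_smul,
    LinearMap.smul_apply, modelForm_node hu, smul_eq_mul]
  rw [Finset.sum_comm]
  refine Finset.sum_congr rfl fun i _ => ?_
  rw [Finset.mul_sum]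
  exact Finset.sum_congr rfl fun j _ => by ring

theorem lorentz_ext {u v : Fin 11 → ℝ}
    (huv : ∀ x, lorentz gramT238 u x = lorentz gramT238 v x) : u = v := by
  ext k
  rw [← lorentz_weight_right u, ← lorentz_weight_right v, huv]

/-- An isometry from a nondegenerate space is injective; equality of dimensions then makes it an
isomorphism. -/
theorem toModel_injective (hu : IsUnitNormal ι h) : Function.Injective (toModel ι h) := by
  intro u v huv
  refine lorentz_ext fun x => ?_
  rw [← modelForm_toModel hu, ← modelForm_toModel hu, huv]

/-- The isomorphism with the model. -/
def modelEquiv (hu : IsUnitNormal ι h) : (Fin 11 → ℝ) ≃ₗ[ℝ] Model :=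
  LinearMap.linearEquivOfInjective (toModel ι h) (toModel_injective hu) (by simp)

theorem modelEquiv_apply (hu : IsUnitNormal ι h) (u : Fin 11 → ℝ) :
    modelEquiv hu u = toModel ι h u := rfl

theorem modelEquiv_single (hu : IsUnitNormal ι h) (i : Fin 11) :
    modelEquiv hu (Pi.single i 1) = nodeModel ι h i := toModel_single i

theorem modelForm_modelEquiv (hu : IsUnitNormal ι h) (u v : Fin 11 → ℝ) :
    modelForm (modelEquiv hu u) (modelEquiv hu v) = lorentz gramT238 u v :=
  modelForm_toModel hu u v

theorem lorentz_modelEquiv_symm (hu : IsUnitNormal ι h) (x : Fin 11 → ℝ) (m : Model) :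
    lorentz gramT238 x ((modelEquiv hu).symm m) = modelForm (modelEquiv hu x) m := by
  rw [← modelForm_modelEquiv hu, LinearEquiv.apply_symm_apply]

theorem modelEquiv_simpleReflection (hu : IsUnitNormal ι h) (i : Fin 11) (u : Fin 11 → ℝ) :
    modelEquiv hu (simpleReflection treeT238 i u) =
      modelReflection (nodeModel ι h i) (modelEquiv hu u) := by
  rw [simpleReflection_apply, modelReflection_apply (modelForm_node_self hu i), map_add, map_smul,
    modelEquiv_single, ← modelEquiv_single hu, modelForm_modelEquiv]

/-- The Weyl group, acting on the model. -/
def modelWeyl (hu : IsUnitNormal ι h) : Subgroup (Model ≃ₗ[ℝ] Model) where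
  carrier := {F | ∃ γ ∈ weylGroup gramT238, ∀ u, modelEquiv hu (γ u) = F (modelEquiv hu u)}
  one_mem' := ⟨1, one_mem _, fun _ => rfl⟩
  mul_mem' := by
    rintro F F' ⟨γ, hγ, e⟩ ⟨γ', hγ', e'⟩
    exact ⟨γ * γ', mul_mem hγ hγ', fun u => by simp only [LinearEquiv.mul_apply, e, e']⟩
  inv_mem' := by
    rintro F ⟨γ, hγ, e⟩
    refine ⟨γ⁻¹, inv_mem hγ, fun u => F.injective ?_⟩
    rw [← e, ← LinearEquiv.mul_apply, ← LinearEquiv.mul_apply, mul_inv_cancel, mul_inv_cancel]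
    rfl

theorem exists_modelWeyl (hu : IsUnitNormal ι h) {γ : (Fin 11 → ℝ) ≃ₗ[ℝ] (Fin 11 → ℝ)}
    (hγ : γ ∈ weylGroup gramT238) :
    ∃ F ∈ modelWeyl hu, ∀ u, modelEquiv hu (γ u) = F (modelEquiv hu u) :=
  ⟨((modelEquiv hu).symm.trans γ).trans (modelEquiv hu), ⟨γ, hγ, fun u => by simp⟩,
    fun u => by simp⟩

theorem node_mem_modelWeyl (hu : IsUnitNormal ι h) (i : Fin 11) :
    modelReflection (nodeModel ι h i) ∈ modelWeyl hu :=
  ⟨simpleReflection treeT238 i, simpleReflection_mem _ i, modelEquiv_simpleReflection hu i⟩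

theorem modelIsometry_of_mem (hu : IsUnitNormal ι h) {F : Model ≃ₗ[ℝ] Model}
    (hF : F ∈ modelWeyl hu) : ModelIsometry F := by
  obtain ⟨γ, hγ, e⟩ := hF
  intro u v
  obtain ⟨u, rfl⟩ := (modelEquiv hu).surjective u
  obtain ⟨v, rfl⟩ := (modelEquiv hu).surjective v
  rw [← e, ← e, modelForm_modelEquiv, modelForm_modelEquiv, preservesProduct_weyl238 hγ]

/-- The Weyl group of the model is generated by the reflections in the nodes. -/
theorem modelWeyl_le (hu : IsUnitNormal ι h) {K : Subgroup (Model ≃ₗ[ℝ] Model)}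
    (hK : ∀ i, modelReflection (nodeModel ι h i) ∈ K) : modelWeyl hu ≤ K := by
  rintro F ⟨γ, hγ, e⟩
  induction hγ using Subgroup.closure_induction generalizing F with
  | mem x hx =>
    obtain ⟨i, rfl⟩ := hx
    convert hK i using 1
    ext1 u
    obtain ⟨u, rfl⟩ := (modelEquiv hu).surjective u
    rw [← e, ← modelEquiv_simpleReflection]
    rfl
  | one =>
    convert one_mem K
    ext1 u
    obtain ⟨u, rfl⟩ := (modelEquiv hu).surjective u
    exact (e u).symm
  | mul x y hx hy ihx ihy =>
    obtain ⟨X, -, hX⟩ := exists_modelWeyl hu hx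
    obtain ⟨Y, -, hY⟩ := exists_modelWeyl hu hy
    convert mul_mem (ihx hX) (ihy hY) using 1
    ext1 u
    obtain ⟨u, rfl⟩ := (modelEquiv hu).surjective u
    rw [← e, LinearEquiv.mul_apply, LinearEquiv.mul_apply, hX, hY]
  | inv x hx ih =>
    obtain ⟨X, -, hX⟩ := exists_modelWeyl hu hx
    convert inv_mem (ih hX) using 1
    ext1 u
    obtain ⟨u, rfl⟩ := (modelEquiv hu).surjective u
    apply X.injective
    rw [← e, ← hX, ← LinearEquiv.mul_apply, ← LinearEquiv.mul_apply, mul_inv_cancel,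
      mul_inv_cancel]
    rfl

/-! ### Reflections in roots and lattice translations -/

theorem nodeModel_of_three_le {i : Fin 11} (hi : 3 ≤ i) :
    nodeModel ι h i = (ι (nodeVec i), 0, 0) := by
  have key : ∀ i : Fin 11, 3 ≤ i →
      nodeExtra 0 i = 0 ∧ nodeExtra 1 i = 0 ∧ nodeExtra 2 i = 0 := by decide +kernel
  obtain ⟨h0, h1, h2⟩ := key i hi
  simp [nodeModel, h0, h1, h2]

theorem nodeModel_two : nodeModel ι h 2 = (ι (nodeVec 2), 0, 1) := by
  simp [nodeModel, nodeExtra]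

theorem nodeVec_zero_one : nodeVec 0 = 0 ∧ nodeVec 1 = 0 := by
  constructor <;> ext k <;> fin_cases k <;> simp [nodeVec, nodeRows]

theorem nodeModel_zero : nodeModel ι h 0 = (-(Real.sqrt 2 • h), 0, 0) := by
  simp [nodeModel, nodeExtra, nodeVec_zero_one.1]

theorem nodeModel_one : nodeModel ι h 1 = ((Real.sqrt 2 / 2) • h, 1, -(3 / 4)) := by
  simp [nodeModel, nodeExtra, nodeVec_zero_one.2]
  ring_nf
  trivial

theorem modelForm_root {r : EuclideanSpace ℝ (Fin 8)} (h2 : inner ℝ r r = (2 : ℝ)) (b : ℝ) :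
    modelForm (ι r, 0, b) (ι r, 0, b) = -2 := by
  simp only [modelForm_apply, LinearIsometry.inner_map_map, h2]
  norm_num

theorem inner_nodeVec_self {i : Fin 11} (hi : 2 ≤ i) : inner ℝ (nodeVec i) (nodeVec i) = (2 : ℝ) := by
  have key : ∀ i : Fin 11, 2 ≤ i → affineGram i i = 2 := by decide +kernel
  rw [inner_nodeVec, key i hi]
  norm_num

/-- Nodes 3 to 10 are the simple roots of E₈, and conjugating by a node reflects the mirror, so root
induction reaches every root. -/
theorem root_reflection_mem (hu : IsUnitNormal ι h) {r : EuclideanSpace ℝ (Fin 8)}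
    (hr : r ∈ latticeE8AddSubgroup) (h2 : inner ℝ r r = (2 : ℝ)) :
    modelReflection (ι r, 0, 0) ∈ modelWeyl hu := by
  refine e8_root_induction (P := fun r => modelReflection (ι r, 0, 0) ∈ modelWeyl hu)
    (fun i hi => ?_) (fun r hr => ?_) (fun r i hi hr => ?_) hr h2
  · rw [← nodeModel_of_three_le hi (h := h)]
    exact node_mem_modelWeyl hu i
  · rw [← modelReflection_neg] at hr
    simpa using hr
  · have hi' := node_mem_modelWeyl hu i
    have := mul_mem (mul_mem hi' hr) (inv_mem hi')
    rw [(modelIsometry_of_mem hu hi').conj, modelReflection_apply (modelForm_node_self hu i),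
      nodeModel_of_three_le hi] at this
    convert this using 2
    ext1
    · simp only [modelForm_apply, map_sub, map_smul, LinearIsometry.inner_map_map, Prod.fst_add,
        Prod.smul_fst, real_inner_comm r]
      module
    · simp

/-- The mirror r ⬝ z = n is the mirror r ⬝ z = 0 moved by n r/2, as r ⬝ r = 2, so the reflection
acquires a translation by n r. -/
theorem affine_reflection_eq {r : EuclideanSpace ℝ (Fin 8)} (h2 : inner ℝ r r = (2 : ℝ)) (n : ℝ) :
    modelReflection (ι r, 0, n) = translationLift (n • ι r) * modelReflection (ι r, 0, 0) := by
  ext1 u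
  rw [LinearEquiv.mul_apply, modelReflection_apply (modelForm_root h2 n),
    modelReflection_apply (modelForm_root h2 0), translationLift_apply]
  have h3 : inner ℝ (ι r) (ι r) = (2 : ℝ) := by rw [LinearIsometry.inner_map_map, h2]
  ext1
  · simp [modelForm_apply]
    module
  · ext1
    · simp
    · simp only [modelForm_apply, Prod.snd_add, Prod.smul_snd, Prod.fst_add, Prod.smul_fst,
        smul_eq_mul, inner_add_left, real_inner_smul_left, real_inner_smul_right, h3,
        real_inner_comm (ι r) u.1]
      ring

/-- The lattice vectors whose translations belong to the Weyl group. -/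
def weylTranslations (hu : IsUnitNormal ι h) : AddSubgroup (EuclideanSpace ℝ (Fin 8)) where
  carrier := {v | translationLift (ι v) ∈ modelWeyl hu}
  zero_mem' := by
    change translationLift (ι 0) ∈ modelWeyl hu
    rw [map_zero, translationLift_zero]
    exact one_mem _
  add_mem' {v w} hv hw := by
    change translationLift (ι (v + w)) ∈ modelWeyl hu
    rw [map_add, translationLift_add]
    exact mul_mem hv hw
  neg_mem' {v} hv := by
    change translationLift (ι (-v)) ∈ modelWeyl hu
    rw [map_neg, translationLift_neg]
    exact inv_mem hv

/-- The affine node and its linear part are two parallel mirrors; their product is a translation. -/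
theorem node_two_mem_weylTranslations (hu : IsUnitNormal ι h) :
    nodeVec 2 ∈ weylTranslations hu := by
  change translationLift (ι (nodeVec 2)) ∈ modelWeyl hu
  have h2 : inner ℝ (nodeVec 2) (nodeVec 2) = (2 : ℝ) := inner_nodeVec_self le_rfl
  have := affine_reflection_eq (ι := ι) h2 1
  rw [one_smul, ← nodeModel_two (h := h), ← mul_inv_eq_iff_eq_mul] at this
  rw [← this]
  exact mul_mem (node_mem_modelWeyl hu 2)
    (inv_mem (root_reflection_mem hu (nodeVec_mem 2) h2))

/-- Conjugating the translation by v with the reflection in r gives the translation by the reflected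
vector v + r; dividing by the translation by v leaves r. -/
theorem weylTranslations_step (hu : IsUnitNormal ι h) {r v : EuclideanSpace ℝ (Fin 8)}
    (hr : r ∈ latticeE8AddSubgroup) (h2 : inner ℝ r r = (2 : ℝ)) (hv : v ∈ weylTranslations hu)
    (hrv : inner ℝ r v = (-1 : ℝ)) : r ∈ weylTranslations hu := by
  have hs := root_reflection_mem hu hr h2
  have key : translationLift (ι (v + r)) =
      modelReflection (ι r, 0, 0) * translationLift (ι v) * modelReflection (ι r, 0, 0) := by
    ext1 u
    have h3 : inner ℝ (ι r) (ι r) = (2 : ℝ) := by rw [LinearIsometry.inner_map_map, h2]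
    have h4 : inner ℝ (ι r) (ι v) = (-1 : ℝ) := by rw [LinearIsometry.inner_map_map, hrv]
    have h5 : inner ℝ (ι v) (ι r) = (-1 : ℝ) := by rw [real_inner_comm, h4]
    simp only [LinearEquiv.mul_apply, modelReflection_apply (modelForm_root h2 0),
      translationLift_apply, map_add]
    ext1
    · simp only [modelForm_apply, Prod.smul_snd, Prod.fst_add, Prod.smul_fst,
        smul_eq_mul, inner_add_right, real_inner_smul_right, h3, h4]
      module
    · ext1
      · simp
      · simp only [modelForm_apply, Prod.snd_add, Prod.smul_snd, Prod.smul_fst,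
          smul_eq_mul, inner_add_left, inner_add_right, real_inner_smul_left,
          real_inner_smul_right, h3, h4, h5, real_inner_comm (ι r) u.1]
        ring
  have hmem : v + r ∈ weylTranslations hu := by
    change translationLift (ι (v + r)) ∈ modelWeyl hu
    rw [key]
    exact mul_mem (mul_mem hs hv) hs
  simpa using sub_mem hmem hv

theorem latticeE8_le_weylTranslations (hu : IsUnitNormal ι h) :
    latticeE8AddSubgroup ≤ weylTranslations hu := by
  refine latticeE8_le_closure.trans ((AddSubgroup.closure_le _).2 ?_)
  -- Adjacent roots have inner product -1, so translations spread from the affine node along the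
  -- connected diagram.
  have step : ∀ i j : Fin 11, 2 ≤ i → affineGram i j = -1 → nodeVec j ∈ weylTranslations hu →
      nodeVec i ∈ weylTranslations hu := fun i j hi hij hj =>
    weylTranslations_step hu (nodeVec_mem i) (inner_nodeVec_self hi) hj
      (by rw [inner_nodeVec, hij]; norm_num)
  have h2 := node_two_mem_weylTranslations hu
  have h3 := step 3 2 (by decide) (by decide) h2
  have h4 := step 4 3 (by decide) (by decide) h3
  have h5 := step 5 4 (by decide) (by decide) h4
  have h6 := step 6 5 (by decide) (by decide) h5
  have h7 := step 7 6 (by decide) (by decide) h6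
  have h8 := step 8 7 (by decide) (by decide) h7
  have h9 := step 9 8 (by decide) (by decide) h8
  have h10 := step 10 7 (by decide) (by decide) h7
  rintro _ ⟨i, hi, rfl⟩
  have hi' : 3 ≤ i := hi
  fin_cases i
  · exact absurd hi' (by decide)
  · exact absurd hi' (by decide)
  · exact absurd hi' (by decide)
  · exact h3
  · exact h4
  · exact h5
  · exact h6
  · exact h7
  · exact h8
  · exact h9
  · exact h10

theorem translation_mem_modelWeyl (hu : IsUnitNormal ι h) {v : EuclideanSpace ℝ (Fin 8)}
    (hv : v ∈ latticeE8) : translationLift (ι v) ∈ modelWeyl hu :=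
  latticeE8_le_weylTranslations hu hv

theorem affine_reflection_mem (hu : IsUnitNormal ι h) {r : EuclideanSpace ℝ (Fin 8)}
    (hr : r ∈ latticeE8AddSubgroup) (h2 : inner ℝ r r = (2 : ℝ)) (n : ℤ) :
    modelReflection (ι r, 0, n) ∈ modelWeyl hu := by
  rw [affine_reflection_eq h2]
  refine mul_mem ?_ (root_reflection_mem hu hr h2)
  have := translation_mem_modelWeyl hu (zsmul_mem hr n)
  rwa [map_zsmul, ← Int.cast_smul_eq_zsmul ℝ] at this

/-! ### Lattice symmetries normalize the Weyl group -/

variable (h) in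
/-- The image of the weight `w₀` in the model: the half space in the direction `h`. -/
def weightModel : Model := ((Real.sqrt 2 / 2) • h, 0, 1 / 2)

theorem modelForm_node_weightModel (hu : IsUnitNormal ι h) (i : Fin 11) :
    modelForm (nodeModel ι h i) (weightModel h) = if i = 0 then 1 else 0 := by
  have key : ∀ i : Fin 11, -4 * nodeExtra 0 i + nodeExtra 1 i = if i = 0 then 8 else 0 := by
    decide +kernel
  have key' : -4 * (nodeExtra 0 i : ℝ) + nodeExtra 1 i = if i = 0 then 8 else 0 := by
    exact_mod_cast key i
  rw [modelForm_apply]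
  simp only [nodeModel, weightModel, inner_add_left, real_inner_smul_left, real_inner_smul_right,
    hu.inner_eq', hu.inner_self]
  split_ifs at key' ⊢ <;>
    linear_combination (1 / 8 : ℝ) * key' - (nodeExtra 0 i : ℝ) / 4 * sqrt_two_mul_self

theorem modelEquiv_weight_zero (hu : IsUnitNormal ι h) :
    modelEquiv hu (weight gramT238 0) = weightModel h := by
  rw [← LinearEquiv.eq_symm_apply]
  refine lorentz_ext fun x => ?_
  rw [lorentz_comm gramT238_isSymm, lorentz_comm gramT238_isSymm _ x, lorentz_eq_sum,
    lorentz_eq_sum x ((modelEquiv hu).symm _)]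
  refine Finset.sum_congr rfl fun i _ => ?_
  rw [lorentz_modelEquiv_symm, modelEquiv_single, modelForm_node_weightModel hu, lorentz_weight]

/-- The images of the weight `w₀` under the Weyl group. -/
def weightOrbit (hu : IsUnitNormal ι h) : Set Model :=
  {v | ∃ F ∈ modelWeyl hu, v = F (weightModel h)}

theorem weightOrbit_map (hu : IsUnitNormal ι h) {F : Model ≃ₗ[ℝ] Model} (hF : F ∈ modelWeyl hu)
    {v : Model} (hv : v ∈ weightOrbit hu) : F v ∈ weightOrbit hu := by
  obtain ⟨F', hF', rfl⟩ := hv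
  exact ⟨F * F', mul_mem hF hF', rfl⟩

theorem modelEquiv_mem_weightOrbit (hu : IsUnitNormal ι h) {v : Fin 11 → ℝ} :
    v ∈ coxeterPacking gramT238 ↔ ∃ m ∈ weightOrbit hu, modelEquiv hu v = Real.sqrt 2 • m := by
  rw [mem_coxeterPacking]
  constructor
  · rintro ⟨γ, hγ, rfl⟩
    obtain ⟨F, hF, e⟩ := exists_modelWeyl hu hγ
    exact ⟨F (weightModel h), ⟨F, hF, rfl⟩, by rw [map_smul, e, modelEquiv_weight_zero]⟩
  · rintro ⟨_, ⟨F, ⟨γ, hγ, e⟩, rfl⟩, hv⟩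
    refine ⟨γ, hγ, (modelEquiv hu).injective ?_⟩
    rw [hv, map_smul, e, modelEquiv_weight_zero]

/-- The map A permutes the roots, hence sends nodes 2 to 10 to affine roots, all of whose
reflections lie in the Weyl group; it fixes nodes 0 and 1. It is not necessary to know that A itself
comes from the Weyl group. -/
theorem linear_symmetry_normalizes (hu : IsUnitNormal ι h)
    {A : EuclideanSpace ℝ (Fin 9) ≃ₗᵢ[ℝ] EuclideanSpace ℝ (Fin 9)} (hAh : A h = h)
    (hA : ∀ x ∈ latticeE8, A (ι x) ∈ ι '' latticeE8) {F : Model ≃ₗ[ℝ] Model}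
    (hF : F ∈ modelWeyl hu) : affineLift A 0 * F * (affineLift A 0)⁻¹ ∈ modelWeyl hu := by
  have hle : modelWeyl hu ≤
      (modelWeyl hu).comap (MulAut.conj (affineLift A 0)).toMonoidHom := by
    refine modelWeyl_le hu fun i => ?_
    change affineLift A 0 * modelReflection (nodeModel ι h i) * (affineLift A 0)⁻¹ ∈ modelWeyl hu
    rw [(modelIsometry_affineLift A 0).conj]
    by_cases hi : 2 ≤ i
    · obtain ⟨r, hr, hAr⟩ := hA _ (nodeVec_mem i)
      have h2 : inner ℝ r r = (2 : ℝ) := by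
        rw [← ι.inner_map_map, hAr, A.inner_map_map, ι.inner_map_map, inner_nodeVec_self hi]
      obtain ⟨n, hn⟩ : ∃ n : ℤ, nodeModel ι h i = (ι (nodeVec i), 0, (n : ℝ)) := by
        by_cases hi3 : 3 ≤ i
        · exact ⟨0, by rw [nodeModel_of_three_le hi3]; simp⟩
        · obtain rfl : i = 2 := by omega
          exact ⟨1, by rw [nodeModel_two]; simp⟩
      have : affineLift A 0 (nodeModel ι h i) = (ι r, 0, (n : ℝ)) := by
        rw [hn, affineLift_apply]
        simp [hAr]
      rw [this]
      exact affine_reflection_mem hu hr h2 n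
    · have : affineLift A 0 (nodeModel ι h i) = nodeModel ι h i := by
        obtain rfl | rfl : i = 0 ∨ i = 1 := by omega
        · simp [nodeModel_zero, affineLift_apply, hAh]
        · simp [nodeModel_one, affineLift_apply, hAh]
      rw [this]
      exact node_mem_modelWeyl hu i
  exact hle hF

/-- Since A fixes w_0, the vector A F w_0 equals (A F A⁻¹) w_0. -/
theorem linear_symmetry_weightOrbit (hu : IsUnitNormal ι h)
    {A : EuclideanSpace ℝ (Fin 9) ≃ₗᵢ[ℝ] EuclideanSpace ℝ (Fin 9)} (hAh : A h = h)
    (hA : ∀ x ∈ latticeE8, A (ι x) ∈ ι '' latticeE8) {v : Model} (hv : v ∈ weightOrbit hu) :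
    affineLift A 0 v ∈ weightOrbit hu := by
  obtain ⟨F, hF, rfl⟩ := hv
  refine ⟨_, linear_symmetry_normalizes hu hAh hA hF, ?_⟩
  have hw : affineLift A 0 (weightModel h) = weightModel h := by
    simp [weightModel, affineLift_apply, hAh]
  have hw' : (affineLift A 0)⁻¹ (weightModel h) = weightModel h := by
    conv_lhs => rw [← hw]
    exact (affineLift A 0).symm_apply_apply _
  rw [LinearEquiv.mul_apply, LinearEquiv.mul_apply, hw']

end Nodes

/-! ### Transformations of `ℝ⁹ ∪ {∞}` and their lifts -/

section Chart

/-- The point at infinity. -/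
def infinityModel : Model := (0, 0, 1)

/-- The light-like vector of a point of `ℝ⁹`. -/
def chartModel (z : EuclideanSpace ℝ (Fin 9)) : Model := (z, 1, inner ℝ z z / 2)

/-- The light-like vector of a point of `ℝ⁹ ∪ {∞}`. -/
def pointModel (p : OnePoint (EuclideanSpace ℝ (Fin 9))) : Model := p.elim infinityModel chartModel

theorem pointModel_infty : pointModel ∞ = infinityModel := rfl

theorem pointModel_coe (z : EuclideanSpace ℝ (Fin 9)) :
    pointModel (z : OnePoint (EuclideanSpace ℝ (Fin 9))) = chartModel z := rfl

theorem modelForm_infinity (m : Model) : modelForm m infinityModel = m.2.1 := by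
  simp [modelForm_apply, infinityModel]

theorem modelForm_chart (m : Model) (z : EuclideanSpace ℝ (Fin 9)) :
    modelForm m (chartModel z) = -inner ℝ m.1 z + m.2.1 * (inner ℝ z z / 2) + m.2.2 := by
  simp only [modelForm_apply, chartModel, mul_one]

theorem modelForm_chart_chart (x y : EuclideanSpace ℝ (Fin 9)) :
    modelForm (chartModel x) (chartModel y) = dist x y ^ 2 / 2 := by
  rw [modelForm_chart, dist_eq_norm, ← real_inner_self_eq_norm_sq, inner_sub_sub_self,
    real_inner_comm x y]
  simp only [chartModel]
  ring

/-- The closed side of the plane of `m`, in `ℝ⁹ ∪ {∞}`. -/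
def capModel (m : Model) : Set (OnePoint (EuclideanSpace ℝ (Fin 9))) :=
  {p | modelForm m (pointModel p) ≤ 0}

theorem mem_capModel {m : Model} {p : OnePoint (EuclideanSpace ℝ (Fin 9))} :
    p ∈ capModel m ↔ modelForm m (pointModel p) ≤ 0 := Iff.rfl

theorem capModel_smul {c : ℝ} (hc : 0 < c) (m : Model) : capModel (c • m) = capModel m := by
  ext p
  simp [mem_capModel, mul_nonpos_iff_pos_imp_nonpos, hc, hc.le]

/-- The linear map `F` induces the transformation `g` of the light-like rays. -/
def IsLift (g : Equiv.Perm (OnePoint (EuclideanSpace ℝ (Fin 9)))) (F : Model ≃ₗ[ℝ] Model) : Prop :=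
  ∀ p, ∃ t : ℝ, 0 < t ∧ F (pointModel p) = t • pointModel (g p)

theorem IsLift.one : IsLift 1 1 := fun p => ⟨1, one_pos, by simp⟩

theorem IsLift.mul {g g' : Equiv.Perm (OnePoint (EuclideanSpace ℝ (Fin 9)))}
    {F F' : Model ≃ₗ[ℝ] Model} (h : IsLift g F) (h' : IsLift g' F') : IsLift (g * g') (F * F') := by
  intro p
  obtain ⟨t', ht', e'⟩ := h' p
  obtain ⟨t, ht, e⟩ := h (g' p)
  exact ⟨t' * t, mul_pos ht' ht, by
    rw [LinearEquiv.mul_apply, e', map_smul, e, smul_smul, Equiv.Perm.mul_apply]⟩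

theorem IsLift.inv {g : Equiv.Perm (OnePoint (EuclideanSpace ℝ (Fin 9)))}
    {F : Model ≃ₗ[ℝ] Model} (h : IsLift g F) : IsLift g⁻¹ F⁻¹ := by
  intro p
  obtain ⟨t, ht, e⟩ := h (g⁻¹ p)
  refine ⟨t⁻¹, inv_pos.2 ht, F.injective ?_⟩
  have hF : F (F⁻¹ (pointModel p)) = pointModel p := F.apply_symm_apply _
  rw [hF, map_smul, e, show g (g⁻¹ p) = p from g.apply_symm_apply p, smul_smul, inv_mul_cancel₀ ht.ne', one_smul]

theorem IsLift.image_cap {g : Equiv.Perm (OnePoint (EuclideanSpace ℝ (Fin 9)))}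
    {F : Model ≃ₗ[ℝ] Model} (h : IsLift g F) (hF : ModelIsometry F) (m : Model) :
    g '' capModel m = capModel (F m) := by
  ext p
  obtain ⟨q, rfl⟩ := g.surjective p
  rw [g.injective.mem_set_image, mem_capModel, mem_capModel]
  obtain ⟨t, ht, e⟩ := h q
  rw [← hF, e, map_smul, smul_eq_mul, mul_nonpos_iff]
  simp [ht.le, not_le.2 ht]

theorem isLift_isometryEquiv {f : EuclideanSpace ℝ (Fin 9) ≃ᵢ EuclideanSpace ℝ (Fin 9)}
    {F : Model ≃ₗ[ℝ] Model} (hinf : F infinityModel = infinityModel)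
    (hF : ∀ z, F (chartModel z) = chartModel (f z)) :
    IsLift f.toHomeomorph.onePointCongr.toEquiv F := by
  intro p
  refine ⟨1, one_pos, ?_⟩
  rw [one_smul]
  induction p using OnePoint.rec with
  | infty => exact hinf
  | coe z => exact hF z

theorem isLift_affineLift (f : EuclideanSpace ℝ (Fin 9) ≃ᵢ EuclideanSpace ℝ (Fin 9)) :
    IsLift f.toHomeomorph.onePointCongr.toEquiv (affineLift f.toRealLinearIsometryEquiv (f 0)) := by
  refine isLift_isometryEquiv (by simp [affineLift_apply, infinityModel]) fun z => ?_
  have hz : f z = f.toRealLinearIsometryEquiv z + f 0 := by simp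
  rw [hz]
  simp only [affineLift_apply, chartModel, one_smul, inner_add_left, inner_add_right,
    LinearIsometryEquiv.inner_map_map, real_inner_comm (f.toRealLinearIsometryEquiv z) (f 0)]
  ext1
  · rfl
  · ext1
    · rfl
    · simp only; ring

theorem capModel_halfSpace {u : EuclideanSpace ℝ (Fin 9)} {t : ℝ} :
    capModel (u, 0, t) = halfSpaceCap u t := by
  ext p
  rw [mem_capModel, halfSpaceCap]
  induction p using OnePoint.rec with
  | infty => simp [pointModel_infty, modelForm_infinity]
  | coe z =>
    rw [pointModel_coe, modelForm_chart]
    simp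

theorem modelForm_ball (p z : EuclideanSpace ℝ (Fin 9)) (r : ℝ) :
    modelForm (p, 1, (inner ℝ p p - r ^ 2) / 2) (chartModel z) = (dist z p ^ 2 - r ^ 2) / 2 := by
  rw [modelForm_chart, dist_eq_norm, ← real_inner_self_eq_norm_sq, inner_sub_sub_self,
    real_inner_comm p z]
  simp only
  ring

theorem capModel_ball (p : EuclideanSpace ℝ (Fin 9)) {r : ℝ} (hr : 0 ≤ r) :
    capModel (p, 1, (inner ℝ p p - r ^ 2) / 2) = ballCap p r := by
  ext q
  rw [mem_capModel, ballCap]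
  induction q using OnePoint.rec with
  | infty => simp [pointModel_infty, modelForm_infinity]
  | coe z =>
    rw [pointModel_coe, modelForm_ball]
    simp only [OnePoint.some_eq_iff, Set.mem_image, Metric.mem_closedBall, exists_eq_right]
    rw [← abs_of_nonneg (dist_nonneg (x := z) (y := p)), ← sq_le_sq₀ (abs_nonneg _) hr, sq_abs]
    constructor <;> intro h <;> linarith

theorem capModel_ball_compl (p : EuclideanSpace ℝ (Fin 9)) {r : ℝ} (hr : 0 ≤ r) :
    capModel (-(p, 1, (inner ℝ p p - r ^ 2) / 2)) = (OnePoint.some '' Metric.ball p r)ᶜ := by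
  ext q
  rw [mem_capModel, map_neg, LinearMap.neg_apply]
  induction q using OnePoint.rec with
  | infty => simp [pointModel_infty, modelForm_infinity]
  | coe z =>
    rw [pointModel_coe, modelForm_ball]
    simp only [OnePoint.some_eq_iff, Set.mem_compl_iff, Set.mem_image, Metric.mem_ball,
      exists_eq_right, not_lt]
    rw [← sq_le_sq₀ hr dist_nonneg]
    constructor <;> intro h <;> linarith

/-- The closed side of a plane is an oriented sphere. -/
theorem isOrientedSphere_capModel {m : Model} (hm : modelForm m m < 0) :
    IsOrientedSphere (capModel m) := by
  obtain ⟨q, a, b⟩ := m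
  rw [modelForm_apply] at hm
  simp only at hm
  set k := inner ℝ q q - 2 * a * b with hk
  have hk0 : 0 < k := by rw [hk]; linarith
  -- The product a with the point ∞ decides the type: for a ≠ 0 the sphere has centre q/a and radius
  -- √k/|a| with k = -m ⬝ m, and a < 0 means its outside.
  have key : a ≠ 0 → b = a * ((inner ℝ (a⁻¹ • q) (a⁻¹ • q) - (Real.sqrt k / |a|) ^ 2) / 2) := by
    intro ha
    rw [real_inner_smul_left, real_inner_smul_right, div_pow, Real.sq_sqrt hk0.le, sq_abs, hk]
    field_simp
    ring
  rcases lt_trichotomy a 0 with ha | rfl | ha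
  · right; left
    refine ⟨a⁻¹ • q, Real.sqrt k / |a|,
      div_pos (Real.sqrt_pos.2 hk0) (abs_pos.2 ha.ne), ?_⟩
    rw [← capModel_ball_compl _ (by positivity)]
    conv_rhs => rw [← capModel_smul (neg_pos.2 ha)]
    congr 1
    ext1
    · simp [ha.ne]
    · ext1
      · simp
      · simpa only [Prod.smul_snd, Prod.snd_neg, smul_eq_mul, neg_mul_neg] using key ha.ne
  · right; right
    refine ⟨q, b, ?_, capModel_halfSpace⟩
    rintro rfl
    simp at hm
  · left
    refine ⟨a⁻¹ • q, Real.sqrt k / |a|,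
      div_pos (Real.sqrt_pos.2 hk0) (abs_pos.2 ha.ne'), ?_⟩
    rw [← capModel_ball _ (by positivity)]
    conv_rhs => rw [← capModel_smul ha]
    congr 1
    ext1
    · simp [ha.ne']
    · ext1
      · simp
      · exact key ha.ne'

end Chart

/-! ### The generators of the construction group -/

section Generators

variable {ι : EuclideanSpace ℝ (Fin 8) →ₗᵢ[ℝ] EuclideanSpace ℝ (Fin 9)}
  {h : EuclideanSpace ℝ (Fin 9)}

theorem one_div_sqrt_two : 1 / Real.sqrt 2 = Real.sqrt 2 / 2 := by
  rw [div_eq_div_iff (Real.sqrt_pos.2 two_pos).ne' two_ne_zero, sqrt_two_mul_self, one_mul]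

/-- Node coordinates parametrize ℝ⁹. They split z along H and h, and later single out a dense set of
points with rational products. -/
theorem exists_decomposition (hu : IsUnitNormal ι h) (z : EuclideanSpace ℝ (Fin 9)) :
    ∃ u : Fin 11 → ℝ, z = (modelEquiv hu u).1 :=
  ⟨(modelEquiv hu).symm (z, 0, 0), by simp⟩

theorem modelEquiv_fst (hu : IsUnitNormal ι h) (u : Fin 11 → ℝ) : (modelEquiv hu u).1 =
    ι (∑ i, u i • nodeVec i) + ((∑ i, u i * nodeExtra 0 i) / 2 * Real.sqrt 2) • h := by
  rw [modelEquiv_apply, toModel, Fintype.linearCombination_apply, Prod.fst_sum]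
  simp only [Prod.smul_fst, nodeModel, smul_add, Finset.sum_add_distrib, map_sum, map_smul,
    smul_smul, ← Finset.sum_smul]
  congr 2
  rw [Finset.sum_div, Finset.sum_mul]
  exact Finset.sum_congr rfl fun i _ => by ring

theorem reflection_hyperplane (hu : IsUnitNormal ι h) (z : EuclideanSpace ℝ (Fin 9)) :
    Submodule.reflection (LinearMap.range ι.toLinearMap) z = z - (2 * inner ℝ h z) • h := by
  obtain ⟨u, rfl⟩ := exists_decomposition hu z
  rw [modelEquiv_fst]
  set y := ∑ i, u i • nodeVec i
  set s := (∑ i, u i * (nodeExtra 0 i : ℝ)) / 2 * Real.sqrt 2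
  have h1 : ι y ∈ LinearMap.range ι.toLinearMap := ⟨y, rfl⟩
  have h2 : h ∈ (LinearMap.range ι.toLinearMap)ᗮ := by
    rw [Submodule.mem_orthogonal]
    rintro _ ⟨x, rfl⟩
    exact hu.inner_eq' x
  rw [map_add, map_smul, Submodule.reflection_mem_subspace_eq_self h1,
    Submodule.reflection_mem_subspace_orthogonalComplement_eq_neg h2, inner_add_right,
    hu.inner_eq, real_inner_smul_right, hu.inner_self]
  module

theorem isLift_reflection (hu : IsUnitNormal ι h) :
    IsLift (Submodule.reflection (LinearMap.range ι.toLinearMap)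
      ).toIsometryEquiv.toHomeomorph.onePointCongr.toEquiv (modelReflection (nodeModel ι h 0)) := by
  have hn := modelForm_node_self hu 0
  refine isLift_isometryEquiv ?_ fun z => ?_
  · rw [modelReflection_apply hn, modelForm_infinity]
    simp [nodeModel_zero]
  · rw [modelReflection_apply hn, modelForm_chart]
    have hz : (Submodule.reflection (LinearMap.range ι.toLinearMap)).toIsometryEquiv z =
      z - (2 * inner ℝ h z) • h := reflection_hyperplane hu z
    rw [hz]
    simp only [nodeModel_zero, chartModel, inner_neg_left, real_inner_smul_left]
    have := sqrt_two_mul_self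
    ext1
    · simp only [Prod.fst_add, Prod.smul_fst]
      match_scalars
      · ring
      · linear_combination -(inner ℝ h z) * this
    · ext1
      · simp
      · simp only [Prod.snd_add, Prod.smul_snd, inner_sub_left, inner_sub_right,
          real_inner_smul_left, real_inner_smul_right, hu.inner_self, real_inner_comm h z]
        simp
        ring

theorem isLift_inversion (hu : IsUnitNormal ι h)
    {g : Equiv.Perm (OnePoint (EuclideanSpace ℝ (Fin 9)))}
    (hg : ∀ p, g p = inversionOnePoint ((1 / Real.sqrt 2) • h)
        (dist ((1 / Real.sqrt 2) • h) (-((1 / Real.sqrt 2) • h))) p) :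
    IsLift g (modelReflection (nodeModel ι h 1)) := by
  have hn := modelForm_node_self hu 1
  have h2 := sqrt_two_mul_self
  set A := (1 / Real.sqrt 2) • h with hA
  have hAA : inner ℝ A A = (1 / 2 : ℝ) := by
    rw [hA, one_div_sqrt_two, real_inner_smul_left, real_inner_smul_right, hu.inner_self]
    linear_combination h2 / 4
  have hR : dist A (-A) ^ 2 = 2 := by
    rw [dist_eq_norm, sub_neg_eq_add, ← real_inner_self_eq_norm_sq]
    simp only [inner_add_left, inner_add_right, hAA]
    norm_num
  -- Node 1 is the sphere with centre A and squared radius 2 = |AB|².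
  have node : nodeModel ι h 1 = (A, 1, (inner ℝ A A - 2) / 2) := by
    rw [nodeModel_one, hA, one_div_sqrt_two, ← one_div_sqrt_two, ← hA, hAA]
    norm_num
  intro p
  rw [hg, modelReflection_apply hn]
  induction p using OnePoint.rec with
  | infty =>
    refine ⟨1, one_pos, ?_⟩
    rw [pointModel_infty, modelForm_infinity, node, one_smul, one_smul]
    change infinityModel + (A, 1, (inner ℝ A A - 2) / 2) = chartModel A
    ext1
    · simp [infinityModel, chartModel]
    · ext1
      · simp [infinityModel, chartModel]
      · simp only [infinityModel, chartModel, Prod.snd_add]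
        ring
  | coe x =>
    have hx : modelForm (nodeModel ι h 1) (chartModel x) = (dist x A ^ 2 - 2) / 2 := by
      have := modelForm_ball A x (Real.sqrt 2)
      rw [Real.sq_sqrt (by norm_num)] at this
      rw [node, this]
    rw [pointModel_coe, hx, node]
    by_cases hxA : x = A
    · refine ⟨1, one_pos, ?_⟩
      have : inversionOnePoint A (dist A (-A)) (x : OnePoint _) = ∞ := by
        simp [inversionOnePoint, hxA]
      rw [this, pointModel_infty, hxA, dist_self, one_smul]
      ext1
      · simp [infinityModel, chartModel]
      · ext1
        · simp [infinityModel, chartModel]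
        · simp only [infinityModel, chartModel, Prod.snd_add, Prod.smul_snd, smul_eq_mul]
          ring
    · have hd : 0 < dist x A := dist_pos.2 hxA
      -- The factor is the middle coordinate of the reflected vector, 1 + (|xA|² - 2)/2.
      refine ⟨dist x A ^ 2 / 2, by positivity, ?_⟩
      have : inversionOnePoint A (dist A (-A)) (x : OnePoint _) =
          ((EuclideanGeometry.inversion A (dist A (-A)) x : EuclideanSpace ℝ (Fin 9)) :
            OnePoint _) := by
        simp [inversionOnePoint, hxA]
      rw [this, pointModel_coe, EuclideanGeometry.inversion, div_pow, hR]
      simp only [vsub_eq_sub, vadd_eq_add, chartModel]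
      have hdd : inner ℝ x x = dist x A ^ 2 + 2 * inner ℝ x A - inner ℝ A A := by
        rw [dist_eq_norm, ← real_inner_self_eq_norm_sq, inner_sub_sub_self, real_inner_comm x A]
        ring
      set d := dist x A
      ext1
      · simp only [Prod.fst_add, Prod.smul_fst, smul_add, smul_smul]
        match_scalars <;> field_simp
        ring
      · ext1
        · simp only [Prod.snd_add, Prod.smul_snd, Prod.fst_add, Prod.smul_fst, smul_eq_mul]
          ring
        · simp only [Prod.snd_add, Prod.smul_snd, smul_eq_mul, inner_add_left, inner_add_right,
            real_inner_smul_left, real_inner_smul_right, inner_sub_left, inner_sub_right,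
            real_inner_comm x A, hdd, hAA]
          field_simp
          ring

/-- The inversion as a permutation. -/
theorem exists_inversion_perm (c : EuclideanSpace ℝ (Fin 9)) {R : ℝ} (hR : R ≠ 0) :
    ∃ g : Equiv.Perm (OnePoint (EuclideanSpace ℝ (Fin 9))), ∀ p, g p = inversionOnePoint c R p := by
  have hinv : Function.Involutive (inversionOnePoint c R) := by
    intro p
    induction p using OnePoint.rec with
    | infty => simp [inversionOnePoint]
    | coe x =>
      by_cases hx : x = c
      · simp [inversionOnePoint, hx]
      · have : EuclideanGeometry.inversion c R x ≠ c := by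
          rwa [Ne, EuclideanGeometry.inversion_eq_center hR]
        simp [inversionOnePoint, hx, this, EuclideanGeometry.inversion_inversion c hR]
  exact ⟨hinv.toPerm, fun p => rfl⟩

theorem reflection_root_apply {r : EuclideanSpace ℝ (Fin 9)} (h2 : inner ℝ r r = (2 : ℝ))
    (z : EuclideanSpace ℝ (Fin 9)) :
    Submodule.reflection (ℝ ∙ r)ᗮ z = z - inner ℝ r z • r := by
  rw [Submodule.reflection_orthogonal_apply, Submodule.reflection_singleton_apply]
  have : ((‖r‖ : ℝ) : ℝ) ^ 2 = 2 := by rw [← real_inner_self_eq_norm_sq, h2]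
  simp only [RCLike.ofReal_real_eq_id, id_eq, this]
  module

/-- Nodes 2 to 10 act as z ↦ z + (n - r ⬝ z) r, which preserves the lattice because its products
with r are integers. Nodes 0 and 1 are the other two generators. -/
theorem exists_lift_node (hu : IsUnitNormal ι h) (i : Fin 11) :
    ∃ g ∈ constructionGroup ι h, IsLift g (modelReflection (nodeModel ι h i)) := by
  by_cases hi : 2 ≤ i
  · obtain ⟨n, hn⟩ : ∃ n : ℤ, nodeModel ι h i = (ι (nodeVec i), 0, (n : ℝ)) := by
      by_cases hi3 : 3 ≤ i
      · exact ⟨0, by rw [nodeModel_of_three_le hi3]; simp⟩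
      · obtain rfl : i = 2 := by omega
        exact ⟨1, by rw [nodeModel_two]; simp⟩
    set r := nodeVec i with hr
    have h2 : inner ℝ (ι r) (ι r) = (2 : ℝ) := by
      rw [ι.inner_map_map, hr, inner_nodeVec_self hi]
    set f : EuclideanSpace ℝ (Fin 9) ≃ᵢ EuclideanSpace ℝ (Fin 9) :=
      (Submodule.reflection (ℝ ∙ ι r)ᗮ).toIsometryEquiv.trans (IsometryEquiv.addRight (n • ι r))
    have hf : ∀ z, f z = z + ((n : ℝ) - inner ℝ (ι r) z) • ι r := by
      intro z
      change Submodule.reflection (ℝ ∙ ι r)ᗮ z + n • ι r = _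
      rw [reflection_root_apply h2, ← Int.cast_smul_eq_zsmul ℝ]
      module
    have hff : ∀ z, f (f z) = z := by
      intro z
      rw [hf (f z), hf z, inner_add_right, real_inner_smul_right, h2]
      module
    have hfL : ∀ x ∈ ι '' latticeE8, f x ∈ ι '' latticeE8 := by
      rintro _ ⟨x, hx, rfl⟩
      obtain ⟨k, hk⟩ := exists_int_inner_nodeVec hx i
      refine ⟨x + (n - k) • r, latticeE8AddSubgroup.add_mem hx
        (zsmul_mem (nodeVec_mem i) _), ?_⟩
      rw [hf, ι.inner_map_map, real_inner_comm, hr, hk, map_add, map_zsmul,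
        ← Int.cast_smul_eq_zsmul ℝ, Int.cast_sub]
    refine ⟨f.toHomeomorph.onePointCongr.toEquiv, Subgroup.subset_closure
      (Or.inl (Or.inl ⟨f, ?_, ?_, rfl⟩)), ?_⟩
    · apply Set.Subset.antisymm
      · rintro _ ⟨x, hx, rfl⟩
        exact hfL x hx
      · exact fun x hx => ⟨f x, hfL x hx, hff x⟩
    · intro y
      rw [hf, inner_add_right, real_inner_smul_right, hu.inner_eq]
      ring
    · rw [hn]
      have hm : modelForm (ι r, 0, (n : ℝ)) (ι r, 0, (n : ℝ)) = -2 := by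
        rw [← hn, modelForm_node_self hu]
      refine isLift_isometryEquiv ?_ fun z => ?_
      · rw [modelReflection_apply hm, modelForm_infinity]
        simp
      · rw [modelReflection_apply hm, modelForm_chart, hf]
        simp only [chartModel]
        ext1
        · simp only [Prod.fst_add, Prod.smul_fst]
          module
        · ext1
          · simp
          · simp only [Prod.snd_add, Prod.smul_snd, smul_eq_mul, inner_add_left, inner_add_right,
              real_inner_smul_left, real_inner_smul_right, h2, real_inner_comm (ι r) z]
            ring
  · obtain rfl | rfl : i = 0 ∨ i = 1 := by omega
    · exact ⟨_, Subgroup.subset_closure (Or.inl (Or.inr rfl)), isLift_reflection hu⟩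
    · have hne : dist ((1 / Real.sqrt 2) • h) (-((1 / Real.sqrt 2) • h)) ≠ 0 := by
        have h1 : (1 : ℝ) / Real.sqrt 2 ≠ 0 := by positivity
        have h2 : h ≠ 0 := by
          rintro rfl
          simpa using hu.norm_eq
        rw [dist_eq_norm, sub_neg_eq_add, ← two_smul ℝ, norm_ne_zero_iff]
        exact smul_ne_zero two_ne_zero (smul_ne_zero h1 h2)
      obtain ⟨g, hg⟩ := exists_inversion_perm ((1 / Real.sqrt 2) • h) hne
      exact ⟨g, Subgroup.subset_closure (Or.inr hg), isLift_inversion hu hg⟩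

/-- Every element of the Weyl group induces an element of the construction group. -/
theorem exists_lift_of_mem_modelWeyl (hu : IsUnitNormal ι h) {F : Model ≃ₗ[ℝ] Model}
    (hF : F ∈ modelWeyl hu) : ∃ g ∈ constructionGroup ι h, IsLift g F := by
  let K : Subgroup (Model ≃ₗ[ℝ] Model) :=
    { carrier := {F | ∃ g ∈ constructionGroup ι h, IsLift g F}
      one_mem' := ⟨1, one_mem _, IsLift.one⟩
      mul_mem' := by
        rintro F F' ⟨g, hg, e⟩ ⟨g', hg', e'⟩
        exact ⟨g * g', mul_mem hg hg', e.mul e'⟩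
      inv_mem' := by
        rintro F ⟨g, hg, e⟩
        exact ⟨g⁻¹, inv_mem hg, e.inv⟩ }
  exact modelWeyl_le hu (K := K) (exists_lift_node hu) hF

/-- Since 0 is in the lattice, f 0 is a lattice vector. So f is a linear symmetry fixing h, followed
by a translation from the Weyl group. The inverse is included for the induction over the generated
group. -/
theorem symmetry_weightOrbit (hu : IsUnitNormal ι h)
    {f : EuclideanSpace ℝ (Fin 9) ≃ᵢ EuclideanSpace ℝ (Fin 9)}
    (hf : f '' (ι '' latticeE8) = ι '' latticeE8) (hh : ∀ y, inner ℝ h (f y) = (inner ℝ h y : ℝ))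
    {v : Model} (hv : v ∈ weightOrbit hu) :
    affineLift f.toRealLinearIsometryEquiv (f 0) v ∈ weightOrbit hu ∧
      (affineLift f.toRealLinearIsometryEquiv (f 0))⁻¹ v ∈ weightOrbit hu := by
  set A := f.toRealLinearIsometryEquiv with hA
  have hAf : ∀ y, A y = f y - f 0 := fun y => by simp [hA]
  have h0 : (0 : EuclideanSpace ℝ (Fin 8)) ∈ latticeE8 := latticeE8AddSubgroup.zero_mem
  obtain ⟨c, hc, hc'⟩ : f 0 ∈ ι '' latticeE8 := by
    rw [← hf]
    exact ⟨0, ⟨0, h0, map_zero ι⟩, rfl⟩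
  -- Two unit vectors with inner product 1 coincide.
  have hAh : A h = h := by
    have h1 : inner ℝ h (A h) = (1 : ℝ) := by
      rw [hAf, inner_sub_right, hh, hh, hu.inner_self, inner_zero_right, sub_zero]
    rw [← sub_eq_zero, ← inner_self_eq_zero (𝕜 := ℝ), inner_sub_sub_self, A.inner_map_map,
      real_inner_comm, h1, hu.inner_self, real_inner_comm, h1]
    norm_num
  have hAL : ∀ x ∈ latticeE8, A (ι x) ∈ ι '' latticeE8 := by
    intro x hx
    obtain ⟨y, hy, hy'⟩ : f (ι x) ∈ ι '' latticeE8 := by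
      rw [← hf]
      exact ⟨_, ⟨x, hx, rfl⟩, rfl⟩
    refine ⟨y - c, latticeE8AddSubgroup.sub_mem hy hc, ?_⟩
    rw [map_sub, hy', hc', hAf]
  have hAL' : ∀ x ∈ latticeE8, A.symm (ι x) ∈ ι '' latticeE8 := by
    intro x hx
    have hxc : ι (x + c) ∈ f '' (ι '' latticeE8) := by
      rw [hf]
      exact ⟨_, latticeE8AddSubgroup.add_mem hx hc, rfl⟩
    obtain ⟨_, ⟨y, hy, rfl⟩, hy'⟩ := hxc
    refine ⟨y, hy, ?_⟩
    rw [LinearIsometryEquiv.eq_symm_apply, hAf, hy', ← hc', map_add, add_sub_cancel_right]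
  have hAh' : A.symm h = h := by rw [LinearIsometryEquiv.symm_apply_eq, hAh]
  have hinv : (affineLift A 0)⁻¹ = affineLift A.symm 0 := by
    rw [inv_eq_iff_mul_eq_one]
    ext1 u
    simp [LinearEquiv.mul_apply, affineLift_apply]
  have ht := translation_mem_modelWeyl hu hc
  rw [hc'] at ht
  rw [affineLift_eq, mul_inv_rev, hinv, LinearEquiv.mul_apply, LinearEquiv.mul_apply]
  exact ⟨weightOrbit_map hu ht (linear_symmetry_weightOrbit hu hAh hAL hv),
    linear_symmetry_weightOrbit hu hAh' hAL' (weightOrbit_map hu (inv_mem ht) hv)⟩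

/-- The construction group preserves the orbit of the weight. -/
theorem exists_lift_weightOrbit (hu : IsUnitNormal ι h)
    {g : Equiv.Perm (OnePoint (EuclideanSpace ℝ (Fin 9)))} (hg : g ∈ constructionGroup ι h) :
    ∃ F : Model ≃ₗ[ℝ] Model, ModelIsometry F ∧ ModelIsometry F⁻¹ ∧ IsLift g F ∧
      ∀ v ∈ weightOrbit hu, F v ∈ weightOrbit hu ∧ F⁻¹ v ∈ weightOrbit hu := by
  have hweyl : ∀ (g : Equiv.Perm (OnePoint (EuclideanSpace ℝ (Fin 9)))) (F : Model ≃ₗ[ℝ] Model),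
      F ∈ modelWeyl hu → IsLift g F →
      ∃ F : Model ≃ₗ[ℝ] Model, ModelIsometry F ∧ ModelIsometry F⁻¹ ∧ IsLift g F ∧
      ∀ v ∈ weightOrbit hu, F v ∈ weightOrbit hu ∧ F⁻¹ v ∈ weightOrbit hu := fun g F hF hgF =>
    ⟨F, modelIsometry_of_mem hu hF, modelIsometry_of_mem hu (inv_mem hF), hgF,
      fun v hv => ⟨weightOrbit_map hu hF hv, weightOrbit_map hu (inv_mem hF) hv⟩⟩
  induction hg using Subgroup.closure_induction with
  | mem x hx =>
    rcases hx with (⟨f, hf, hh, rfl⟩ | rfl) | hx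
    · have hm := modelIsometry_affineLift f.toRealLinearIsometryEquiv (f 0)
      refine ⟨_, hm, fun u v => ?_, isLift_affineLift f, fun v hv => symmetry_weightOrbit hu hf hh hv⟩
      rw [← hm, ← LinearEquiv.mul_apply, ← LinearEquiv.mul_apply, mul_inv_cancel]
      rfl
    · exact hweyl _ _ (node_mem_modelWeyl hu 0) (isLift_reflection hu)
    · exact hweyl _ _ (node_mem_modelWeyl hu 1) (isLift_inversion hu hx)
  | one => exact hweyl _ _ (one_mem _) IsLift.one
  | mul x y _ _ hx hy =>
    obtain ⟨F, h1, h2, h3, h4⟩ := hx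
    obtain ⟨F', h1', h2', h3', h4'⟩ := hy
    refine ⟨F * F', fun u v => (h1 _ _).trans (h1' u v), ?_, h3.mul h3', fun v hv => ?_⟩
    · rw [mul_inv_rev]
      exact fun u v => (h2' _ _).trans (h2 u v)
    · rw [mul_inv_rev]
      exact ⟨(h4 _ (h4' v hv).1).1, (h4' _ (h4 v hv).2).2⟩
  | inv x _ hx =>
    obtain ⟨F, h1, h2, h3, h4⟩ := hx
    refine ⟨F⁻¹, h2, by rwa [inv_inv], h3.inv, fun v hv => ?_⟩
    rw [inv_inv]
    exact (h4 v hv).symm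

/-! ### The configuration as an orbit -/

theorem weightModel_mem (hu : IsUnitNormal ι h) : weightModel h ∈ weightOrbit hu :=
  ⟨1, one_mem _, rfl⟩

variable (h) in
/-- The opposite half space. -/
def oppositeModel : Model := (-((Real.sqrt 2 / 2) • h), 0, 1 / 2)

theorem oppositeModel_mem (hu : IsUnitNormal ι h) : oppositeModel h ∈ weightOrbit hu := by
  convert weightOrbit_map hu (node_mem_modelWeyl hu 0) (weightModel_mem hu) using 1
  rw [modelReflection_apply (modelForm_node_self hu 0), modelForm_node_weightModel hu,
    if_pos rfl, one_smul, nodeModel_zero]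
  ext1
  · simp only [oppositeModel, weightModel, Prod.fst_add]
    module
  · simp [oppositeModel, weightModel]

variable (ι) in
/-- The ball of radius `1/√2` at a point of the hyperplane. -/
def ballModel (x : EuclideanSpace ℝ (Fin 8)) : Model := (ι x, 1, (inner ℝ x x - 1 / 2) / 2)

/-- The inversion σ maps the half space touching at B to the ball at the origin; lattice
translations in the Weyl group give the others. -/
theorem ballModel_mem (hu : IsUnitNormal ι h) {x : EuclideanSpace ℝ (Fin 8)}
    (hx : x ∈ latticeE8) : ballModel ι x ∈ weightOrbit hu := by
  have h0 : ballModel ι 0 ∈ weightOrbit hu := by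
    convert weightOrbit_map hu (node_mem_modelWeyl hu 1) (oppositeModel_mem hu) using 1
    rw [modelReflection_apply (modelForm_node_self hu 1)]
    have : modelForm (nodeModel ι h 1) (oppositeModel h) = 1 := by
      simp only [nodeModel_one, oppositeModel, modelForm_apply, inner_neg_right,
        real_inner_smul_left, real_inner_smul_right, hu.inner_self]
      linear_combination sqrt_two_mul_self / 4
    rw [this, one_smul, nodeModel_one]
    simp only [ballModel, oppositeModel]
    ext1
    · simp
    · simp
      norm_num
  convert weightOrbit_map hu (translation_mem_modelWeyl hu hx) h0 using 1
  rw [translationLift_apply]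
  simp only [ballModel, map_zero, zero_add, one_smul, inner_zero_left, ι.inner_map_map]
  ext1
  · rfl
  · ext1
    · rfl
    · simp only; ring

theorem capModel_weightModel : capModel (weightModel h) = halfSpaceCap h (1 / Real.sqrt 2) := by
  rw [← capModel_halfSpace]
  conv_rhs => rw [← capModel_smul (show 0 < Real.sqrt 2 / 2 by positivity)]
  congr 1
  simp only [weightModel, Prod.smul_mk, one_div_sqrt_two, smul_eq_mul, mul_zero]
  have : (1 / 2 : ℝ) = Real.sqrt 2 / 2 * (Real.sqrt 2 / 2) := by
    linear_combination (-1 / 4 : ℝ) * sqrt_two_mul_self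
  rw [this]

theorem capModel_oppositeModel :
    capModel (oppositeModel h) = halfSpaceCap (-h) (1 / Real.sqrt 2) := by
  have := capModel_weightModel (h := -h)
  rwa [weightModel, smul_neg] at this

theorem capModel_ballModel (x : EuclideanSpace ℝ (Fin 8)) :
    capModel (ballModel ι x) = ballCap (ι x) (1 / Real.sqrt 2) := by
  rw [← capModel_ball _ (by positivity), ballModel, ι.inner_map_map, div_pow, one_pow,
    Real.sq_sqrt (by norm_num)]

/-- One inclusion holds because the construction group preserves the orbit, the other because the
Weyl group already generates the orbit from one initial half space. -/
theorem stripConfiguration_eq (hu : IsUnitNormal ι h) :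
    stripConfiguration ι h = {c | ∃ m ∈ weightOrbit hu, c = capModel m} := by
  ext c
  constructor
  · rintro ⟨g, hg, c₀, hc₀, rfl⟩
    obtain ⟨m, hm, rfl⟩ : ∃ m ∈ weightOrbit hu, c₀ = capModel m := by
      rcases hc₀ with ⟨x, hx, rfl⟩ | rfl | rfl
      · exact ⟨_, ballModel_mem hu hx, (capModel_ballModel x).symm⟩
      · exact ⟨_, weightModel_mem hu, capModel_weightModel.symm⟩
      · exact ⟨_, oppositeModel_mem hu, capModel_oppositeModel.symm⟩
    obtain ⟨F, hF, -, hgF, hW⟩ := exists_lift_weightOrbit hu hg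
    exact ⟨F m, (hW m hm).1, hgF.image_cap hF m⟩
  · rintro ⟨_, ⟨F, hF, rfl⟩, rfl⟩
    obtain ⟨g, hg, hgF⟩ := exists_lift_of_mem_modelWeyl hu hF
    refine ⟨g, hg, _, Or.inr (Or.inl rfl), ?_⟩
    rw [← capModel_weightModel, hgF.image_cap (modelIsometry_of_mem hu hF)]

end Generators

/-! ### The boundary chart -/

section Perspective

variable {ι : EuclideanSpace ℝ (Fin 8) →ₗᵢ[ℝ] EuclideanSpace ℝ (Fin 9)}
  {h : EuclideanSpace ℝ (Fin 9)}

theorem lorentz_symm_symm (hu : IsUnitNormal ι h) (u v : Model) :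
    lorentz gramT238 ((modelEquiv hu).symm u) ((modelEquiv hu).symm v) = modelForm u v := by
  rw [lorentz_modelEquiv_symm, LinearEquiv.apply_symm_apply]

theorem modelForm_chart_self (z : EuclideanSpace ℝ (Fin 9)) :
    modelForm (chartModel z) (chartModel z) = 0 := by
  simp [modelForm_chart_chart]

theorem modelForm_chart_infinity (z : EuclideanSpace ℝ (Fin 9)) :
    modelForm (chartModel z) infinityModel = 1 := modelForm_infinity _

/-- The point ∞ is the weight w_1: its products with the nodes are 1 at node 1 and 0 elsewhere. -/
theorem symm_infinity_mem (hu : IsUnitNormal ι h) : (modelEquiv hu).symm infinityModel ∈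
    lightCone gramT238 (weylVector gramT238) := by
  refine ⟨by rw [lorentz_symm_symm, modelForm_infinity]; rfl, ?_⟩
  have key : ∀ i, nodeExtra 1 i = if i = 1 then 4 else 0 := by decide
  have : (modelEquiv hu).symm infinityModel = weight gramT238 1 := by
    refine lorentz_ext fun x => ?_
    rw [lorentz_comm gramT238_isSymm, lorentz_comm gramT238_isSymm _ x, lorentz_eq_sum,
      lorentz_eq_sum x (weight gramT238 1)]
    refine Finset.sum_congr rfl fun i _ => ?_
    rw [lorentz_modelEquiv_symm, modelEquiv_single, modelForm_infinity, lorentz_weight]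
    simp only [nodeModel, key]
    split_ifs <;> norm_num
  rw [this, lorentz_weylVector]
  have key : 0 < ∑ j, twiceInverse j 1 := by decide +kernel
  have : (0 : ℝ) < ((∑ j, twiceInverse j 1 : ℤ) : ℝ) := by exact_mod_cast key
  simp only [weight_gramT238_apply, ← Finset.sum_div]
  push_cast at this
  linarith

theorem symm_chart_mem (hu : IsUnitNormal ι h) (z : EuclideanSpace ℝ (Fin 9)) :
    (modelEquiv hu).symm (chartModel z) ∈ lightCone gramT238 (weylVector gramT238) := by
  have h0 : lorentz gramT238 ((modelEquiv hu).symm (chartModel z))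
      ((modelEquiv hu).symm (chartModel z)) = 0 := by
    rw [lorentz_symm_symm, modelForm_chart_self]
  have h1 : lorentz gramT238 ((modelEquiv hu).symm (chartModel z))
      ((modelEquiv hu).symm infinityModel) = 1 := by
    rw [lorentz_symm_symm, modelForm_chart_infinity]
  refine ⟨h0, ?_⟩
  have hE := symm_infinity_mem hu
  set U := (modelEquiv hu).symm (chartModel z)
  have hU : U ≠ 0 := by
    intro hU
    rw [hU] at h1
    simp at h1
  -- The product of U with ∞ is 1. A nonzero light-like U is not orthogonal to D, and on the wrong
  -- side -U would have product -1 with ∞, against causality.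
  by_contra! hle
  rcases hle.eq_or_lt with heq | hlt
  · have := isLorentzian_gramT238.neg_of_orthogonal weylVector_timelike hU heq
    linarith
  · have := isLorentzian_gramT238.nonneg_of_causal (u := -U) weylVector_timelike
      (by simp [h0]) hE.1.ge (by simpa using hlt) hE.2
    rw [map_neg, LinearMap.neg_apply, h1] at this
    linarith

theorem symm_point_mem (hu : IsUnitNormal ι h) (p : OnePoint (EuclideanSpace ℝ (Fin 9))) :
    (modelEquiv hu).symm (pointModel p) ∈ lightCone gramT238 (weylVector gramT238) := by
  induction p using OnePoint.rec with
  | infty => exact symm_infinity_mem hu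
  | coe z => exact symm_chart_mem hu z

/-- Every light-like ray is a point of `ℝ⁹ ∪ {∞}`. -/
theorem exists_point_of_mem_lightCone (hu : IsUnitNormal ι h) {x : Fin 11 → ℝ}
    (hx : x ∈ lightCone gramT238 (weylVector gramT238)) :
    ∃ p : OnePoint (EuclideanSpace ℝ (Fin 9)), ∃ t : ℝ, 0 < t ∧
      x = t • (modelEquiv hu).symm (pointModel p) := by
  have hE := symm_infinity_mem hu
  have ha := isLorentzian_gramT238.nonneg_of_causal weylVector_timelike hx.1.ge hE.1.ge hx.2 hE.2
  have h0 := hx.1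
  obtain ⟨m, rfl⟩ := (modelEquiv hu).symm.surjective x
  rw [lorentz_symm_symm, modelForm_infinity] at ha
  rw [lorentz_symm_symm] at h0
  obtain ⟨q, a, b⟩ := m
  rw [modelForm_apply] at h0
  simp only at ha h0
  rcases ha.eq_or_lt with rfl | hpos
  · have hq : q = 0 := by
      rw [← inner_self_eq_zero (𝕜 := ℝ)]
      linarith
    have hb : ((q, 0, b) : Model) = b • infinityModel := by simp [infinityModel, hq]
    refine ⟨∞, b, ?_, by rw [hb, map_smul]; rfl⟩
    have := hx.2
    rw [hb, map_smul, map_smul, LinearMap.smul_apply, smul_eq_mul] at this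
    exact pos_of_mul_pos_left this hE.2.le
  · refine ⟨(a⁻¹ • q : EuclideanSpace ℝ (Fin 9)), a, hpos, ?_⟩
    rw [← map_smul, pointModel_coe]
    congr 1
    ext1
    · simp [chartModel, hpos.ne']
    · ext1
      · simp [chartModel]
      · simp only [chartModel, Prod.smul_snd, smul_eq_mul, real_inner_smul_left,
          real_inner_smul_right]
        field_simp
        linarith

theorem isBoundaryChart_chartModel (hu : IsUnitNormal ι h) :
    IsBoundaryChart gramT238 (weylVector gramT238) ((modelEquiv hu).symm infinityModel)
      fun z => (modelEquiv hu).symm (chartModel z) where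
  mem z := by
    refine ⟨symm_chart_mem hu z, fun hs => ?_⟩
    have h1 : lorentz gramT238 ((modelEquiv hu).symm (chartModel z))
        ((modelEquiv hu).symm infinityModel) = 1 := by
      rw [lorentz_symm_symm, modelForm_chart_infinity]
    have h0 := (symm_infinity_mem hu).1
    rcases hs with hs | hs | ⟨r, s, hr, hs, e⟩
    · rw [hs] at h1
      simp at h1
    · rw [hs] at h1
      simp at h1
    · have := congrArg (fun v => lorentz gramT238 v ((modelEquiv hu).symm infinityModel)) e
      simp only [map_smul, LinearMap.smul_apply, h1, h0, smul_eq_mul] at this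
      linarith
  surj A hA hne := by
    obtain ⟨p, t, ht, rfl⟩ := exists_point_of_mem_lightCone hu hA
    induction p using OnePoint.rec with
    | infty => exact absurd (SameRay.sameRay_pos_smul_left _ ht) hne
    | coe z => exact ⟨z, SameRay.sameRay_pos_smul_left _ ht⟩
  dist_sq x y := by
    simp only [lorentz_symm_symm, modelForm_chart_chart, modelForm_chart_infinity]
    ring

theorem stripConfiguration_eq_caps (hu : IsUnitNormal ι h) : stripConfiguration ι h =
    {c | ∃ n ∈ coxeterPacking gramT238, c = capModel (modelEquiv hu n)} := by
  rw [stripConfiguration_eq hu]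
  have h2 : 0 < Real.sqrt 2 := Real.sqrt_pos.2 two_pos
  ext c
  constructor
  · rintro ⟨m, hm, rfl⟩
    refine ⟨(modelEquiv hu).symm (Real.sqrt 2 • m), ?_, ?_⟩
    · exact (modelEquiv_mem_weightOrbit hu).2 ⟨m, hm, by simp⟩
    · rw [LinearEquiv.apply_symm_apply, capModel_smul h2]
  · rintro ⟨n, hn, rfl⟩
    obtain ⟨m, hm, e⟩ := (modelEquiv_mem_weightOrbit hu).1 hn
    exact ⟨m, hm, by rw [e, capModel_smul h2]⟩

theorem isPerspective_stripConfiguration (hu : IsUnitNormal ι h) :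
    IsPerspective gramT238 (weylVector gramT238) (coxeterPacking gramT238)
      (stripConfiguration ι h) := by
  refine ⟨_, symm_infinity_mem hu, _, isBoundaryChart_chartModel hu, ?_⟩
  rw [stripConfiguration_eq_caps hu]
  have : ∀ n : Fin 11 → ℝ, capModel (modelEquiv hu n) = {p | lorentz gramT238 n
      (p.elim ((modelEquiv hu).symm infinityModel) fun z =>
        (modelEquiv hu).symm (chartModel z)) ≤ 0} := by
    intro n
    ext p
    induction p using OnePoint.rec with
    | infty =>
      change modelForm _ infinityModel ≤ 0 ↔
        lorentz gramT238 n ((modelEquiv hu).symm infinityModel) ≤ 0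
      rw [lorentz_modelEquiv_symm]
    | coe z =>
      change modelForm _ (chartModel z) ≤ 0 ↔
        lorentz gramT238 n ((modelEquiv hu).symm (chartModel z)) ≤ 0
      rw [lorentz_modelEquiv_symm]
  simp only [this]

/-! ### The configuration is a sphere packing -/

/-- A spherical cap has no interior points on its boundary. -/
theorem not_eventually_modelForm_chart_eq_zero {m : Model} (hm : modelForm m m < 0)
    (z : EuclideanSpace ℝ (Fin 9)) : ¬∀ᶠ y in nhds z, modelForm m (chartModel y) = 0 := by
  intro hev
  have hz := hev.self_of_nhds
  rw [modelForm_chart] at hz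
  rw [modelForm_apply] at hm
  -- The gradient at z of y ↦ m ⬝ chart(y). Where that function vanishes, |g|² = -m ⬝ m > 0.
  set g := m.2.1 • z - m.1 with hg
  have hgg : inner ℝ g g = -(-inner ℝ m.1 m.1 + m.2.1 * m.2.2 + m.2.2 * m.2.1) := by
    rw [hg]
    simp only [inner_sub_left, inner_sub_right, real_inner_smul_left, real_inner_smul_right,
      real_inner_comm m.1 z]
    linear_combination (2 * m.2.1) * hz
  have hpos : 0 < inner ℝ g g := by rw [hgg]; linarith
  have hline : Filter.Tendsto (fun ε : ℝ => z + ε • g) (nhdsWithin 0 (Set.Ioi 0)) (nhds z) := by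
    have : Continuous fun ε : ℝ => z + ε • g := by fun_prop
    have h0 := this.tendsto 0
    rw [zero_smul, add_zero] at h0
    exact h0.mono_left nhdsWithin_le_nhds
  -- Moving from z along the gradient makes the function positive for small ε > 0, so it cannot
  -- vanish near z.
  have hval : ∀ ε : ℝ, modelForm m (chartModel (z + ε • g)) =
      ε * inner ℝ g g * (1 + m.2.1 * ε / 2) := by
    intro ε
    have h3 : inner ℝ g g = m.2.1 * inner ℝ z g - inner ℝ m.1 g := by
      conv_lhs => rw [hg]
      rw [inner_sub_left, real_inner_smul_left]
    rw [modelForm_chart]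
    simp only [inner_add_left, inner_add_right, real_inner_smul_left, real_inner_smul_right,
      real_inner_comm z g]
    linear_combination hz - ε * h3
  have hcont : ∀ᶠ ε : ℝ in nhds 0, 0 < 1 + m.2.1 * ε / 2 := by
    have : Continuous fun ε : ℝ => 1 + m.2.1 * ε / 2 := by fun_prop
    exact this.continuousAt.eventually_const_lt (by simp)
  obtain ⟨ε, ⟨h1, h2⟩, h3⟩ := (((hline.eventually hev).and
    (hcont.filter_mono nhdsWithin_le_nhds)).and
      (self_mem_nhdsWithin : Set.Ioi (0 : ℝ) ∈ nhdsWithin 0 (Set.Ioi 0))).exists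
  rw [hval] at h1
  exact (mul_pos (mul_pos h3 hpos) h2).ne' h1

/-- Add to D a vector orthogonal to n, n' and D, scaled to reach the light cone: the products with n
and n' remain those of D. -/
theorem exists_common_exterior_point {n n' : Fin 11 → ℝ}
    (hn : 0 < lorentz gramT238 n (weylVector gramT238))
    (hn' : 0 < lorentz gramT238 n' (weylVector gramT238)) :
    ∃ x ∈ lightCone gramT238 (weylVector gramT238),
      0 < lorentz gramT238 n x ∧ 0 < lorentz gramT238 n' x := by
  set D := weylVector gramT238
  let L : (Fin 11 → ℝ) →ₗ[ℝ] Fin 3 → ℝ :=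
    LinearMap.pi ![lorentz gramT238 n, lorentz gramT238 n', lorentz gramT238 D]
  have hker : LinearMap.ker L ≠ ⊥ := L.ker_ne_bot_of_finrank_lt (by simp)
  obtain ⟨v, hv, hv0⟩ := Submodule.exists_mem_ne_zero_of_ne_bot hker
  have hv1 : lorentz gramT238 n v = 0 := congrFun hv 0
  have hv2 : lorentz gramT238 n' v = 0 := congrFun hv 1
  have hv3 : lorentz gramT238 D v = 0 := congrFun hv 2
  have hv4 : lorentz gramT238 v D = 0 := by rw [lorentz_comm gramT238_isSymm, hv3]
  have hneg := isLorentzian_gramT238.neg_of_orthogonal weylVector_timelike hv0 hv4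
  have hD := weylVector_timelike
  set s := Real.sqrt (lorentz gramT238 D D / -lorentz gramT238 v v)
  have hs : s * s = lorentz gramT238 D D / -lorentz gramT238 v v :=
    Real.mul_self_sqrt (div_nonneg hD.le (by linarith))
  refine ⟨D + s • v, ⟨?_, ?_⟩, ?_, ?_⟩
  · simp only [map_add, map_smul, LinearMap.add_apply, LinearMap.smul_apply, smul_eq_mul, hv3, hv4]
    have hne : -lorentz gramT238 v v ≠ 0 := by linarith
    rw [eq_div_iff hne] at hs
    linear_combination -hs
  · simp only [map_add, map_smul, LinearMap.add_apply, LinearMap.smul_apply, smul_eq_mul, hv4]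
    linarith
  · rw [map_add, map_smul, hv1, smul_zero, add_zero]
    exact hn
  · rw [map_add, map_smul, hv2, smul_zero, add_zero]
    exact hn'

theorem isSpherePacking_stripConfiguration (hu : IsUnitNormal ι h) :
    IsSpherePacking (stripConfiguration ι h) := by
  rw [stripConfiguration_eq_caps hu]
  have hneg : ∀ n ∈ coxeterPacking gramT238,
      modelForm (modelEquiv hu n) (modelEquiv hu n) < 0 := by
    intro n hn
    rw [modelForm_modelEquiv, lorentz_self_of_mem_coxeterPacking hn]
    norm_num
  refine ⟨?_, ?_⟩
  · rintro _ ⟨n, hn, rfl⟩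
    exact isOrientedSphere_capModel (hneg n hn)
  rintro _ ⟨n, hn, rfl⟩ _ ⟨n', hn', rfl⟩ hne
  have hnn : n ≠ n' := fun e => hne (by rw [e])
  have hD := lorentz_weylVector_pos_of_mem_coxeterPacking hn
  have hD' := lorentz_weylVector_pos_of_mem_coxeterPacking hn'
  have hpoint : ∀ (x : Fin 11 → ℝ) (p : OnePoint (EuclideanSpace ℝ (Fin 9))),
      modelForm (modelEquiv hu x) (pointModel p) =
        lorentz gramT238 x ((modelEquiv hu).symm (pointModel p)) :=
    fun x p => (lorentz_modelEquiv_symm hu x _).symm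
  constructor
  · rw [Set.disjoint_iff_inter_eq_empty, ← Set.not_nonempty_iff_eq_empty]
    intro hne
    have hopen : IsOpen (interior (capModel (modelEquiv hu n)) ∩
      interior (capModel (modelEquiv hu n'))) := isOpen_interior.inter isOpen_interior
    obtain ⟨z, hz⟩ := OnePoint.denseRange_coe.exists_mem_open hopen hne
    apply not_eventually_modelForm_chart_eq_zero (hneg n hn) z
    have hnhds := OnePoint.continuous_coe.continuousAt.preimage_mem_nhds (hopen.mem_nhds hz)
    filter_upwards [hnhds] with y hy
    have h1 := mem_capModel.1 (interior_subset hy.1)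
    have h2 := mem_capModel.1 (interior_subset hy.2)
    rw [hpoint] at h1 h2
    have hy' := symm_point_mem hu (y : OnePoint (EuclideanSpace ℝ (Fin 9)))
    -- The packing inequality makes n + n' causal, and it is on the side of D, so it has nonnegative
    -- product with every point. In both closed sides, both products must therefore vanish, on a
    -- whole open set.
    have h3 := isLorentzian_gramT238.nonneg_of_causal (u := n + n') weylVector_timelike (by
      have := one_le_lorentz_of_mem_coxeterPacking hn hn' hnn
      have hc := lorentz_comm gramT238_isSymm n n'
      simp only [map_add, LinearMap.add_apply, lorentz_self_of_mem_coxeterPacking hn,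
        lorentz_self_of_mem_coxeterPacking hn']
      linarith) hy'.1.ge (by rw [map_add, LinearMap.add_apply]; linarith) hy'.2
    rw [map_add, LinearMap.add_apply] at h3
    rw [← pointModel_coe, hpoint]
    linarith
  · intro hcover
    obtain ⟨x, hx, h1, h2⟩ := exists_common_exterior_point hD hD'
    obtain ⟨p, t, ht, rfl⟩ := exists_point_of_mem_lightCone hu hx
    rw [map_smul, smul_eq_mul, ← hpoint] at h1 h2
    rcases (hcover ▸ Set.mem_univ p : p ∈ capModel _ ∪ capModel _) with hp | hp
    · exact absurd (mul_nonpos_of_nonneg_of_nonpos ht.le hp) (not_le.2 h1)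
    · exact absurd (mul_nonpos_of_nonneg_of_nonpos ht.le hp) (not_le.2 h2)

end Perspective

/-! ### The packing is Apollonian -/

section Apollonian

/-- The standard hyperplane in `ℝ⁹`. -/
def standardInclusion : EuclideanSpace ℝ (Fin 8) →ₗᵢ[ℝ] EuclideanSpace ℝ (Fin 9) where
  toFun x := !₂[x 0, x 1, x 2, x 3, x 4, x 5, x 6, x 7, 0]
  map_add' x y := by
    ext i
    fin_cases i <;> simp
  map_smul' c x := by
    ext i
    fin_cases i <;> simp
  norm_map' x := by
    simp [EuclideanSpace.norm_eq, Fin.sum_univ_succ]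

theorem isUnitNormal_standard :
    IsUnitNormal standardInclusion (EuclideanSpace.single 8 1) := by
  refine ⟨by simp, fun x => ?_⟩
  simp [standardInclusion, EuclideanSpace.inner_single_left]

variable {ι : EuclideanSpace ℝ (Fin 8) →ₗᵢ[ℝ] EuclideanSpace ℝ (Fin 9)}
  {h : EuclideanSpace ℝ (Fin 9)}

/-- A witness is the centre of a ball, or a point far out in the direction q for a half space, or
far along ±h for the outside of a ball. -/
theorem exists_chart_neg (hu : IsUnitNormal ι h) {m : Model} (hm : modelForm m m < 0) :
    ∃ z, modelForm m (chartModel z) < 0 := by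
  obtain ⟨q, a, b⟩ := m
  rw [modelForm_apply] at hm
  simp only [modelForm_chart]
  simp only at hm
  by_contra! hall
  have ha : 0 ≤ a := by
    by_contra! ha
    have h1 : ∀ t : ℝ, 0 ≤ -inner ℝ q h * t + a / 2 * t ^ 2 + b := fun t => by
      have := hall (t • h)
      simp only [real_inner_smul_left, real_inner_smul_right, hu.inner_self] at this
      linarith
    -- Adding the inequalities at t and -t cancels the linear term; t is so large that -a t²/2
    -- exceeds |b|.
    have h2 := h1 ((|b| + 1) / (-a / 2) + 1)
    have h3 := h1 (-((|b| + 1) / (-a / 2) + 1))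
    set t := (|b| + 1) / (-a / 2) + 1 with ht
    have h4 : -a / 2 * (t - 1) = |b| + 1 := by
      rw [ht, add_sub_cancel_right, mul_div_cancel₀ _ (by linarith)]
    have h5 : 0 ≤ t - 1 := by
      rw [ht, add_sub_cancel_right]
      exact div_nonneg (by positivity) (by linarith)
    have h6 : 0 ≤ -a / 2 * ((t - 1) * t + 1) := mul_nonneg (by linarith) (by
      have := mul_nonneg h5 (by linarith : 0 ≤ t)
      linarith)
    have := mul_nonneg (by linarith : 0 ≤ -a / 2) (mul_nonneg h5 h5)
    linarith [le_abs_self b]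
  rcases ha.eq_or_lt with rfl | ha
  · have hq : 0 < inner ℝ q q := by linarith
    have := hall (((|b| + 1) / inner ℝ q q) • q)
    rw [real_inner_smul_right, div_mul_cancel₀ _ hq.ne'] at this
    have := le_abs_self b
    linarith
  · have := hall (a⁻¹ • q)
    rw [real_inner_smul_left, real_inner_smul_right] at this
    have h2 : -(a⁻¹ * inner ℝ q q) + a * (a⁻¹ * (a⁻¹ * inner ℝ q q) / 2) + b =
        (2 * a)⁻¹ * (-inner ℝ q q + a * b + b * a) := by
      field_simp
      ring
    rw [h2] at this
    exact absurd (mul_neg_of_pos_of_neg (inv_pos.2 (by linarith)) hm) (not_lt.2 this)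

theorem inner_nodeModel_fst (hu : IsUnitNormal ι h) (i j : Fin 11) :
    inner ℝ (nodeModel ι h i).1 (nodeModel ι h j).1 =
      ((affineGram i j + nodeExtra 0 i * nodeExtra 0 j / 2 : ℚ) : ℝ) := by
  simp only [nodeModel, inner_add_left, inner_add_right, real_inner_smul_left,
    real_inner_smul_right, hu.inner_self, hu.inner_eq, hu.inner_eq', LinearIsometry.inner_map_map,
    inner_nodeVec]
  push_cast
  linear_combination (nodeExtra 0 i : ℝ) * nodeExtra 0 j / 4 * sqrt_two_mul_self

/-- The Euclidean components of the nodes have rational inner products, because √2 enters only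
squared. -/
theorem exists_rat_modelForm_chart (hu : IsUnitNormal ι h) (u : Fin 11 → ℚ) (i : Fin 11) :
    ∃ r : ℚ, modelForm (nodeModel ι h i)
      (chartModel (modelEquiv hu fun j => (u j : ℝ)).1) = r := by
  have hz : (modelEquiv hu fun j => (u j : ℝ)).1 = ∑ j, (u j : ℝ) • (nodeModel ι h j).1 := by
    rw [modelEquiv_apply, toModel, Fintype.linearCombination_apply, Prod.fst_sum]
    rfl
  have h1 : ∀ k, ∃ r : ℚ,
      inner ℝ (nodeModel ι h k).1 (∑ j, (u j : ℝ) • (nodeModel ι h j).1) = (r : ℝ) := fun k => by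
    refine ⟨∑ j, u j * (affineGram k j + nodeExtra 0 k * nodeExtra 0 j / 2), ?_⟩
    simp only [inner_sum, real_inner_smul_right, inner_nodeModel_fst hu]
    push_cast
    rfl
  choose r hr using h1
  rw [hz, modelForm_chart, hr, sum_inner]
  simp only [real_inner_smul_left, hr]
  refine ⟨-r i + (nodeExtra 1 i : ℚ) / 4 * ((∑ k, u k * r k) / 2) + (nodeExtra 2 i : ℚ) / 4, ?_⟩
  push_cast
  rfl

theorem exists_common_denominator {k : ℕ} (r : Fin k → ℚ) :
    ∃ n : ℕ, 0 < n ∧ ∀ i, ∃ z : ℤ, (n : ℝ) * r i = z := by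
  refine ⟨∏ i, (r i).den, Finset.prod_pos fun i _ => (r i).den_pos, fun i => ?_⟩
  obtain ⟨d, hd⟩ := Finset.dvd_prod_of_mem (fun i => (r i).den) (Finset.mem_univ i)
  refine ⟨d * (r i).num, ?_⟩
  rw [hd]
  have h1 : (((r i).den : ℚ) * r i : ℚ) = (r i).num := Rat.den_mul_eq_num (r i)
  have h2 : ((r i).den : ℝ) * (r i : ℝ) = (r i).num := by exact_mod_cast h1
  push_cast
  linear_combination (d : ℝ) * h2

/-- The strict inside of a sphere is open and nonempty, so it contains a point whose light-like
vector has rational products with the nodes. A multiple has integral products and is not in the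
residual set. -/
theorem isMaximalPacking_coxeterPacking :
    IsMaximalPacking gramT238 (weylVector gramT238) (coxeterPacking gramT238) := by
  rintro ⟨m, hm, hres⟩
  have hu := isUnitNormal_standard
  set h : EuclideanSpace ℝ (Fin 9) := EuclideanSpace.single 8 1
  obtain ⟨z, hz⟩ := exists_chart_neg hu (m := modelEquiv hu m) (by rwa [modelForm_modelEquiv])
  obtain ⟨u, rfl⟩ := exists_decomposition hu z
  have hcont : Continuous fun u : Fin 11 → ℝ =>
      modelForm (modelEquiv hu m) (chartModel (modelEquiv hu u).1) := by
    have h1 : Continuous fun u => (modelEquiv hu u).1 :=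
      continuous_fst.comp (LinearMap.continuous_of_finiteDimensional (modelEquiv hu).toLinearMap)
    simp only [modelForm_chart]
    fun_prop
  -- Density is needed only in ℝ¹¹, whose node coordinates map continuously onto ℝ⁹.
  have hdense : DenseRange (Pi.map fun (_ : Fin 11) (r : ℚ) => (r : ℝ)) :=
    DenseRange.piMap fun _ => Rat.denseRange_cast
  obtain ⟨v, hv⟩ := hdense.exists_mem_open (isOpen_lt hcont continuous_const) ⟨u, hz⟩
  have hv' : modelForm (modelEquiv hu m) (chartModel (modelEquiv hu fun j => (v j : ℝ)).1) < 0 := hv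
  choose r hr using exists_rat_modelForm_chart hu v
  set x := (modelEquiv hu).symm (chartModel (modelEquiv hu fun j => (v j : ℝ)).1)
  have hx := symm_chart_mem hu (modelEquiv hu fun j => (v j : ℝ)).1
  obtain ⟨n, hn, hint⟩ := exists_common_denominator r
  have hn' : (0 : ℝ) < n := Nat.cast_pos.2 hn
  have hmem : (n : ℝ) • x ∈ lightCone gramT238 (weylVector gramT238) := by
    refine ⟨?_, ?_⟩
    · rw [map_smul, map_smul, LinearMap.smul_apply, hx.1, smul_zero, smul_zero]
    · rw [map_smul, LinearMap.smul_apply]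
      exact mul_pos hn' hx.2
  refine not_mem_residualSet_of_integral hmem (fun i => ?_) (hres _ hmem ?_)
  · obtain ⟨k, hk⟩ := hint i
    exact ⟨k, by rw [map_smul, lorentz_modelEquiv_symm, modelEquiv_single, hr, smul_eq_mul, hk]⟩
  · rw [map_smul, lorentz_modelEquiv_symm]
    exact mul_nonpos_of_nonneg_of_nonpos hn'.le hv'.le

/-- A relation s n + t n' = 0 has s = t by pairing with n, and then s = 0 because n and n' both have
positive product with D. -/
theorem areTangent_of_mem_coxeterPacking {n n' : Fin 11 → ℝ}
    (hn : n ∈ coxeterPacking gramT238) (hn' : n' ∈ coxeterPacking gramT238)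
    (h1 : lorentz gramT238 n n' = 1) : AreTangent gramT238 n n' := by
  have hs := lorentz_self_of_mem_coxeterPacking hn
  have hs' := lorentz_self_of_mem_coxeterPacking hn'
  have hD := lorentz_weylVector_pos_of_mem_coxeterPacking hn
  have hD' := lorentz_weylVector_pos_of_mem_coxeterPacking hn'
  constructor
  · rw [LinearIndependent.pair_iff]
    intro s t hst
    have e1 := congrArg (lorentz gramT238 n) hst
    have e2 := congrArg (fun v => lorentz gramT238 v (weylVector gramT238)) hst
    simp only [map_add, map_smul, LinearMap.add_apply, LinearMap.smul_apply, map_zero,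
      LinearMap.zero_apply, smul_eq_mul, hs, h1] at e1 e2
    obtain rfl : t = s := by linarith
    have : t * (lorentz gramT238 n (weylVector gramT238) +
      lorentz gramT238 n' (weylVector gramT238)) = 0 := by linarith
    rcases mul_eq_zero.1 this with h | h
    · exact ⟨h, h⟩
    · linarith
  · rw [h1, lorentzLength, lorentzLength, hs, hs']
    norm_num

/-- Twice the coordinates of the vertices of a regular simplex of edge length `√2` in `E₈`. -/
def simplexRows : Matrix (Fin 9) (Fin 8) ℤ :=
  !![0, 0, 0, 0, 0, 0, 0, 0;
     2, 0, 0, 0, 0, 0, 0, 2;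
     0, 2, 0, 0, 0, 0, 0, 2;
     0, 0, 2, 0, 0, 0, 0, 2;
     0, 0, 0, 2, 0, 0, 0, 2;
     0, 0, 0, 0, 2, 0, 0, 2;
     0, 0, 0, 0, 0, 2, 0, 2;
     0, 0, 0, 0, 0, 0, 2, 2;
     1, 1, 1, 1, 1, 1, 1, 1]

/-- The vertices of a regular simplex in the `E₈` lattice. -/
def simplexVertex (k : Fin 9) : EuclideanSpace ℝ (Fin 8) :=
  WithLp.toLp 2 fun i => (simplexRows k i : ℝ) / 2

theorem simplexVertex_mem (k : Fin 9) : simplexVertex k ∈ latticeE8 := by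
  have key : ∀ k : Fin 9, ((∀ i, simplexRows k i % 2 = 0) ∨ ∀ i, simplexRows k i % 2 = 1) ∧
      (∑ i, simplexRows k i) % 4 = 0 := by decide +kernel
  obtain ⟨h1, h2⟩ := key k
  refine ⟨?_, (∑ i, simplexRows k i) / 4, ?_⟩
  · refine h1.imp (fun h i => ⟨simplexRows k i / 2, ?_⟩) fun h i => ⟨simplexRows k i / 2, ?_⟩
    · have : simplexRows k i = 2 * (simplexRows k i / 2) := by have := h i; omega
      have : (simplexRows k i : ℝ) = 2 * ((simplexRows k i / 2 : ℤ) : ℝ) := by exact_mod_cast this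
      change (simplexRows k i : ℝ) / 2 = _
      rw [this]
      ring
    · have : simplexRows k i = 2 * (simplexRows k i / 2) + 1 := by have := h i; omega
      have : (simplexRows k i : ℝ) = 2 * ((simplexRows k i / 2 : ℤ) : ℝ) + 1 := by
        exact_mod_cast this
      change (simplexRows k i : ℝ) / 2 = _
      rw [this]
      ring
  · have : ∑ i, simplexRows k i = 4 * ((∑ i, simplexRows k i) / 4) := by omega
    have : ∑ i, (simplexRows k i : ℝ) = 4 * (((∑ i, simplexRows k i) / 4 : ℤ) : ℝ) := by
      exact_mod_cast this
    change ∑ i, (simplexRows k i : ℝ) / 2 = _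
    rw [← Finset.sum_div, this]
    ring

theorem simplexVertex_dist (k l : Fin 9) :
    inner ℝ (simplexVertex k) (simplexVertex k) + inner ℝ (simplexVertex l) (simplexVertex l) -
      2 * inner ℝ (simplexVertex k) (simplexVertex l) = if k = l then (0 : ℝ) else 2 := by
  have hin : ∀ k l : Fin 9, inner ℝ (simplexVertex k) (simplexVertex l) =
      (((simplexRows * simplexRows.transpose) k l : ℤ) : ℝ) / 4 := by
    intro k l
    rw [inner_eq_sum, Matrix.mul_apply]
    push_cast
    rw [Finset.sum_div]
    refine Finset.sum_congr rfl fun i _ => ?_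
    change (simplexRows k i : ℝ) / 2 * ((simplexRows l i : ℝ) / 2) = _
    rw [Matrix.transpose_apply]
    ring
  set M := simplexRows * simplexRows.transpose with hM
  have key : Matrix.of (fun k l : Fin 9 => M k k + M l l - 2 * M k l) =
      Matrix.of fun k l => if k = l then 0 else 8 := by
    rw [hM]
    decide +kernel
  have key' : M k k + M l l - 2 * M k l = if k = l then 0 else 8 := congrFun (congrFun key k) l
  have key2 : (M k k : ℝ) + M l l - 2 * M k l = if k = l then 0 else 8 := by exact_mod_cast key'
  rw [hin, hin, hin]
  split_ifs at key2 ⊢ <;> linarith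

variable (ι h) in
/-- Two half spaces and nine balls that touch each other. -/
def clusterModel : Bool ⊕ Fin 9 → Model :=
  Sum.elim (fun b => if b then weightModel h else oppositeModel h)
    fun k => ballModel ι (simplexVertex k)

theorem clusterModel_mem (hu : IsUnitNormal ι h) (k : Bool ⊕ Fin 9) :
    clusterModel ι h k ∈ weightOrbit hu := by
  rcases k with (_ | _) | k
  · exact oppositeModel_mem hu
  · exact weightModel_mem hu
  · exact ballModel_mem hu (simplexVertex_mem k)

/-- In the unnormalized orbit the norm is -1/2, so tangency means product 1/2. The two half spaces
touch at ∞, and balls of radius 1/√2 touch at distance √2. -/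
theorem modelForm_cluster (hu : IsUnitNormal ι h) {k l : Bool ⊕ Fin 9} (hkl : k ≠ l) :
    modelForm (clusterModel ι h k) (clusterModel ι h l) = 1 / 2 := by
  have hplane : ∀ (s : ℝ) (l : Fin 9),
      modelForm (s • h, 0, 1 / 2) (ballModel ι (simplexVertex l)) = 1 / 2 := by
    intro s l
    simp [modelForm_apply, ballModel, real_inner_smul_left, hu.inner_eq]
  have hw : ∀ l : Fin 9, modelForm (weightModel h) (ballModel ι (simplexVertex l)) = 1 / 2 :=
    hplane _
  have ho : ∀ l : Fin 9, modelForm (oppositeModel h) (ballModel ι (simplexVertex l)) = 1 / 2 := by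
    intro l
    rw [oppositeModel, ← neg_smul]
    exact hplane _ l
  have hwo : modelForm (weightModel h) (oppositeModel h) = 1 / 2 := by
    simp only [modelForm_apply, weightModel, oppositeModel, inner_neg_right, real_inner_smul_left,
      real_inner_smul_right, hu.inner_self]
    linear_combination sqrt_two_mul_self / 4
  rcases k with (_ | _) | k <;> rcases l with (_ | _) | l
  · exact absurd rfl hkl
  · exact (modelForm_comm _ _).trans hwo
  · exact ho l
  · exact hwo
  · exact absurd rfl hkl
  · exact hw l
  · exact (modelForm_comm _ _).trans (ho k)
  · exact (modelForm_comm _ _).trans (hw k)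
  · have hne : k ≠ l := fun e => hkl (by rw [e])
    have := simplexVertex_dist k l
    rw [if_neg hne] at this
    change modelForm (ballModel ι _) (ballModel ι _) = _
    simp only [ballModel, modelForm_apply, ι.inner_map_map]
    linarith

/-- The cluster contains w_0, so the element that carries w_0 to the given member carries the
cluster along. -/
theorem hasApollonianProperty_coxeterPacking :
    HasApollonianProperty gramT238 (coxeterPacking gramT238) := by
  classical
  intro n hn
  have hu := isUnitNormal_standard
  obtain ⟨γ, hγ, rfl⟩ := mem_coxeterPacking.1 hn
  set h : EuclideanSpace ℝ (Fin 9) := EuclideanSpace.single 8 1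
  let c : Bool ⊕ Fin 9 → Fin 11 → ℝ := fun k =>
    γ ((modelEquiv hu).symm (Real.sqrt 2 • clusterModel standardInclusion h k))
  have hc : ∀ k, c k ∈ coxeterPacking gramT238 := fun k => map_mem_coxeterPacking hγ
    ((modelEquiv_mem_weightOrbit hu).2 ⟨_, clusterModel_mem hu k, by simp⟩)
  have hcc : ∀ k l, k ≠ l → lorentz gramT238 (c k) (c l) = 1 := by
    intro k l hkl
    rw [preservesProduct_weyl238 hγ, lorentz_symm_symm, map_smul, map_smul, LinearMap.smul_apply,
      modelForm_cluster hu hkl, smul_smul, sqrt_two_mul_self]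
    norm_num
  have hinj : Function.Injective c := by
    intro k l hkl
    by_contra hne
    have h1 := hcc k l hne
    rw [hkl, lorentz_self_of_mem_coxeterPacking (hc l)] at h1
    norm_num at h1
  refine ⟨Finset.univ.image c, ?_, ?_, ?_, ?_⟩
  · rw [Finset.mem_image]
    refine ⟨Sum.inl true, Finset.mem_univ _, ?_⟩
    change γ ((modelEquiv hu).symm (Real.sqrt 2 • weightModel h)) = _
    rw [← modelEquiv_weight_zero hu, ← map_smul, LinearEquiv.symm_apply_apply, map_smul]
  · intro v hv
    obtain ⟨k, -, rfl⟩ := Finset.mem_image.1 hv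
    exact hc k
  · rw [Finset.card_image_of_injective _ hinj]
    simp
  · rw [Finset.coe_image, Finset.coe_univ, Set.image_univ]
    rintro _ ⟨k, rfl⟩ _ ⟨l, rfl⟩ hne
    exact areTangent_of_mem_coxeterPacking (hc k) (hc l) (hcc k l fun e => hne (by rw [e]))

end Apollonian

end

theorem mainTheorem6 :
    (IsLorentzian gramT238 ∧
      0 < lorentz gramT238 (weylVector gramT238)
        (weylVector gramT238)) ∧
    ((∀ i, lorentz gramT238 (weight gramT238 i)
        (weight gramT238 i) < 0 ↔ i = 0) ∧
      AreTangent gramT238 (weight gramT238 0) (Pi.single 0 1)) ∧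
    (∀ (ι : EuclideanSpace ℝ (Fin 8) →ₗᵢ[ℝ] EuclideanSpace ℝ (Fin 9))
      (h : EuclideanSpace ℝ (Fin 9)), ‖h‖ = 1 → (∀ x, inner ℝ h (ι x) = 0) →
      IsSpherePacking (stripConfiguration ι h) ∧
      IsPerspective gramT238 (weylVector gramT238)
        (coxeterPacking gramT238) (stripConfiguration ι h)) ∧
    IsBoydMaxwellPacking gramT238 (weylVector gramT238)
      (coxeterPacking gramT238) ∧
    IsApollonianPacking gramT238 (weylVector gramT238)
      (coxeterPacking gramT238) := by
  refine ⟨⟨isLorentzian_gramT238, weylVector_timelike⟩,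
    ⟨lorentz_weight_self_neg_iff, areTangent_weight_zero⟩, fun ι h hh hι => ?_,
    isBoydMaxwellPacking_coxeterPacking,
    ⟨isPacking_coxeterPacking, _, isCrystallographicFor_weyl238⟩,
    isMaximalPacking_coxeterPacking, hasApollonianProperty_coxeterPacking⟩
  have hu : IsUnitNormal ι h := ⟨hh, hι⟩
  exact ⟨isSpherePacking_stripConfiguration hu, isPerspective_stripConfiguration hu⟩
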